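/- **Setting.** Fix $p,k\ge 0$. For $t=1,2,\dots$ let $y=X\beta+Zv+\varepsilon$ be linear mixed models with $N=N_t\to\infty$ observations, $X$ ($N\times p$), $Z$ ($N\times m$, $m=m_t$), covariance functions $R_e(\psi),R_v(\psi)$ and $\Sigma(\psi)=R_e(\psi)+ZR_v(\psi)Z^\top$, $\psi\in\Theta$, where $\Theta\subset\mathbb R^k$ is open and convex; let $\psi_0\in\Theta$ be the true value. At $\psi_0$: $R_e,R_v$ are positive definite; $\varepsilon$ and $v$ are independent with mean $0$ and covariance matrices $R_e$, $R_v$; the components of $R_e^{-1/2}\varepsilon$ are independent with fourth moment $K_e+3$, those of $R_v^{-1/2}v$ are independent with fourth moment $K_v+3$, and all these components have uniformly bounded sixth moments. No normality is assumed. Let $W_a(\psi)$, $a=1,\dots,k$, be symmetric $N\times N$ matrices. Write $F_{(b)}=\partial F/\partial\psi_b$, $F_{(bc)}=\partial^2F/\partial\psi_b\partial\psi_c$, $W_{a(b)}=\partial W_a/\partial\psi_b$. Assume that $\Sigma$ and $W_a$ are three times continuously differentiable on $\Theta$; that the spectral norms of $\Sigma(\psi_0)$, of the partial derivatives of $\Sigma$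 of orders $1$ to $3$ and of those of $W_a$ of orders $0$ to $3$ are bounded uniformly in $t$ and $\psi\in\Theta$; and that for some $c>0$ and all large $t$, $\max_a|\mathrm{tr}\{W_a(\psi)(\Sigma(\psi)-\Sigma(\psi_0))\}|\ge cN\|\psi-\psi_0\|$ for all $\psi\in\Theta$ (identification; it implies that the matrix $A$ below is invertible with $A^{-1}=O(N^{-1})$). Let $L(\psi)$ be $p\times N$ matrices, three times continuously differentiable in $\psi\in\Theta$, with $L(\psi)X=I$ (so that $\hat\beta=Ly$ is unbiased), such that, uniformly in the indices, $(L^\top X^\top W_aXL)_{ij}=O(N^{-1})$ and $(L\Sigma L^\top)_{ij}=O(N^{-1})$ at $\psi_0$, and $(XL)_{ij}$ and its partial derivatives in $\psi$ up to order $3$ are $O(N^{-1})$ uniformly on $\Theta$. Let $Q=I-XL$. Let $\hat\psi$ be measurable, a solution in $\Theta$ of the equations $$y^\top Q^\top W_aQy-\mathrm{tr}(Q^\top W_aQ\Sigma)=0,\qquad a=1,\dots,k,$$ whenever there is one, and any value in a fixed bounded set otherwise. For matrices $C,D$ put $h_e(C,D)=\sum_{i=1}^N(R_e^{1/2}CR_e^{1/2})_{ii}(R_e^{1/2}DR_e^{1/2})_{ii}$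 and $h_v(C,D)=\sum_{i=1}^m(R_v^{1/2}Z^\top CZR_v^{1/2})_{ii}(R_v^{1/2}Z^\top DZR_v^{1/2})_{ii}$, and, at $\psi=\psi_0$, $$A_{ab}=\mathrm{tr}(W_a\Sigma_{(b)}),\quad B_{ab}=\mathrm{tr}(W_a\Sigma W_b\Sigma),\quad \tilde B_{ab}=K_eh_e(W_a,W_b)+K_vh_v(W_a,W_b),$$ $$(K_a)_{bc}=\mathrm{tr}(W_{a(b)}\Sigma W_c\Sigma),\quad (H_a)_{bc}=\mathrm{tr}(W_{a(b)}\Sigma_{(c)})+\tfrac12\mathrm{tr}(W_a\Sigma_{(bc)}),\quad (\tilde K_a)_{bc}=K_eh_e(W_{a(b)},W_c)+K_vh_v(W_{a(b)},W_c).$$ **Theorem.** For all large $t$, $A$ is invertible and $\hat\psi$ has finite second moments; and as $t\to\infty$, with $A^{-\top}=(A^{-1})^\top$ and $\mathrm{col}_a(x_a)=(x_1,\dots,x_k)^\top$, $$\mathrm{Cov}(\hat\psi)=2A^{-1}BA^{-\top}+A^{-1}\tilde BA^{-\top}+O(N^{-3/2}),$$ $$E(\hat\psi-\psi_0)=2A^{-1}\mathrm{col}_a\,\mathrm{tr}(K_aA^{-\top}-H_aA^{-1}BA^{-\top})+A^{-1}\mathrm{col}_a\,\mathrm{tr}(\tilde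 K_aA^{-\top}-H_aA^{-1}\tilde BA^{-\top})+O(N^{-3/2}).$$ In particular neither leading term depends on $L$: for two choices of $L$ as above (for example those of GLS and OLS, when they satisfy these conditions), the covariance matrices and the biases of the two estimators differ by $O(N^{-3/2})$. (If $A$ is symmetric, $A^{-\top}=A^{-1}$.) -/

import Mathlib

open MeasureTheory ProbabilityTheory Filter Matrix
open scoped MatrixOrder

/-- Entrywise partial derivative `∂_b F` of a matrix-valued function of `ψ ∈ ℝᵏ`. -/
noncomputable def pderiv {k : ℕ} {ι κ : Type} (b : Fin k)
    (F : (Fin k → ℝ) → Matrix ι κ ℝ) : (Fin k → ℝ) → Matrix ι κ ℝ :=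
  fun ψ => Matrix.of fun i j => lineDeriv ℝ (fun θ => F θ i j) ψ (Pi.single b 1)

/-- Iterated partial derivative; the empty list gives `F` itself. -/
noncomputable def pderivs {k : ℕ} {ι κ : Type} (s : List (Fin k))
    (F : (Fin k → ℝ) → Matrix ι κ ℝ) : (Fin k → ℝ) → Matrix ι κ ℝ :=
  s.foldr pderiv F

/-- Spectral norm (operator norm for the Euclidean norm). -/
noncomputable def specNorm {n : ℕ} (F : Matrix (Fin n) (Fin n) ℝ) : ℝ :=
  ‖Matrix.toEuclideanCLM (n := Fin n) (𝕜 := ℝ) F‖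

/-- The known data of a linear mixed model `y = X β + Z v + ε` with `N` observations,
`m` random effects, `p` regression coefficients and a `k`-dimensional parameter `ψ`:
the matrices `X`, `Z`, and the covariance functions `R_e(ψ)`, `R_v(ψ)`. -/
structure MixedModel (N m p k : ℕ) where
  X : Matrix (Fin N) (Fin p) ℝ
  Z : Matrix (Fin N) (Fin m) ℝ
  Re : (Fin k → ℝ) → Matrix (Fin N) (Fin N) ℝ
  Rv : (Fin k → ℝ) → Matrix (Fin m) (Fin m) ℝ

/-- A family of weight matrices `W_a(ψ)`, `a = 1, …, k`. -/
abbrev Weights (N k : ℕ) := Fin k → (Fin k → ℝ) → Matrix (Fin N) (Fin N) ℝ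

namespace MixedModel

variable {N m p k : ℕ} (M : MixedModel N m p k) (W : Weights N k)

/-- `Σ(ψ) = R_e(ψ) + Z R_v(ψ) Zᵀ`. -/
def Sig (ψ : Fin k → ℝ) : Matrix (Fin N) (Fin N) ℝ :=
  M.Re ψ + M.Z * M.Rv ψ * M.Zᵀ

/-- `h_e(C, D)`. -/
noncomputable def he (ψ : Fin k → ℝ) (C D : Matrix (Fin N) (Fin N) ℝ) : ℝ :=
  ∑ i, (CFC.sqrt (M.Re ψ) * C * CFC.sqrt (M.Re ψ)) i i *
    (CFC.sqrt (M.Re ψ) * D * CFC.sqrt (M.Re ψ)) i i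

/-- `h_v(C, D)`. -/
noncomputable def hv (ψ : Fin k → ℝ) (C D : Matrix (Fin N) (Fin N) ℝ) : ℝ :=
  ∑ i, (CFC.sqrt (M.Rv ψ) * M.Zᵀ * C * M.Z * CFC.sqrt (M.Rv ψ)) i i *
    (CFC.sqrt (M.Rv ψ) * M.Zᵀ * D * M.Z * CFC.sqrt (M.Rv ψ)) i i

/-- `A_{ab} = tr(W_a Σ_(b))`. -/
noncomputable def A (ψ : Fin k → ℝ) : Matrix (Fin k) (Fin k) ℝ :=
  Matrix.of fun a b => (W a ψ * pderiv b M.Sig ψ).trace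

/-- `B_{ab} = tr(W_a Σ W_b Σ)`. -/
noncomputable def B (ψ : Fin k → ℝ) : Matrix (Fin k) (Fin k) ℝ :=
  Matrix.of fun a b => (W a ψ * M.Sig ψ * W b ψ * M.Sig ψ).trace

/-- `B̃_{ab} = K_e h_e(W_a, W_b) + K_v h_v(W_a, W_b)`. -/
noncomputable def Bt (Ke Kv : ℝ) (ψ : Fin k → ℝ) : Matrix (Fin k) (Fin k) ℝ :=
  Matrix.of fun a b => Ke * M.he ψ (W a ψ) (W b ψ) + Kv * M.hv ψ (W a ψ) (W b ψ)

/-- `(K_a)_{bc} = tr(W_{a(b)} Σ W_c Σ)`. -/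
noncomputable def K (ψ : Fin k → ℝ) (a : Fin k) : Matrix (Fin k) (Fin k) ℝ :=
  Matrix.of fun b c => (pderiv b (W a) ψ * M.Sig ψ * W c ψ * M.Sig ψ).trace

/-- `(H_a)_{bc} = tr(W_{a(b)} Σ_(c)) + tr(W_a Σ_(bc)) / 2`. -/
noncomputable def H (ψ : Fin k → ℝ) (a : Fin k) : Matrix (Fin k) (Fin k) ℝ :=
  Matrix.of fun b c => (pderiv b (W a) ψ * pderiv c M.Sig ψ).trace
    + (W a ψ * pderiv b (pderiv c M.Sig) ψ).trace / 2

/-- `(K̃_a)_{bc} = K_e h_e(W_{a(b)}, W_c) + K_v h_v(W_{a(b)}, W_c)`. -/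
noncomputable def Kt (Ke Kv : ℝ) (ψ : Fin k → ℝ) (a : Fin k) : Matrix (Fin k) (Fin k) ℝ :=
  Matrix.of fun b c => Ke * M.he ψ (pderiv b (W a) ψ) (W c ψ)
    + Kv * M.hv ψ (pderiv b (W a) ψ) (W c ψ)

/-- The leading term `2 A⁻¹ B A⁻ᵀ + A⁻¹ B̃ A⁻ᵀ` of the covariance matrix. -/
noncomputable def asympCov (Ke Kv : ℝ) (ψ : Fin k → ℝ) : Matrix (Fin k) (Fin k) ℝ :=
  (2 : ℝ) • ((M.A W ψ)⁻¹ * M.B W ψ * ((M.A W ψ)⁻¹)ᵀ)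
    + (M.A W ψ)⁻¹ * M.Bt W Ke Kv ψ * ((M.A W ψ)⁻¹)ᵀ

/-- The leading term of the bias,
`2 A⁻¹ col_a{tr(K_a A⁻ᵀ - H_a A⁻¹ B A⁻ᵀ)} + A⁻¹ col_a{tr(K̃_a A⁻ᵀ - H_a A⁻¹ B̃ A⁻ᵀ)}`. -/
noncomputable def asympBias (Ke Kv : ℝ) (ψ : Fin k → ℝ) : Fin k → ℝ :=
  (2 : ℝ) • ((M.A W ψ)⁻¹ *ᵥ fun a =>
      (M.K W ψ a * ((M.A W ψ)⁻¹)ᵀ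
        - M.H W ψ a * (M.A W ψ)⁻¹ * M.B W ψ * ((M.A W ψ)⁻¹)ᵀ).trace)
    + (M.A W ψ)⁻¹ *ᵥ fun a =>
      (M.Kt W Ke Kv ψ a * ((M.A W ψ)⁻¹)ᵀ
        - M.H W ψ a * (M.A W ψ)⁻¹ * M.Bt W Ke Kv ψ * ((M.A W ψ)⁻¹)ᵀ).trace

/-- The observation `y = X β + Z v + ε`. -/
def obs (β : Fin p → ℝ) (ε : Fin N → ℝ) (v : Fin m → ℝ) : Fin N → ℝ :=
  M.X *ᵥ β + M.Z *ᵥ v + ε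

/-- `Q = I - X L`. -/
def Q (L : (Fin k → ℝ) → Matrix (Fin p) (Fin N) ℝ) (ψ : Fin k → ℝ) :
    Matrix (Fin N) (Fin N) ℝ :=
  1 - M.X * L ψ

/-- `ψ` solves the estimating equations
`yᵀ Qᵀ W_a Q y - tr(Qᵀ W_a Q Σ) = 0`, `a = 1, …, k`, where `Q`, `W_a`, `Σ` are taken at `ψ`. -/
def Solves (L : (Fin k → ℝ) → Matrix (Fin p) (Fin N) ℝ) (y : Fin N → ℝ)
    (ψ : Fin k → ℝ) : Prop :=
  ∀ a, y ⬝ᵥ (((M.Q L ψ)ᵀ * W a ψ * M.Q L ψ) *ᵥ y)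
    - ((M.Q L ψ)ᵀ * W a ψ * M.Q L ψ * M.Sig ψ).trace = 0

/-- Distribution of the errors `ε` and the random effects `v` when the true parameter is `ψ`:
`ε` and `v` are independent, centred, with covariance matrices `R_e(ψ)` and `R_v(ψ)`; the
components of `R_e^{-1/2} ε` are independent with fourth moments `K_e + 3`, those of
`R_v^{-1/2} v` are independent with fourth moments `K_v + 3`, and all of them have sixth moments
at most `S`. -/
structure ErrorLaw {Ω : Type*} [MeasurableSpace Ω] (μ : Measure Ω) (ψ : Fin k → ℝ)
    (Ke Kv S : ℝ) (ε : Ω → Fin N → ℝ) (v : Ω → Fin m → ℝ) : Prop where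
  posDef_e : (M.Re ψ).PosDef
  posDef_v : (M.Rv ψ).PosDef
  measurable_e : Measurable ε
  measurable_v : Measurable v
  indep : IndepFun ε v μ
  mean_e : ∀ i, ∫ ω, ε ω i ∂μ = 0
  mean_v : ∀ i, ∫ ω, v ω i ∂μ = 0
  cov_e : ∀ i j, ∫ ω, ε ω i * ε ω j ∂μ = M.Re ψ i j
  cov_v : ∀ i j, ∫ ω, v ω i * v ω j ∂μ = M.Rv ψ i j
  indep_e : iIndepFun (fun i ω => ((CFC.sqrt (M.Re ψ))⁻¹ *ᵥ ε ω) i) μ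
  indep_v : iIndepFun (fun i ω => ((CFC.sqrt (M.Rv ψ))⁻¹ *ᵥ v ω) i) μ
  memLp_e : ∀ i, MemLp (fun ω => ((CFC.sqrt (M.Re ψ))⁻¹ *ᵥ ε ω) i) 6 μ
  memLp_v : ∀ i, MemLp (fun ω => ((CFC.sqrt (M.Rv ψ))⁻¹ *ᵥ v ω) i) 6 μ
  fourth_e : ∀ i, ∫ ω, ((CFC.sqrt (M.Re ψ))⁻¹ *ᵥ ε ω) i ^ 4 ∂μ = Ke + 3
  fourth_v : ∀ i, ∫ ω, ((CFC.sqrt (M.Rv ψ))⁻¹ *ᵥ v ω) i ^ 4 ∂μ = Kv + 3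
  sixth_e : ∀ i, ∫ ω, ((CFC.sqrt (M.Re ψ))⁻¹ *ᵥ ε ω) i ^ 6 ∂μ ≤ S
  sixth_v : ∀ i, ∫ ω, ((CFC.sqrt (M.Rv ψ))⁻¹ *ᵥ v ω) i ^ 6 ∂μ ≤ S

end MixedModel

/-- Regularity of a sequence of models and weights on the parameter set `Θ`, with true value `ψ₀`:
the weights are symmetric, `Σ` and `W_a` are three times continuously differentiable with
uniformly bounded spectral norms, and the estimating equations identify `ψ₀`. -/
structure RegularModels {p k : ℕ} (N m : ℕ → ℕ) (M : ∀ t, MixedModel (N t) (m t) p k)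
    (W : ∀ t, Weights (N t) k) (Θ : Set (Fin k → ℝ)) (ψ₀ : Fin k → ℝ) : Prop where
  symm_W : ∀ t a, ∀ ψ ∈ Θ, (W t a ψ).IsSymm
  smooth_Sig : ∀ t i j, ContDiffOn ℝ 3 (fun ψ => (M t).Sig ψ i j) Θ
  smooth_W : ∀ t a i j, ContDiffOn ℝ 3 (fun ψ => W t a ψ i j) Θ
  bound_Sig₀ : ∃ c : ℝ, ∀ t, specNorm ((M t).Sig ψ₀) ≤ c
  bound_dSig : ∃ c : ℝ, ∀ t, ∀ s : List (Fin k), 1 ≤ s.length → s.length ≤ 3 → ∀ ψ ∈ Θ,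
    specNorm (pderivs s (M t).Sig ψ) ≤ c
  bound_W : ∃ c : ℝ, ∀ t a, ∀ s : List (Fin k), s.length ≤ 3 → ∀ ψ ∈ Θ,
    specNorm (pderivs s (W t a) ψ) ≤ c
  ident : ∃ c : ℝ, 0 < c ∧ ∀ᶠ t in atTop, ∀ ψ ∈ Θ,
    c * N t * ‖ψ - ψ₀‖ ≤ ‖fun a => (W t a ψ * ((M t).Sig ψ - (M t).Sig ψ₀)).trace‖

/-- `β̂ = L(ψ) y` is a linear unbiased estimator of `β`, smooth in `ψ`, subject to the order
conditions `(XL)_{ij} = O(N⁻¹)` (for `XL` and its partial derivatives up to the third order),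
`(Lᵀ Xᵀ W_a X L)_{ij} = O(N⁻¹)` and `L Σ Lᵀ = O(N⁻¹)`. -/
structure AdmissibleL {p k : ℕ} (N m : ℕ → ℕ) (M : ∀ t, MixedModel (N t) (m t) p k)
    (W : ∀ t, Weights (N t) k) (Θ : Set (Fin k → ℝ)) (ψ₀ : Fin k → ℝ)
    (L : ∀ t, (Fin k → ℝ) → Matrix (Fin p) (Fin (N t)) ℝ) : Prop where
  unbiased : ∀ t, ∀ ψ ∈ Θ, L t ψ * (M t).X = 1
  smooth : ∀ t i j, ContDiffOn ℝ 3 (fun ψ => L t ψ i j) Θ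
  order_XL : ∃ c : ℝ, ∀ t, ∀ s : List (Fin k), s.length ≤ 3 → ∀ ψ ∈ Θ, ∀ i j,
    |pderivs s (fun θ => (M t).X * L t θ) ψ i j| ≤ c / N t
  order_W : ∃ c : ℝ, ∀ t a i j,
    |((L t ψ₀)ᵀ * (M t).Xᵀ * W t a ψ₀ * (M t).X * L t ψ₀) i j| ≤ c / N t
  order_Sig : ∃ c : ℝ, ∀ t i j, |(L t ψ₀ * (M t).Sig ψ₀ * (L t ψ₀)ᵀ) i j| ≤ c / N t

/-- `ψ̂` is a solution in `Θ` of the estimating equations with observation `y` whenever there is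
one; on samples without a solution it is set to any value in a fixed bounded set. -/
structure IsEstimator {p k : ℕ} (N m : ℕ → ℕ) (M : ∀ t, MixedModel (N t) (m t) p k)
    (W : ∀ t, Weights (N t) k) (Θ : Set (Fin k → ℝ))
    (L : ∀ t, (Fin k → ℝ) → Matrix (Fin p) (Fin (N t)) ℝ)
    {Ω : ℕ → Type*} [∀ t, MeasurableSpace (Ω t)]
    (y : ∀ t, Ω t → Fin (N t) → ℝ) (ψhat : ∀ t, Ω t → Fin k → ℝ) : Prop where
  measurable : ∀ t, Measurable (ψhat t)
  solves : ∀ t ω, (∃ θ ∈ Θ, (M t).Solves (W t) (L t) (y t ω) θ) →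
    ψhat t ω ∈ Θ ∧ (M t).Solves (W t) (L t) (y t ω) (ψhat t ω)
  fallback : ∃ R : ℝ, ∀ t ω, (¬ ∃ θ ∈ Θ, (M t).Solves (W t) (L t) (y t ω) θ) →
    ‖ψhat t ω‖ ≤ R

/-! Put u = Zv + ε. Since L(ψ)X = I, the matrix Q annihilates X, so the estimating equations involve
y only through u. With V_a = QᵀW_aQ, D(ψ) = Σ(ψ) - Σ(ψ₀) and the random linear functional q(C) =
uᵀCu - tr(CΣ(ψ₀)), they read q(V_a(ψ)) = tr(V_a(ψ)D(ψ)) (`solves_iff_score_eq_zero`). The left side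
is noise; the right side is deterministic and, by identification, of size at least a multiple of N‖ψ
- ψ₀‖.

Noise. q(C) is a centred quadratic form in independent standardized variables. Adding the variables
one at a time gives orthogonal increments, and sixth moments then bound the L³-norm of q(C) by a
multiple of the Frobenius norm of C (`StdFamily.l3Le_quadForm`, `l3Le_centeredQuad`); this is O(√N)
when the spectral norm is bounded. Hence a single random variable z, of order N^{-1/2} in L³,
dominates q(C)/N for the finitely many C that matter: the identity, V_a and its derivatives up to
order two at ψ₀, and V_a on a finite net in Θ (`exists_dominating`). At other parameter values q is
controlled by the mean value theorem and by |q(C)| ≤ ‖C‖(cN + |q(1)|).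

Expansion (`exists_expansion`), a deterministic statement about each sample. Write δ = ψ̂ - ψ₀ and
let d = A⁻¹q(V(ψ₀)) be its first order approximation. If z is below a fixed κ, a quantitative
inverse function argument gives a zero near ψ₀, identification and the net force every zero in Θ to
lie near ψ₀, and Taylor's formula gives δ = O(z), δ - d = O(z²) and (Aδ)_a = q(V_a) + Σ d_b
q(V_{a(b)}) - Σ d_b d_e (H_a)_{be} + O(Nz³). If z > κ, identification or the fallback bound still
gives δ = O(z), and z/κ > 1 makes the same estimates trivial. So they hold on the whole sample
space, and E z³ = O(N^{-3/2}) yields the error terms with no separate bound on the probability of an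
exceptional event.

Irrelevance of L. The entries of XL are O(1/N), so XL and V_a - W_a have bounded Frobenius norm.
Replacing V_a by W_a therefore changes covariances of quadratic forms by O(√N) only, against a main
term of order N. The gradient tr(V_aΣ_(b)) must agree with A up to O(1), and does because XL is
idempotent (`ModelBound.abs_trace_projError_mul_le`). The leading terms are then evaluated with the
covariance formula for quadratic forms (`integral_centeredQuad_mul`). -/

/-! ### Frobenius and spectral norms. -/

section MatrixNorms

variable {n : ℕ}

/-- Frobenius norm. -/
noncomputable def frob (F : Matrix (Fin n) (Fin n) ℝ) : ℝ :=
  ‖WithLp.toLp 2 (fun p : Fin n × Fin n => F p.1 p.2)‖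

lemma frob_nonneg (F : Matrix (Fin n) (Fin n) ℝ) : 0 ≤ frob F := norm_nonneg _

lemma frob_sq (F : Matrix (Fin n) (Fin n) ℝ) : frob F ^ 2 = ∑ i, ∑ j, F i j ^ 2 := by
  rw [frob, EuclideanSpace.real_norm_sq_eq, Fintype.sum_prod_type]

lemma frob_add_le (F G : Matrix (Fin n) (Fin n) ℝ) : frob (F + G) ≤ frob F + frob G := by
  refine le_trans (le_of_eq ?_) (norm_add_le _ _)
  rfl

lemma frob_neg (F : Matrix (Fin n) (Fin n) ℝ) : frob (-F) = frob F := by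
  exact norm_neg (WithLp.toLp 2 (fun p : Fin n × Fin n => F p.1 p.2))

lemma frob_transpose (F : Matrix (Fin n) (Fin n) ℝ) : frob Fᵀ = frob F := by
  rw [← sq_eq_sq₀ (frob_nonneg _) (frob_nonneg _), frob_sq, frob_sq, Finset.sum_comm]
  rfl

/-- Cauchy–Schwarz for the inner product of F and Gᵀ. A trace costs N when both factors are bounded
only in spectral norm, √N when one is bounded in Frobenius norm, and nothing when both are. -/
lemma abs_trace_mul_le (F G : Matrix (Fin n) (Fin n) ℝ) :
    |(F * G).trace| ≤ frob F * frob G := by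
  rw [← frob_transpose G]
  refine le_trans (le_of_eq ?_) (abs_real_inner_le_norm
    (WithLp.toLp 2 (fun p : Fin n × Fin n => F p.1 p.2))
    (WithLp.toLp 2 (fun p : Fin n × Fin n => Gᵀ p.1 p.2)))
  rw [EuclideanSpace.inner_eq_star_dotProduct]
  simp only [Matrix.trace, Matrix.diag, Matrix.mul_apply, dotProduct, Fintype.sum_prod_type]
  congr 1
  refine Finset.sum_congr rfl fun i _ => Finset.sum_congr rfl fun j _ => ?_
  simp [mul_comm]

lemma specNorm_nonneg (F : Matrix (Fin n) (Fin n) ℝ) : 0 ≤ specNorm F := norm_nonneg _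

lemma specNorm_add_le (F G : Matrix (Fin n) (Fin n) ℝ) :
    specNorm (F + G) ≤ specNorm F + specNorm G := by
  rw [specNorm, map_add]
  exact norm_add_le _ _

lemma specNorm_mul_le (F G : Matrix (Fin n) (Fin n) ℝ) :
    specNorm (F * G) ≤ specNorm F * specNorm G := by
  rw [specNorm, map_mul]
  exact norm_mul_le _ _

lemma specNorm_neg (F : Matrix (Fin n) (Fin n) ℝ) : specNorm (-F) = specNorm F := by
  rw [specNorm, map_neg, norm_neg, specNorm]

lemma specNorm_zero : specNorm (0 : Matrix (Fin n) (Fin n) ℝ) = 0 := by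
  rw [specNorm, map_zero, norm_zero]

lemma specNorm_transpose (F : Matrix (Fin n) (Fin n) ℝ) : specNorm Fᵀ = specNorm F := by
  have : Fᵀ = star F := by ext; simp [Matrix.star_apply]
  rw [this, specNorm, map_star, ContinuousLinearMap.star_eq_adjoint, LinearIsometryEquiv.norm_map,
    specNorm]

lemma specNorm_one_le : specNorm (1 : Matrix (Fin n) (Fin n) ℝ) ≤ 1 := by
  rw [specNorm, map_one]
  exact ContinuousLinearMap.norm_id_le

lemma sum_mulVec_sq_le (F : Matrix (Fin n) (Fin n) ℝ) (x : Fin n → ℝ) :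
    ∑ i, (F *ᵥ x) i ^ 2 ≤ specNorm F ^ 2 * ∑ i, x i ^ 2 := by
  have h := (Matrix.toEuclideanCLM (n := Fin n) (𝕜 := ℝ) F).le_opNorm (WithLp.toLp 2 x)
  rw [toEuclideanCLM_toLp] at h
  have h2 := pow_le_pow_left₀ (norm_nonneg _) h 2
  rw [mul_pow, EuclideanSpace.real_norm_sq_eq, EuclideanSpace.real_norm_sq_eq] at h2
  exact h2

lemma abs_dotProduct_mulVec_le (F : Matrix (Fin n) (Fin n) ℝ) (x : Fin n → ℝ) :
    |x ⬝ᵥ (F *ᵥ x)| ≤ specNorm F * ∑ i, x i ^ 2 := by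
  rw [← inner_toEuclideanCLM F (WithLp.toLp 2 x) (WithLp.toLp 2 x)]
  refine (abs_real_inner_le_norm _ _).trans ?_
  have h := (Matrix.toEuclideanCLM (n := Fin n) (𝕜 := ℝ) F).le_opNorm (WithLp.toLp 2 x)
  have e : ∑ i, x i ^ 2 = ‖WithLp.toLp 2 x‖ * ‖WithLp.toLp 2 x‖ := by
    rw [← sq, EuclideanSpace.real_norm_sq_eq]
  rw [e, specNorm]
  nlinarith [mul_le_mul_of_nonneg_left h (norm_nonneg (WithLp.toLp 2 x))]

/-- A bound of the bilinear form `xᵀ F y` bounds the spectral norm. -/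
lemma specNorm_le_of_bilin {F : Matrix (Fin n) (Fin n) ℝ} {c : ℝ} (hc : 0 ≤ c)
    (h : ∀ x y : Fin n → ℝ,
      |x ⬝ᵥ (F *ᵥ y)| ≤ c * (‖WithLp.toLp 2 x‖ * ‖WithLp.toLp 2 y‖)) :
    specNorm F ≤ c := by
  refine ContinuousLinearMap.opNorm_le_bound _ hc fun y => ?_
  -- Testing the form at x = Fy turns it into ‖Fy‖².
  have := h (F *ᵥ y.ofLp) y.ofLp
  set z := Matrix.toEuclideanCLM (n := Fin n) (𝕜 := ℝ) F y with hz
  have e : (F *ᵥ y.ofLp) ⬝ᵥ (F *ᵥ y.ofLp) = ‖z‖ * ‖z‖ := by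
    rw [← real_inner_self_eq_norm_mul_norm, hz, inner_toEuclideanCLM]
    rfl
  have e2 : WithLp.toLp 2 (F *ᵥ y.ofLp) = z := rfl
  have e3 : WithLp.toLp 2 y.ofLp = y := rfl
  rw [e, e2, e3, abs_of_nonneg (by positivity)] at this
  rcases (norm_nonneg z).eq_or_lt with h0 | h0
  · rw [← h0]; positivity
  · nlinarith

lemma specNorm_bilin_le (F : Matrix (Fin n) (Fin n) ℝ) (x y : Fin n → ℝ) :
    |x ⬝ᵥ (F *ᵥ y)| ≤ specNorm F * (‖WithLp.toLp 2 x‖ * ‖WithLp.toLp 2 y‖) := by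
  rw [← inner_toEuclideanCLM F (WithLp.toLp 2 x) (WithLp.toLp 2 y)]
  refine (abs_real_inner_le_norm _ _).trans ?_
  have h := (Matrix.toEuclideanCLM (n := Fin n) (𝕜 := ℝ) F).le_opNorm (WithLp.toLp 2 y)
  rw [specNorm]
  nlinarith [mul_le_mul_of_nonneg_left h (norm_nonneg (WithLp.toLp 2 x))]

lemma frob_mul_le_specNorm_mul (F G : Matrix (Fin n) (Fin n) ℝ) :
    frob (F * G) ≤ specNorm F * frob G := by
  refine abs_le_of_sq_le_sq' ?_ (mul_nonneg (specNorm_nonneg _) (frob_nonneg _)) |>.2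
  rw [mul_pow, frob_sq, frob_sq, Finset.sum_comm, Finset.sum_comm (f := fun i j => G i j ^ 2),
    Finset.mul_sum]
  refine Finset.sum_le_sum fun j _ => ?_
  exact sum_mulVec_sq_le F (fun i => G i j)

lemma frob_mul_le_mul_specNorm (F G : Matrix (Fin n) (Fin n) ℝ) :
    frob (F * G) ≤ frob F * specNorm G := by
  rw [← frob_transpose, Matrix.transpose_mul, ← frob_transpose F, ← specNorm_transpose G, mul_comm]
  exact frob_mul_le_specNorm_mul _ _

lemma frob_one : frob (1 : Matrix (Fin n) (Fin n) ℝ) = √n := by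
  rw [eq_comm, Real.sqrt_eq_iff_mul_self_eq (by positivity) (frob_nonneg _), ← sq, frob_sq]
  simp [Matrix.one_apply]

lemma frob_le_sqrt_mul_specNorm (F : Matrix (Fin n) (Fin n) ℝ) :
    frob F ≤ √n * specNorm F := by
  have := frob_mul_le_specNorm_mul F 1
  rwa [mul_one, frob_one, mul_comm] at this

lemma abs_trace_mul_le_specNorm (F G : Matrix (Fin n) (Fin n) ℝ) :
    |(F * G).trace| ≤ n * (specNorm F * specNorm G) := by
  refine (abs_trace_mul_le F G).trans ((mul_le_mul (frob_le_sqrt_mul_specNorm F)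
    (frob_le_sqrt_mul_specNorm G) (frob_nonneg _)
    (mul_nonneg (by positivity) (specNorm_nonneg _))).trans (le_of_eq ?_))
  have := Real.mul_self_sqrt (Nat.cast_nonneg (α := ℝ) n)
  linear_combination (specNorm F * specNorm G) * this

lemma abs_trace_le_specNorm (F : Matrix (Fin n) (Fin n) ℝ) :
    |F.trace| ≤ n * specNorm F := by
  have h := abs_trace_mul_le_specNorm F 1
  rw [mul_one] at h
  refine h.trans (mul_le_mul_of_nonneg_left ?_ (by positivity))
  have := mul_le_mul_of_nonneg_left (specNorm_one_le (n := n)) (specNorm_nonneg F)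
  linarith

lemma specNorm_le_frob (F : Matrix (Fin n) (Fin n) ℝ) : specNorm F ≤ frob F := by
  refine ContinuousLinearMap.opNorm_le_bound _ (frob_nonneg _) fun y => ?_
  refine abs_le_of_sq_le_sq' ?_ (mul_nonneg (frob_nonneg _) (norm_nonneg _)) |>.2
  rw [mul_pow, frob_sq, EuclideanSpace.real_norm_sq_eq, EuclideanSpace.real_norm_sq_eq,
    Finset.sum_mul]
  refine Finset.sum_le_sum fun i _ => ?_
  exact Finset.sum_mul_sq_le_sq_mul_sq Finset.univ (F i) y.ofLp

/-- There are n² entries of size 1/n. This is how the order condition on XL becomes a Frobenius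
bound. The absolute value covers n = 0, where the hypothesis is vacuous and c may be negative. -/
lemma frob_le_of_entries {F : Matrix (Fin n) (Fin n) ℝ} {c : ℝ}
    (h : ∀ i j, |F i j| ≤ c / n) : frob F ≤ |c| := by
  refine abs_le_of_sq_le_sq' ?_ (abs_nonneg _) |>.2
  rw [frob_sq]
  rcases Nat.eq_zero_or_pos n with rfl | hn
  · simp; positivity
  have hn' : (0 : ℝ) < n := by exact_mod_cast hn
  calc ∑ i, ∑ j, F i j ^ 2 ≤ ∑ _i : Fin n, ∑ _j : Fin n, (c / n) ^ 2 :=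
        Finset.sum_le_sum fun i _ => Finset.sum_le_sum fun j _ => sq_le_sq' (by
          have := abs_le.1 (h i j); linarith [this.1]) (abs_le.1 (h i j)).2
    _ = |c| ^ 2 := by
        simp only [Finset.sum_const, Finset.card_univ, Fintype.card_fin, nsmul_eq_mul, sq_abs]
        field_simp

end MatrixNorms

/-! ### Calculus of entrywise partial derivatives. -/

section PartialDerivatives

variable {k : ℕ} {ι κ τ : Type} {U : Set (Fin k → ℝ)}

/-- The entries of `F` are `n` times continuously differentiable on `U`. -/
def EntrySmooth (n : ℕ) (U : Set (Fin k → ℝ)) (F : (Fin k → ℝ) → Matrix ι κ ℝ) : Prop :=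
  ∀ i j, ContDiffOn ℝ n (fun ψ => F ψ i j) U

lemma EntrySmooth.of_le {n n' : ℕ} (h : n' ≤ n) {F : (Fin k → ℝ) → Matrix ι κ ℝ}
    (hF : EntrySmooth n U F) : EntrySmooth n' U F :=
  fun i j => (hF i j).of_le (by exact_mod_cast h)

lemma EntrySmooth.mono {n : ℕ} {U' : Set (Fin k → ℝ)} (h : U' ⊆ U)
    {F : (Fin k → ℝ) → Matrix ι κ ℝ} (hF : EntrySmooth n U F) : EntrySmooth n U' F :=
  fun i j => (hF i j).mono h

lemma EntrySmooth.differentiableAt (hU : IsOpen U) {n : ℕ} {F : (Fin k → ℝ) → Matrix ι κ ℝ}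
    (hF : EntrySmooth (n + 1) U F) {ψ : Fin k → ℝ} (hψ : ψ ∈ U) (i : ι) (j : κ) :
    DifferentiableAt ℝ (fun θ => F θ i j) ψ :=
  ((hF i j).differentiableOn (by simp)).differentiableAt (hU.mem_nhds hψ)

lemma pderiv_apply_eq_fderiv (hU : IsOpen U) {n : ℕ} {F : (Fin k → ℝ) → Matrix ι κ ℝ}
    (hF : EntrySmooth (n + 1) U F) {ψ : Fin k → ℝ} (hψ : ψ ∈ U) (b : Fin k) (i : ι) (j : κ) :
    pderiv b F ψ i j = fderiv ℝ (fun θ => F θ i j) ψ (Pi.single b 1) :=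
  (hF.differentiableAt hU hψ i j).lineDeriv_eq_fderiv

lemma EntrySmooth.hasLineDerivAt (hU : IsOpen U) {n : ℕ} {F : (Fin k → ℝ) → Matrix ι κ ℝ}
    (hF : EntrySmooth (n + 1) U F) {ψ : Fin k → ℝ} (hψ : ψ ∈ U) (b : Fin k) (i : ι) (j : κ) :
    HasLineDerivAt ℝ (fun θ => F θ i j) (pderiv b F ψ i j) ψ (Pi.single b 1) := by
  rw [pderiv_apply_eq_fderiv hU hF hψ]
  exact (hF.differentiableAt hU hψ i j).hasFDerivAt.hasLineDerivAt _

lemma EntrySmooth.smooth_pderiv (hU : IsOpen U) {n : ℕ} {F : (Fin k → ℝ) → Matrix ι κ ℝ}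
    (hF : EntrySmooth (n + 1) U F) (b : Fin k) : EntrySmooth n U (pderiv b F) := by
  intro i j
  have h : ContDiffOn ℝ n (fderiv ℝ (fun θ => F θ i j)) U :=
    (hF i j).fderiv_of_isOpen hU (by norm_cast)
  exact (h.clm_apply contDiffOn_const).congr fun ψ hψ => pderiv_apply_eq_fderiv hU hF hψ b i j

lemma EntrySmooth.mul [Fintype κ] {n : ℕ} {F : (Fin k → ℝ) → Matrix ι κ ℝ}
    {G : (Fin k → ℝ) → Matrix κ τ ℝ} (hF : EntrySmooth n U F) (hG : EntrySmooth n U G) :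
    EntrySmooth n U (fun ψ => F ψ * G ψ) := by
  intro i j
  simp only [Matrix.mul_apply]
  exact ContDiffOn.sum fun l _ => (hF i l).mul (hG l j)

lemma EntrySmooth.add {n : ℕ} {F G : (Fin k → ℝ) → Matrix ι κ ℝ} (hF : EntrySmooth n U F)
    (hG : EntrySmooth n U G) : EntrySmooth n U (fun ψ => F ψ + G ψ) :=
  fun i j => (hF i j).add (hG i j)

lemma EntrySmooth.sub {n : ℕ} {F G : (Fin k → ℝ) → Matrix ι κ ℝ} (hF : EntrySmooth n U F)
    (hG : EntrySmooth n U G) : EntrySmooth n U (fun ψ => F ψ - G ψ) :=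
  fun i j => (hF i j).sub (hG i j)

lemma EntrySmooth.transpose {n : ℕ} {F : (Fin k → ℝ) → Matrix ι κ ℝ} (hF : EntrySmooth n U F) :
    EntrySmooth n U (fun ψ => (F ψ)ᵀ) :=
  fun i j => hF j i

lemma entrySmooth_const {n : ℕ} (F : Matrix ι κ ℝ) : EntrySmooth n U (fun _ => F) :=
  fun _ _ => contDiffOn_const

/-- Openness lets identities valid only on U, such as the product rule, be differentiated again. -/
lemma pderiv_congr (hU : IsOpen U) {F G : (Fin k → ℝ) → Matrix ι κ ℝ} (h : Set.EqOn F G U)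
    (b : Fin k) : Set.EqOn (pderiv b F) (pderiv b G) U := by
  intro ψ hψ
  ext i j
  change lineDeriv ℝ (fun θ => F θ i j) ψ _ = lineDeriv ℝ (fun θ => G θ i j) ψ _
  refine Filter.EventuallyEq.lineDeriv_eq ?_
  filter_upwards [hU.mem_nhds hψ] with θ hθ
  rw [h hθ]

lemma pderiv_const (F : Matrix ι κ ℝ) (b : Fin k) : pderiv b (fun _ => F) = fun _ => 0 := by
  funext ψ
  ext i j
  simp [pderiv, lineDeriv]

lemma pderiv_sub_const (F : (Fin k → ℝ) → Matrix ι κ ℝ) (C : Matrix ι κ ℝ) (b : Fin k) :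
    pderiv b (fun ψ => F ψ - C) = pderiv b F := by
  funext ψ
  ext i j
  simp [pderiv, lineDeriv]

lemma pderiv_add (hU : IsOpen U) {F G : (Fin k → ℝ) → Matrix ι κ ℝ} {n : ℕ}
    (hF : EntrySmooth (n + 1) U F) (hG : EntrySmooth (n + 1) U G) (b : Fin k) :
    Set.EqOn (pderiv b (fun ψ => F ψ + G ψ)) (fun ψ => pderiv b F ψ + pderiv b G ψ) U := by
  intro ψ hψ
  ext i j
  have h : HasLineDerivAt ℝ (fun θ => (F θ + G θ) i j) (pderiv b F ψ i j + pderiv b G ψ i j) ψ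
      (Pi.single b 1) :=
    HasDerivAt.add (f := fun t : ℝ => F (ψ + t • Pi.single b 1) i j)
      (g := fun t : ℝ => G (ψ + t • Pi.single b 1) i j)
      (hF.hasLineDerivAt hU hψ b i j) (hG.hasLineDerivAt hU hψ b i j)
  exact h.lineDeriv

lemma pderiv_mul [Fintype κ] (hU : IsOpen U) {F : (Fin k → ℝ) → Matrix ι κ ℝ}
    {G : (Fin k → ℝ) → Matrix κ τ ℝ} {n : ℕ}
    (hF : EntrySmooth (n + 1) U F) (hG : EntrySmooth (n + 1) U G) (b : Fin k) :
    Set.EqOn (pderiv b (fun ψ => F ψ * G ψ))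
      (fun ψ => pderiv b F ψ * G ψ + F ψ * pderiv b G ψ) U := by
  intro ψ hψ
  ext i j
  have h := HasDerivAt.fun_sum (u := Finset.univ) fun l _ =>
    HasDerivAt.mul (hF.hasLineDerivAt hU hψ b i l) (hG.hasLineDerivAt hU hψ b l j)
  have h' : HasLineDerivAt ℝ (fun θ => (F θ * G θ) i j)
      (∑ l, (pderiv b F ψ i l * G ψ l j + F ψ i l * pderiv b G ψ l j)) ψ (Pi.single b 1) := by
    simpa [HasLineDerivAt, Matrix.mul_apply] using h
  refine h'.lineDeriv.trans ?_
  simp only [Matrix.add_apply, Matrix.mul_apply, Finset.sum_add_distrib]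

end PartialDerivatives

/-! ### Uniform bounds for derivatives of matrix functions. -/

section DerivativeBounds

variable {k N : ℕ} {U : Set (Fin k → ℝ)} {ν : Matrix (Fin N) (Fin N) ℝ → ℝ}

/-- All partial derivatives of `F` of order at most `n` have `ν` at most `c` on `U`. -/
def DerivBound (ν : Matrix (Fin N) (Fin N) ℝ → ℝ) (U : Set (Fin k → ℝ)) :
    ℕ → ((Fin k → ℝ) → Matrix (Fin N) (Fin N) ℝ) → ℝ → Prop
  | 0, F, c => ∀ ψ ∈ U, ν (F ψ) ≤ c
  | n + 1, F, c => (∀ ψ ∈ U, ν (F ψ) ≤ c) ∧ ∀ b, DerivBound ν U n (pderiv b F) c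

lemma DerivBound.le {n : ℕ} {F : (Fin k → ℝ) → Matrix (Fin N) (Fin N) ℝ} {c : ℝ}
    (h : DerivBound ν U n F c) {ψ : Fin k → ℝ} (hψ : ψ ∈ U) : ν (F ψ) ≤ c := by
  cases n with
  | zero => exact h ψ hψ
  | succ n => exact h.1 ψ hψ

lemma DerivBound.bound_pderiv {n : ℕ} {F : (Fin k → ℝ) → Matrix (Fin N) (Fin N) ℝ} {c : ℝ}
    (h : DerivBound ν U (n + 1) F c) (b : Fin k) : DerivBound ν U n (pderiv b F) c := h.2 b

lemma DerivBound.pred {n : ℕ} {F : (Fin k → ℝ) → Matrix (Fin N) (Fin N) ℝ} {c : ℝ}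
    (h : DerivBound ν U (n + 1) F c) : DerivBound ν U n F c := by
  induction n generalizing F with
  | zero => exact h.1
  | succ n ih => exact ⟨h.1, fun b => ih (h.2 b)⟩

lemma DerivBound.weaken {n : ℕ} {F : (Fin k → ℝ) → Matrix (Fin N) (Fin N) ℝ} {c c' : ℝ}
    {U' : Set (Fin k → ℝ)} (hU : U' ⊆ U) (hc : c ≤ c')
    (h : DerivBound ν U n F c) : DerivBound ν U' n F c' := by
  induction n generalizing F with
  | zero => exact fun ψ hψ => (h ψ (hU hψ)).trans hc
  | succ n ih => exact ⟨fun ψ hψ => (h.1 ψ (hU hψ)).trans hc, fun b => ih (h.2 b)⟩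

lemma DerivBound.norm_mono {n : ℕ} {F : (Fin k → ℝ) → Matrix (Fin N) (Fin N) ℝ} {c : ℝ}
    {ν' : Matrix (Fin N) (Fin N) ℝ → ℝ} (hν : ∀ F, ν' F ≤ ν F)
    (h : DerivBound ν U n F c) : DerivBound ν' U n F c := by
  induction n generalizing F with
  | zero => exact fun ψ hψ => (hν _).trans (h ψ hψ)
  | succ n ih => exact ⟨fun ψ hψ => (hν _).trans (h.1 ψ hψ), fun b => ih (h.2 b)⟩

lemma DerivBound.congr (hU : IsOpen U) {n : ℕ} {F G : (Fin k → ℝ) → Matrix (Fin N) (Fin N) ℝ}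
    {c : ℝ} (hFG : Set.EqOn F G U) (h : DerivBound ν U n F c) : DerivBound ν U n G c := by
  induction n generalizing F G with
  | zero => exact fun ψ hψ => hFG hψ ▸ h ψ hψ
  | succ n ih =>
    exact ⟨fun ψ hψ => hFG hψ ▸ h.1 ψ hψ, fun b => ih (pderiv_congr hU hFG b) (h.2 b)⟩

lemma derivBound_of_pderivs {n : ℕ} {F : (Fin k → ℝ) → Matrix (Fin N) (Fin N) ℝ} {c : ℝ}
    (h : ∀ s : List (Fin k), s.length ≤ n → ∀ ψ ∈ U, ν (pderivs s F ψ) ≤ c) :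
    DerivBound ν U n F c := by
  induction n generalizing F with
  | zero => exact fun ψ hψ => h [] le_rfl ψ hψ
  | succ n ih =>
    refine ⟨fun ψ hψ => h [] (Nat.zero_le _) ψ hψ, fun b => ih fun s hs ψ hψ => ?_⟩
    -- `pderivs` folds from the right, so the last entry of the list is the derivative taken first.
    have := h (s ++ [b]) (by simpa using hs) ψ hψ
    rwa [pderivs, List.foldr_append] at this

lemma DerivBound.add (hU : IsOpen U) (hν : ∀ F G, ν (F + G) ≤ ν F + ν G) {n : ℕ}
    {F G : (Fin k → ℝ) → Matrix (Fin N) (Fin N) ℝ} {c d : ℝ}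
    (hF : EntrySmooth n U F) (hG : EntrySmooth n U G)
    (h : DerivBound ν U n F c) (h' : DerivBound ν U n G d) :
    DerivBound ν U n (fun ψ => F ψ + G ψ) (c + d) := by
  induction n generalizing F G with
  | zero => exact fun ψ hψ => (hν _ _).trans (add_le_add (h ψ hψ) (h' ψ hψ))
  | succ n ih =>
    exact ⟨fun ψ hψ => (hν _ _).trans (add_le_add (h.1 ψ hψ) (h'.1 ψ hψ)), fun b =>
      (ih (hF.smooth_pderiv hU b) (hG.smooth_pderiv hU b) (h.2 b) (h'.2 b)).congr hU
        (pderiv_add hU hF hG b).symm⟩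

/-- Each differentiation doubles the number of Leibniz terms, whence 2ⁿ. The three norms are
independent so that a Frobenius bound can be multiplied by a spectral one on either side. -/
lemma DerivBound.mul {ν₁ ν₂ : Matrix (Fin N) (Fin N) ℝ → ℝ} (hU : IsOpen U)
    (hν : ∀ F G, ν (F + G) ≤ ν F + ν G) (hm : ∀ F G, ν (F * G) ≤ ν₁ F * ν₂ G)
    (h₂ : ∀ F, 0 ≤ ν₂ F) {n : ℕ}
    {F G : (Fin k → ℝ) → Matrix (Fin N) (Fin N) ℝ} {c d : ℝ} (hc : 0 ≤ c) (hd : 0 ≤ d)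
    (hF : EntrySmooth n U F) (hG : EntrySmooth n U G)
    (h : DerivBound ν₁ U n F c) (h' : DerivBound ν₂ U n G d) :
    DerivBound ν U n (fun ψ => F ψ * G ψ) (2 ^ n * (c * d)) := by
  have key : ∀ {F G : Matrix (Fin N) (Fin N) ℝ}, ν₁ F ≤ c → ν₂ G ≤ d → ν (F * G) ≤ c * d :=
    fun hF hG => (hm _ _).trans (mul_le_mul hF hG (h₂ _) hc)
  induction n generalizing F G with
  | zero => exact fun ψ hψ => by simpa using key (h ψ hψ) (h' ψ hψ)
  | succ n ih =>
    refine ⟨fun ψ hψ => (key (h.1 ψ hψ) (h'.1 ψ hψ)).trans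
      (le_mul_of_one_le_left (by positivity) (one_le_pow₀ (by norm_num))), fun b => ?_⟩
    have e := (ih (hF.smooth_pderiv hU b) (hG.of_le n.le_succ) (h.2 b) h'.pred).add hU hν
      ((hF.smooth_pderiv hU b).mul (hG.of_le n.le_succ))
      ((hF.of_le n.le_succ).mul (hG.smooth_pderiv hU b))
      (ih (hF.of_le n.le_succ) (hG.smooth_pderiv hU b) h.pred (h'.2 b))
    refine (e.congr hU (pderiv_mul hU hF hG b).symm).weaken subset_rfl (le_of_eq ?_)
    ring

lemma DerivBound.transpose (hν : ∀ F, ν Fᵀ = ν F) {n : ℕ}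
    {F : (Fin k → ℝ) → Matrix (Fin N) (Fin N) ℝ} {c : ℝ}
    (h : DerivBound ν U n F c) : DerivBound ν U n (fun ψ => (F ψ)ᵀ) c := by
  induction n generalizing F with
  | zero => exact fun ψ hψ => (hν _).trans_le (h ψ hψ)
  | succ n ih => exact ⟨fun ψ hψ => (hν _).trans_le (h.1 ψ hψ), fun b => ih (h.2 b)⟩

lemma DerivBound.neg (hν : ∀ F, ν (-F) = ν F) {n : ℕ}
    {F : (Fin k → ℝ) → Matrix (Fin N) (Fin N) ℝ} {c : ℝ}
    (h : DerivBound ν U n F c) : DerivBound ν U n (fun ψ => -(F ψ)) c := by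
  have e : ∀ (F : (Fin k → ℝ) → Matrix (Fin N) (Fin N) ℝ) b,
      pderiv b (fun ψ => -(F ψ)) = fun ψ => -(pderiv b F ψ) := by
    intro F b
    funext ψ
    ext i j
    simp [pderiv, lineDeriv]
  induction n generalizing F with
  | zero => exact fun ψ hψ => (hν _).trans_le (h ψ hψ)
  | succ n ih =>
    exact ⟨fun ψ hψ => (hν _).trans_le (h.1 ψ hψ), fun b => by rw [e]; exact ih (h.2 b)⟩

lemma derivBound_const {n : ℕ} {C : Matrix (Fin N) (Fin N) ℝ} {c : ℝ} (h0 : ν 0 ≤ c)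
    (h : ν C ≤ c) : DerivBound ν U n (fun _ => C) c := by
  induction n generalizing C with
  | zero => exact fun _ _ => h
  | succ n ih => exact ⟨fun _ _ => h, fun b => by rw [pderiv_const]; exact ih h0⟩

end DerivativeBounds

/-! ### Mean value and Taylor estimates for linear functionals of matrix functions. -/

section Taylor

variable {k N : ℕ} {U : Set (Fin k → ℝ)}

/-- Reduces derivatives of a functional l(F(ψ)) to those of the entries, so that no topology on
matrices is needed. The functionals of interest are q, the trace and bilinear forms. -/
lemma linearMap_eq_sum_single (l : Matrix (Fin N) (Fin N) ℝ →ₗ[ℝ] ℝ)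
    (F : Matrix (Fin N) (Fin N) ℝ) :
    l F = ∑ i, ∑ j, F i j * l (Matrix.single i j 1) := by
  conv_lhs => rw [Matrix.matrix_eq_sum_single F]
  simp only [map_sum]
  refine Finset.sum_congr rfl fun i _ => Finset.sum_congr rfl fun j _ => ?_
  rw [← smul_eq_mul (F i j), ← map_smul, Matrix.smul_single, smul_eq_mul, mul_one]

lemma EntrySmooth.hasDerivAt_line (hU : IsOpen U) {n : ℕ}
    {F : (Fin k → ℝ) → Matrix (Fin N) (Fin N) ℝ} (hF : EntrySmooth (n + 1) U F)
    (l : Matrix (Fin N) (Fin N) ℝ →ₗ[ℝ] ℝ) {x h : Fin k → ℝ} {s : ℝ} (hs : x + s • h ∈ U) :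
    HasDerivAt (fun s : ℝ => l (F (x + s • h)))
      (∑ b, h b * l (pderiv b F (x + s • h))) s := by
  have h1 : ∀ i j, HasDerivAt (fun s : ℝ => F (x + s • h) i j)
      (∑ b, h b * pderiv b F (x + s • h) i j) s := by
    intro i j
    have hd : HasDerivAt (fun s : ℝ => x + s • h) h s := by
      simpa using ((hasDerivAt_id s).smul_const h).const_add x
    have := (hF.differentiableAt hU hs i j).hasFDerivAt.comp_hasDerivAt s hd
    refine this.congr_deriv ?_
    simp only [pderiv_apply_eq_fderiv hU hF hs]
    conv_lhs => arg 2; rw [pi_eq_sum_univ' h]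
    rw [map_sum]
    refine Finset.sum_congr rfl fun b _ => ?_
    rw [map_smul, smul_eq_mul]
  have h2 := HasDerivAt.fun_sum (u := Finset.univ) fun i _ =>
    HasDerivAt.fun_sum (u := Finset.univ) fun j _ =>
      (h1 i j).mul_const (l (Matrix.single i j 1))
  simp only [← linearMap_eq_sum_single] at h2
  refine h2.congr_deriv ?_
  simp only [linearMap_eq_sum_single l (pderiv _ F _), Finset.sum_mul, Finset.mul_sum]
  rw [eq_comm, Finset.sum_comm]
  refine Finset.sum_congr rfl fun i _ => ?_
  rw [Finset.sum_comm]
  simp only [mul_assoc]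

lemma abs_sum_mul_le {h g : Fin k → ℝ} {C : ℝ} (hg : ∀ b, |g b| ≤ C) :
    |∑ b, h b * g b| ≤ k * C * ‖h‖ := by
  refine (Finset.abs_sum_le_sum_abs _ _).trans ?_
  calc ∑ b, |h b * g b| ≤ ∑ _b : Fin k, ‖h‖ * C := Finset.sum_le_sum fun b _ => by
        rw [abs_mul]
        exact mul_le_mul (norm_le_pi_norm h b) (hg b) (abs_nonneg _) (norm_nonneg _)
    _ = k * C * ‖h‖ := by simp; ring

/-- The mean value inequality applied to the restriction to the segment minus its candidate linear
part. With g a row of A it gives approximate linearity; with g = 0, a Lipschitz bound. -/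
lemma abs_sub_sub_le_of_pderiv_near (hU : IsOpen U) (hc : Convex ℝ U) {n : ℕ}
    {F : (Fin k → ℝ) → Matrix (Fin N) (Fin N) ℝ} (hF : EntrySmooth (n + 1) U F)
    (l : Matrix (Fin N) (Fin N) ℝ →ₗ[ℝ] ℝ) {C : ℝ} {g : Fin k → ℝ}
    (hC : ∀ b, ∀ ψ ∈ U, |l (pderiv b F ψ) - g b| ≤ C) {x y : Fin k → ℝ} (hx : x ∈ U)
    (hy : y ∈ U) :
    |l (F y) - l (F x) - ∑ b, (y - x) b * g b| ≤ k * C * ‖y - x‖ := by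
  have hm : ∀ s ∈ Set.Icc (0 : ℝ) 1, x + s • (y - x) ∈ U := fun s hs =>
    hc.add_smul_sub_mem hx hy hs
  set h := y - x with hh
  have hd : ∀ s ∈ Set.Icc (0 : ℝ) 1, HasDerivAt
      (fun s : ℝ => l (F (x + s • h)) - s * ∑ b, h b * g b)
      (∑ b, h b * (l (pderiv b F (x + s • h)) - g b)) s := fun s hs => by
    refine ((hF.hasDerivAt_line hU l (hm s hs)).sub
      ((hasDerivAt_id s).mul_const (∑ b, h b * g b))).congr_deriv ?_
    simp only [mul_sub, Finset.sum_sub_distrib, one_mul]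
  have := norm_image_sub_le_of_norm_deriv_le_segment_01' (E := ℝ) (C := k * C * ‖h‖)
    (fun s hs => (hd s hs).hasDerivWithinAt)
    (fun s hs => abs_sum_mul_le fun b => hC b _ (hm s (Set.Ico_subset_Icc_self hs)))
  simp only [one_smul, zero_smul, add_zero, one_mul, zero_mul, sub_zero] at this
  rw [hh, add_sub_cancel, ← hh, sub_right_comm] at this
  exact this

lemma abs_sub_le_of_pderiv_bound (hU : IsOpen U) (hc : Convex ℝ U) {n : ℕ}
    {F : (Fin k → ℝ) → Matrix (Fin N) (Fin N) ℝ} (hF : EntrySmooth (n + 1) U F)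
    (l : Matrix (Fin N) (Fin N) ℝ →ₗ[ℝ] ℝ) {C : ℝ}
    (hC : ∀ b, ∀ ψ ∈ U, |l (pderiv b F ψ)| ≤ C) {x y : Fin k → ℝ} (hx : x ∈ U) (hy : y ∈ U) :
    |l (F y) - l (F x)| ≤ k * C * ‖y - x‖ := by
  simpa using abs_sub_sub_le_of_pderiv_near hU hc hF l (g := 0) (by simpa using hC) hx hy

lemma abs_taylor_two_le {f f₁ f₂ f₃ : ℝ → ℝ} {C : ℝ}
    (h₀ : ∀ s ∈ Set.Icc (0 : ℝ) 1, HasDerivAt f (f₁ s) s)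
    (h₁ : ∀ s ∈ Set.Icc (0 : ℝ) 1, HasDerivAt f₁ (f₂ s) s)
    (h₂ : ∀ s ∈ Set.Icc (0 : ℝ) 1, HasDerivAt f₂ (f₃ s) s)
    (h₃ : ∀ s ∈ Set.Icc (0 : ℝ) 1, |f₃ s| ≤ C) :
    |f 1 - f 0 - f₁ 0 - f₂ 0 / 2| ≤ C := by
  have hC : 0 ≤ C := (abs_nonneg _).trans (h₃ 0 (by simp))
  -- Used three times. Integration over a subinterval of [0, 1] preserves the bound C; the factor
  -- 1/6 of Taylor's formula is given away.
  have mv : ∀ {g g' : ℝ → ℝ}, (∀ s ∈ Set.Icc (0 : ℝ) 1, HasDerivAt g (g' s) s) →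
      (∀ s ∈ Set.Icc (0 : ℝ) 1, |g' s| ≤ C) → g 0 = 0 → ∀ s ∈ Set.Icc (0 : ℝ) 1, |g s| ≤ C := by
    intro g g' hg hb h0 s hs
    have := norm_image_sub_le_of_norm_deriv_le_segment' (E := ℝ) (f := g) (f' := g') (C := C)
      (fun s hs => (hg s hs).hasDerivWithinAt) (fun s hs => hb s (Set.Ico_subset_Icc_self hs)) s hs
    rw [h0, sub_zero, sub_zero] at this
    exact this.trans (mul_le_of_le_one_right hC hs.2)
  have e₂ := mv (g := fun s => f₂ s - f₂ 0) (fun s hs => (h₂ s hs).sub_const _) h₃ (by simp)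
  have e₁ := mv (g := fun s => f₁ s - f₁ 0 - s * f₂ 0) (g' := fun s => f₂ s - f₂ 0)
    (fun s hs => by
      have := ((h₁ s hs).sub_const (f₁ 0)).sub ((hasDerivAt_id s).mul_const (f₂ 0))
      exact this.congr_deriv (by simp))
    e₂ (by simp)
  have e₀ := mv (g := fun s => f s - f 0 - s * f₁ 0 - s ^ 2 / 2 * f₂ 0)
    (g' := fun s => f₁ s - f₁ 0 - s * f₂ 0)
    (fun s hs => by
      have := (((h₀ s hs).sub_const (f 0)).sub ((hasDerivAt_id s).mul_const (f₁ 0))).sub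
        ((((hasDerivAt_id s).pow 2).div_const 2).mul_const (f₂ 0))
      refine (this.congr_deriv ?_)
      simp) e₁ (by simp)
  have := e₀ 1 (by simp)
  refine le_of_eq_of_le (congrArg _ ?_) this
  ring

lemma abs_taylor_two_le_of_pderiv_bound (hU : IsOpen U) (hc : Convex ℝ U)
    {F : (Fin k → ℝ) → Matrix (Fin N) (Fin N) ℝ} (hF : EntrySmooth 3 U F)
    (l : Matrix (Fin N) (Fin N) ℝ →ₗ[ℝ] ℝ) {C : ℝ}
    (hC : ∀ a b c, ∀ ψ ∈ U, |l (pderiv a (pderiv b (pderiv c F)) ψ)| ≤ C)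
    {x y : Fin k → ℝ} (hx : x ∈ U) (hy : y ∈ U) :
    |l (F y) - l (F x) - ∑ b, (y - x) b * l (pderiv b F x)
      - (∑ c, (y - x) c * ∑ b, (y - x) b * l (pderiv b (pderiv c F) x)) / 2|
      ≤ k ^ 3 * C * ‖y - x‖ ^ 3 := by
  have hm : ∀ s ∈ Set.Icc (0 : ℝ) 1, x + s • (y - x) ∈ U := fun s hs =>
    hc.add_smul_sub_mem hx hy hs
  set d := y - x with hd
  have h₀ : ∀ s ∈ Set.Icc (0 : ℝ) 1, HasDerivAt (fun s : ℝ => l (F (x + s • d)))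
      (∑ c, d c * l (pderiv c F (x + s • d))) s :=
    fun s hs => hF.hasDerivAt_line (n := 2) hU l (hm s hs)
  have h₁ : ∀ s ∈ Set.Icc (0 : ℝ) 1,
      HasDerivAt (fun s : ℝ => ∑ c, d c * l (pderiv c F (x + s • d)))
        (∑ c, d c * ∑ b, d b * l (pderiv b (pderiv c F) (x + s • d))) s :=
    fun s hs => HasDerivAt.fun_sum fun c _ =>
      ((hF.smooth_pderiv (n := 2) hU c).hasDerivAt_line (n := 1) hU l (hm s hs)).const_mul (d c)
  have h₂ : ∀ s ∈ Set.Icc (0 : ℝ) 1,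
      HasDerivAt (fun s : ℝ => ∑ c, d c * ∑ b, d b * l (pderiv b (pderiv c F) (x + s • d)))
        (∑ c, d c * ∑ b, d b * ∑ a, d a * l (pderiv a (pderiv b (pderiv c F)) (x + s • d))) s :=
    fun s hs => HasDerivAt.fun_sum fun c _ =>
      (HasDerivAt.fun_sum fun b _ =>
        (((hF.smooth_pderiv (n := 2) hU c).smooth_pderiv (n := 1) hU b).hasDerivAt_line (n := 0)
          hU l (hm s hs)).const_mul (d b)).const_mul (d c)
  have h₃ : ∀ s ∈ Set.Icc (0 : ℝ) 1,
      |∑ c, d c * ∑ b, d b * ∑ a, d a * l (pderiv a (pderiv b (pderiv c F)) (x + s • d))|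
        ≤ k ^ 3 * C * ‖d‖ ^ 3 := by
    intro s hs
    refine (abs_sum_mul_le fun c => abs_sum_mul_le fun b => abs_sum_mul_le fun a =>
      hC a b c _ (hm s hs)).trans (le_of_eq ?_)
    ring
  have := abs_taylor_two_le h₀ h₁ h₂ h₃
  simp only [one_smul, zero_smul, add_zero] at this
  rwa [hd, add_sub_cancel, ← hd] at this

/-- Apply the scalar mean value inequality to every bilinear form F ↦ uᵀFw, with constants
proportional to ‖u‖‖w‖. -/
lemma specNorm_sub_le_of_pderiv_bound (hU : IsOpen U) (hc : Convex ℝ U) {n : ℕ}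
    {F : (Fin k → ℝ) → Matrix (Fin N) (Fin N) ℝ} (hF : EntrySmooth (n + 1) U F) {C : ℝ}
    (hC0 : 0 ≤ C) (hC : ∀ b, ∀ ψ ∈ U, specNorm (pderiv b F ψ) ≤ C) {x y : Fin k → ℝ}
    (hx : x ∈ U) (hy : y ∈ U) :
    specNorm (F y - F x) ≤ k * C * ‖y - x‖ := by
  refine specNorm_le_of_bilin (by positivity) fun u w => ?_
  let l : Matrix (Fin N) (Fin N) ℝ →ₗ[ℝ] ℝ :=
    { toFun := fun F => u ⬝ᵥ (F *ᵥ w)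
      map_add' := fun F G => by rw [Matrix.add_mulVec, dotProduct_add]
      map_smul' := fun r F => by rw [Matrix.smul_mulVec, dotProduct_smul]; rfl }
  have := abs_sub_le_of_pderiv_bound hU hc hF l
    (C := C * (‖WithLp.toLp 2 u‖ * ‖WithLp.toLp 2 w‖)) (fun b ψ hψ =>
      (specNorm_bilin_le _ u w).trans (mul_le_mul_of_nonneg_right (hC b ψ hψ) (by positivity)))
      hx hy
  rw [← map_sub] at this
  exact this.trans (le_of_eq (by ring))

end Taylor

/-! ### Third absolute moments. -/

section ThirdMoments

variable {Ω : Type*} [MeasurableSpace Ω] {μ : Measure Ω}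

/-- `f` is integrable with integral `v`. -/
def HasInt (μ : Measure Ω) (f : Ω → ℝ) (v : ℝ) : Prop := Integrable f μ ∧ ∫ ω, f ω ∂μ = v

lemma HasInt.intro {f : Ω → ℝ} {v : ℝ} (h : Integrable f μ) (hv : ∫ ω, f ω ∂μ = v) :
    HasInt μ f v := ⟨h, hv⟩

lemma HasInt.add {f g : Ω → ℝ} {v w : ℝ} (hf : HasInt μ f v) (hg : HasInt μ g w) :
    HasInt μ (fun ω => f ω + g ω) (v + w) :=
  ⟨hf.1.add hg.1, by rw [integral_add hf.1 hg.1, hf.2, hg.2]⟩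

lemma HasInt.const_mul {f : Ω → ℝ} {v : ℝ} (hf : HasInt μ f v) (c : ℝ) :
    HasInt μ (fun ω => c * f ω) (c * v) :=
  ⟨hf.1.const_mul c, by rw [integral_const_mul, hf.2]⟩

lemma HasInt.congr {f g : Ω → ℝ} {v w : ℝ} (hf : HasInt μ f v) (h : ∀ ω, g ω = f ω)
    (hv : w = v) : HasInt μ g w := by
  obtain rfl : g = f := funext h
  exact hv ▸ hf

lemma HasInt.sum {τ : Type*} {s : Finset τ} {f : τ → Ω → ℝ} {v : τ → ℝ}
    (h : ∀ i ∈ s, HasInt μ (f i) (v i)) :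
    HasInt μ (fun ω => ∑ i ∈ s, f i ω) (∑ i ∈ s, v i) :=
  ⟨integrable_finsetSum _ fun i hi => (h i hi).1, by
    rw [integral_finsetSum _ fun i hi => (h i hi).1]
    exact Finset.sum_congr rfl fun i hi => (h i hi).2⟩

lemma HasInt.mul_of_indep {f g : Ω → ℝ} {v w : ℝ} (hf : HasInt μ f v) (hg : HasInt μ g w)
    (h : IndepFun f g μ) : HasInt μ (fun ω => f ω * g ω) (v * w) :=
  ⟨h.integrable_mul hf.1 hg.1, by
    rw [h.integral_fun_mul_eq_mul_integral hf.1.1 hg.1.1, hf.2, hg.2]⟩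

/-- `X` has `L³`-norm at most `a`. -/
structure L3Le (μ : Measure Ω) (X : Ω → ℝ) (a : ℝ) : Prop where
  aesm : AEStronglyMeasurable X μ
  int : Integrable (fun ω => |X ω| ^ 3) μ
  nonneg : 0 ≤ a
  le : ∫ ω, |X ω| ^ 3 ∂μ ≤ a ^ 3

lemma L3Le.memLp {X : Ω → ℝ} {a : ℝ} (h : L3Le μ X a) : MemLp X 3 μ := by
  rw [← integrable_norm_rpow_iff h.aesm (by norm_num) (by norm_num)]
  refine h.int.congr (Eventually.of_forall fun ω => ?_)
  simp only [ENNReal.toReal_ofNat, Real.norm_eq_abs]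
  norm_cast

lemma L3Le.mono {X : Ω → ℝ} {a b : ℝ} (h : L3Le μ X a) (hab : a ≤ b) : L3Le μ X b :=
  ⟨h.aesm, h.int, h.nonneg.trans hab, h.le.trans (pow_le_pow_left₀ h.nonneg hab 3)⟩

lemma L3Le.const_mul {X : Ω → ℝ} {a : ℝ} (h : L3Le μ X a) (c : ℝ) :
    L3Le μ (fun ω => c * X ω) (|c| * a) := by
  have e : (fun ω => |c * X ω| ^ 3) = fun ω => |c| ^ 3 * |X ω| ^ 3 := by
    funext ω; rw [abs_mul, mul_pow]
  refine ⟨h.aesm.const_mul c, e ▸ h.int.const_mul _, mul_nonneg (abs_nonneg _) h.nonneg, ?_⟩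
  rw [e, integral_const_mul, mul_pow]
  exact mul_le_mul_of_nonneg_left h.le (by positivity)

lemma l3Le_one [IsProbabilityMeasure μ] : L3Le μ (fun _ => (1 : ℝ)) 1 :=
  ⟨aestronglyMeasurable_const, by simp, zero_le_one, by simp⟩

lemma l3Le_zero {a : ℝ} (ha : 0 ≤ a) : L3Le μ (fun _ => (0 : ℝ)) a :=
  ⟨aestronglyMeasurable_const, by simp, ha, by simp; positivity⟩

lemma L3Le.ae_eq_zero {X : Ω → ℝ} (h : L3Le μ X 0) : ∀ᵐ ω ∂μ, X ω = 0 := by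
  have h0 : ∫ ω, |X ω| ^ 3 ∂μ = 0 :=
    le_antisymm (h.le.trans (by norm_num)) (integral_nonneg fun ω => by positivity)
  rw [integral_eq_zero_iff_of_nonneg (fun ω => by positivity) h.int] at h0
  filter_upwards [h0] with ω hω
  simpa using hω

lemma mul_mul_le_cubes {x y z : ℝ} (hx : 0 ≤ x) (hy : 0 ≤ y) (hz : 0 ≤ z) :
    x * y * z ≤ (x ^ 3 + y ^ 3 + z ^ 3) / 3 := by
  nlinarith [mul_nonneg (add_nonneg (add_nonneg hx hy) hz)
    (add_nonneg (add_nonneg (sq_nonneg (x - y)) (sq_nonneg (y - z))) (sq_nonneg (x - z)))]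

lemma L3Le.integrable_mul₃ {X Y Z : Ω → ℝ} {a b c : ℝ} (hX : L3Le μ X a) (hY : L3Le μ Y b)
    (hZ : L3Le μ Z c) : Integrable (fun ω => X ω * Y ω * Z ω) μ := by
  refine ((hX.int.add hY.int).add hZ.int).mono' ((hX.aesm.mul hY.aesm).mul hZ.aesm)
    (Eventually.of_forall fun ω => ?_)
  rw [Real.norm_eq_abs, abs_mul, abs_mul]
  have := mul_mul_le_cubes (abs_nonneg (X ω)) (abs_nonneg (Y ω)) (abs_nonneg (Z ω))
  have h3 : 0 ≤ |X ω| ^ 3 + |Y ω| ^ 3 + |Z ω| ^ 3 := by positivity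
  simp only [Pi.add_apply]
  linarith

/-- Hölder's inequality for three functions in `L³`. -/
lemma L3Le.integral_mul₃_le {X Y Z : Ω → ℝ} {a b c : ℝ} (hX : L3Le μ X a) (hY : L3Le μ Y b)
    (hZ : L3Le μ Z c) : ∫ ω, |X ω * Y ω * Z ω| ∂μ ≤ a * b * c := by
  -- A factor of norm zero vanishes almost everywhere. This case is split off because the
  -- normalization below divides by a, b and c.
  have zero : (∀ᵐ ω ∂μ, X ω * Y ω * Z ω = 0) → ∫ ω, |X ω * Y ω * Z ω| ∂μ ≤ a * b * c := by
    intro h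
    rw [integral_congr_ae (g := fun _ => 0) (by filter_upwards [h] with ω hω; rw [hω, abs_zero])]
    simpa using mul_nonneg (mul_nonneg hX.nonneg hY.nonneg) hZ.nonneg
  rcases hX.nonneg.eq_or_lt with rfl | ha
  · exact zero (by filter_upwards [hX.ae_eq_zero] with ω hω; simp [hω])
  rcases hY.nonneg.eq_or_lt with rfl | hb
  · exact zero (by filter_upwards [hY.ae_eq_zero] with ω hω; simp [hω])
  rcases hZ.nonneg.eq_or_lt with rfl | hc
  · exact zero (by filter_upwards [hZ.ae_eq_zero] with ω hω; simp [hω])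
  -- The pointwise bound by arithmetic and geometric means for |X|/a, |Y|/b, |Z|/c; each of the
  -- three normalized cubes integrates to at most 1.
  have hI : Integrable (fun ω => a * b * c / 3 * ((a ^ 3)⁻¹ * |X ω| ^ 3 + (b ^ 3)⁻¹ * |Y ω| ^ 3
      + (c ^ 3)⁻¹ * |Z ω| ^ 3)) μ :=
    (((hX.int.const_mul _).add (hY.int.const_mul _)).add (hZ.int.const_mul _)).const_mul _
  refine (integral_mono (hX.integrable_mul₃ hY hZ).abs hI fun ω => ?_).trans ?_
  · have := mul_mul_le_cubes (x := |X ω| / a) (y := |Y ω| / b) (z := |Z ω| / c)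
      (by positivity) (by positivity) (by positivity)
    have h2 := mul_le_mul_of_nonneg_left this (by positivity : 0 ≤ a * b * c)
    simp only [abs_mul]
    refine le_of_eq_of_le ?_ (h2.trans (le_of_eq ?_))
    · field_simp
    · field_simp
  · rw [integral_const_mul, ((((HasInt.intro hX.int rfl).const_mul (a ^ 3)⁻¹).add
      ((HasInt.intro hY.int rfl).const_mul (b ^ 3)⁻¹)).add
      ((HasInt.intro hZ.int rfl).const_mul (c ^ 3)⁻¹)).2]
    have h1 : (a ^ 3)⁻¹ * ∫ ω, |X ω| ^ 3 ∂μ ≤ 1 := by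
      rw [inv_mul_le_one₀ (by positivity)]; exact hX.le
    have h2 : (b ^ 3)⁻¹ * ∫ ω, |Y ω| ^ 3 ∂μ ≤ 1 := by
      rw [inv_mul_le_one₀ (by positivity)]; exact hY.le
    have h3 : (c ^ 3)⁻¹ * ∫ ω, |Z ω| ^ 3 ∂μ ≤ 1 := by
      rw [inv_mul_le_one₀ (by positivity)]; exact hZ.le
    have : a * b * c / 3 * 3 = a * b * c := by ring
    refine le_trans (mul_le_mul_of_nonneg_left ?_ (by positivity)) this.le
    linarith

lemma L3Le.integrable_mul [IsProbabilityMeasure μ] {X Y : Ω → ℝ} {a b : ℝ} (hX : L3Le μ X a)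
    (hY : L3Le μ Y b) : Integrable (fun ω => X ω * Y ω) μ := by
  simpa using hX.integrable_mul₃ hY l3Le_one

lemma L3Le.integrable [IsProbabilityMeasure μ] {X : Ω → ℝ} {a : ℝ} (hX : L3Le μ X a) :
    Integrable X μ := by
  simpa using hX.integrable_mul l3Le_one

lemma L3Le.abs_integral_mul_le [IsProbabilityMeasure μ] {X Y : Ω → ℝ} {a b : ℝ}
    (hX : L3Le μ X a) (hY : L3Le μ Y b) : |∫ ω, X ω * Y ω ∂μ| ≤ a * b := by
  refine (abs_integral_le_integral_abs).trans ?_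
  simpa using hX.integral_mul₃_le hY l3Le_one

/-- Expansion of the cube about x. The first order term 3|x|xd is kept with its sign, because its
integral vanishes for orthogonal increments. -/
lemma abs_add_cube_le (x d : ℝ) :
    |x + d| ^ 3 ≤ |x| ^ 3 + 3 * (|x| * x * d) + 3 * |x * d * d| + |d| ^ 3 := by
  have key : ∀ x d : ℝ, 0 ≤ x →
      |x + d| ^ 3 ≤ x ^ 3 + 3 * (x * x * d) + 3 * (x * (d * d)) + |d| ^ 3 := by
    intro x d hx
    rcases le_total 0 (x + d) with h | h
    · rw [abs_of_nonneg h]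
      have := pow_le_pow_left₀ (abs_nonneg d) le_rfl 3
      have h3 : d ^ 3 ≤ |d| ^ 3 := by
        rw [← abs_pow]; exact le_abs_self _
      nlinarith
    · rw [abs_of_nonpos h, abs_of_nonpos (by linarith : d ≤ 0)]
      nlinarith [mul_nonneg hx (add_nonneg (sq_nonneg (x + d))
        (add_nonneg (sq_nonneg d) (sq_nonneg (x + 2 * d)))),
        mul_nonneg hx (sq_nonneg (2 * x + 3 * d))]
  rcases le_total 0 x with h | h
  · have := key x d h
    rw [mul_assoc x d d, abs_mul x, abs_of_nonneg h, abs_mul_self]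
    exact this
  · have := key (-x) (-d) (by linarith)
    rw [mul_assoc x d d, abs_mul x, abs_mul_self, abs_of_nonpos h]
    rw [show -x + -d = -(x + d) by ring, abs_neg, abs_neg] at this
    linarith

lemma L3Le.abs_mul_self_mul {X D : Ω → ℝ} {a b : ℝ} (hX : L3Le μ X a) (hD : L3Le μ D b) :
    Integrable (fun ω => |X ω| * X ω * D ω) μ := by
  have h : L3Le μ (fun ω => |X ω|) a :=
    ⟨hX.aesm.norm, by simpa using hX.int, hX.nonneg, by simpa using hX.le⟩
  exact h.integrable_mul₃ hX hD

/-- Orthogonal increments: the squared `L³`-norm grows by at most three times the squared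
`L³`-norm of the increment. -/
lemma L3Le.add_of_orthogonal {X D : Ω → ℝ} {a b : ℝ} (hX : L3Le μ X a) (hD : L3Le μ D b)
    (h0 : ∫ ω, |X ω| * X ω * D ω ∂μ = 0) :
    L3Le μ (fun ω => X ω + D ω) √(a ^ 2 + 3 * b ^ 2) := by
  have ha := hX.nonneg
  have hb := hD.nonneg
  have i1 := hX.abs_mul_self_mul hD
  have i2 := (hX.integrable_mul₃ hD hD).abs
  have iR := ((hX.int.add (i1.const_mul 3)).add (i2.const_mul 3)).add hD.int
  have hm := hX.aesm.add hD.aesm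
  refine ⟨hm, ?_, Real.sqrt_nonneg _, ?_⟩
  · refine iR.mono' (hm.norm.pow 3) (Eventually.of_forall fun ω => ?_)
    rw [Real.norm_of_nonneg (by positivity)]
    exact abs_add_cube_le _ _
  · have hle : ∫ ω, |X ω + D ω| ^ 3 ∂μ ≤ a ^ 3 + 3 * (a * b * b) + b ^ 3 := by
      refine (integral_mono_of_nonneg (Eventually.of_forall fun ω => by positivity) iR
        (Eventually.of_forall fun ω => abs_add_cube_le _ _)).trans ?_
      simp only [Pi.add_apply]
      rw [((((HasInt.intro hX.int rfl).add ((HasInt.intro i1 h0).const_mul 3)).add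
        ((HasInt.intro i2 rfl).const_mul 3)).add (HasInt.intro hD.int rfl)).2]
      have := hX.integral_mul₃_le hD hD
      linarith [hX.le, hD.le]
    refine hle.trans (abs_le_of_sq_le_sq' ?_ (by positivity)).2
    have e : (√(a ^ 2 + 3 * b ^ 2) ^ 3) ^ 2 = (a ^ 2 + 3 * b ^ 2) ^ 3 := by
      rw [← pow_mul, show 3 * 2 = 2 * 3 from rfl, pow_mul, Real.sq_sqrt (by positivity)]
    rw [e]
    -- This is (a² + 3b²)³ - (a³ + 3ab² + b³)², written as a quadratic form in a²b, ab² and b³.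
    have : 0 ≤ 3 * (a ^ 2 * b) ^ 2 - 2 * (a ^ 2 * b) * (a * b ^ 2) + 18 * (a * b ^ 2) ^ 2
        - 6 * (a * b ^ 2) * b ^ 3 + 26 * (b ^ 3) ^ 2 := by
      nlinarith [sq_nonneg (a ^ 2 * b - a * b ^ 2), sq_nonneg (a * b ^ 2 - b ^ 3),
        sq_nonneg (a ^ 2 * b), sq_nonneg (a * b ^ 2), sq_nonneg (b ^ 3)]
    nlinarith [this]

lemma L3Le.add_of_le {X Y : Ω → ℝ} {a b : ℝ} (hX : L3Le μ X a) (hY : L3Le μ Y b) :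
    L3Le μ (fun ω => X ω + Y ω) (2 * √(a ^ 2 + b ^ 2)) := by
  have ha := hX.nonneg
  have hb := hY.nonneg
  have hp : ∀ ω, |X ω + Y ω| ^ 3 ≤ 4 * |X ω| ^ 3 + 4 * |Y ω| ^ 3 := fun ω => by
    refine (pow_le_pow_left₀ (abs_nonneg _) (abs_add_le _ _) 3).trans ?_
    nlinarith [mul_nonneg (add_nonneg (abs_nonneg (X ω)) (abs_nonneg (Y ω)))
      (sq_nonneg (|X ω| - |Y ω|))]
  have hm := hX.aesm.add hY.aesm
  have iR := (hX.int.const_mul 4).add (hY.int.const_mul 4)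
  refine ⟨hm, ?_, by positivity, ?_⟩
  · refine iR.mono' (hm.norm.pow 3) (Eventually.of_forall fun ω => ?_)
    rw [Real.norm_of_nonneg (by positivity)]
    exact hp ω
  · refine (integral_mono_of_nonneg (Eventually.of_forall fun ω => by positivity) iR
        (Eventually.of_forall hp)).trans ?_
    simp only [Pi.add_apply]
    rw [integral_add (hX.int.const_mul 4) (hY.int.const_mul 4), integral_const_mul,
      integral_const_mul]
    have s0 := Real.sqrt_nonneg (a ^ 2 + b ^ 2)
    have ha' : a ≤ √(a ^ 2 + b ^ 2) := Real.le_sqrt_of_sq_le (by nlinarith)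
    have hb' : b ≤ √(a ^ 2 + b ^ 2) := Real.le_sqrt_of_sq_le (by nlinarith)
    have h1 := pow_le_pow_left₀ ha ha' 3
    have h2 := pow_le_pow_left₀ hb hb' 3
    rw [mul_pow]
    linarith [hX.le, hY.le]

end ThirdMoments

/-! ### Moments of linear and quadratic forms in independent variables. -/

section QuadraticForms

variable {Ω : Type*} {ι : Type*}

/-- `f` is a function of the variables `ξ j`, `j ∈ s`. -/
def DependsOnlyOn (ξ : ι → Ω → ℝ) (s : Finset ι) (f : Ω → ℝ) : Prop :=
  ∃ φ : (s → ℝ) → ℝ, Measurable φ ∧ f = fun ω => φ (fun j => ξ j ω)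

lemma DependsOnlyOn.mul {ξ : ι → Ω → ℝ} {s : Finset ι} {f g : Ω → ℝ}
    (hf : DependsOnlyOn ξ s f) (hg : DependsOnlyOn ξ s g) :
    DependsOnlyOn ξ s (fun ω => f ω * g ω) := by
  obtain ⟨φ, hφ, rfl⟩ := hf
  obtain ⟨χ, hχ, rfl⟩ := hg
  exact ⟨fun x => φ x * χ x, hφ.mul hχ, rfl⟩

lemma DependsOnlyOn.comp {ξ : ι → Ω → ℝ} {s : Finset ι} {f : Ω → ℝ}
    (hf : DependsOnlyOn ξ s f) {g : ℝ → ℝ} (hg : Measurable g) :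
    DependsOnlyOn ξ s (fun ω => g (f ω)) := by
  obtain ⟨φ, hφ, rfl⟩ := hf
  exact ⟨fun x => g (φ x), hg.comp hφ, rfl⟩

/-- Linear form in the variables `ξ j`, `j ∈ s`. -/
def linForm (ξ : ι → Ω → ℝ) (s : Finset ι) (c : ι → ℝ) (ω : Ω) : ℝ := ∑ j ∈ s, c j * ξ j ω

/-- Centred quadratic form in the variables `ξ j`, `j ∈ s`. -/
def quadForm (ξ : ι → Ω → ℝ) (s : Finset ι) (C : Matrix ι ι ℝ) (ω : Ω) : ℝ :=
  ∑ i ∈ s, ∑ j ∈ s, C i j * (ξ i ω * ξ j ω) - ∑ i ∈ s, C i i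

lemma dependsOnlyOn_linForm (ξ : ι → Ω → ℝ) (s : Finset ι) (c : ι → ℝ) :
    DependsOnlyOn ξ s (linForm ξ s c) := by
  refine ⟨fun x => ∑ j : s, c j * x j, by fun_prop, ?_⟩
  funext ω
  exact (Finset.sum_coe_sort s (fun j => c j * ξ j ω)).symm

lemma dependsOnlyOn_quadForm (ξ : ι → Ω → ℝ) (s : Finset ι) (C : Matrix ι ι ℝ) :
    DependsOnlyOn ξ s (quadForm ξ s C) := by
  refine ⟨fun x => ∑ i : s, ∑ j : s, C i j * (x i * x j) - ∑ i ∈ s, C i i, by fun_prop, ?_⟩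
  funext ω
  rw [quadForm, ← Finset.sum_coe_sort s (fun i => ∑ j ∈ s, C i j * (ξ i ω * ξ j ω))]
  congr 1
  refine Finset.sum_congr rfl fun i _ => ?_
  exact (Finset.sum_coe_sort s (fun j => C i j * (ξ i ω * ξ j ω))).symm

lemma linForm_insert [DecidableEq ι] (ξ : ι → Ω → ℝ) {s : Finset ι} {a : ι} (ha : a ∉ s)
    (c : ι → ℝ) (ω : Ω) :
    linForm ξ (insert a s) c ω = linForm ξ s c ω + c a * ξ a ω := by
  rw [linForm, Finset.sum_insert ha, linForm, add_comm]

/-- The increment is a linear form in the earlier variables times the new variable, plus a multiple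
of its centred square. Given the past both are centred, which is the martingale structure behind all
moment computations here. -/
lemma quadForm_insert [DecidableEq ι] (ξ : ι → Ω → ℝ) {s : Finset ι} {a : ι} (ha : a ∉ s)
    (C : Matrix ι ι ℝ)
    (ω : Ω) : quadForm ξ (insert a s) C ω = quadForm ξ s C ω
      + (linForm ξ s (fun j => C a j + C j a) ω * ξ a ω + C a a * (ξ a ω ^ 2 - 1)) := by
  simp only [quadForm, linForm, Finset.sum_insert ha, Finset.sum_add_distrib, add_mul,
    Finset.sum_mul]
  have h1 : ∑ j ∈ s, C a j * (ξ a ω * ξ j ω) = ∑ j ∈ s, C a j * ξ j ω * ξ a ω :=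
    Finset.sum_congr rfl fun j _ => by ring
  have h2 : ∑ j ∈ s, C j a * (ξ j ω * ξ a ω) = ∑ j ∈ s, C j a * ξ j ω * ξ a ω :=
    Finset.sum_congr rfl fun j _ => by ring
  rw [h1, h2]
  ring

variable [MeasurableSpace Ω] {μ : Measure Ω} {ξ : ι → Ω → ℝ} {κ : ι → ℝ} {K : ℝ}

lemma DependsOnlyOn.indepFun {ξ : ι → Ω → ℝ} {s : Finset ι} {f : Ω → ℝ}
    (hf : DependsOnlyOn ξ s f) (hξ : iIndepFun ξ μ) (hm : ∀ i, Measurable (ξ i)) {a : ι}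
    (ha : a ∉ s) {g : ℝ → ℝ} (hg : Measurable g) :
    IndepFun f (fun ω => g (ξ a ω)) μ := by
  obtain ⟨φ, hφ, rfl⟩ := hf
  have h := hξ.indepFun_finset s {a} (by simpa using ha) hm
  exact h.comp (ψ := fun x : ({a} : Finset ι) → ℝ => g (x ⟨a, by simp⟩)) hφ
    (hg.comp (measurable_pi_apply _))

/-- Independent standardized variables with excess kurtosis `κ i` and `L³`-norms of `ξ i` and
`ξ i ^ 2 - 1` bounded by `K`. -/
structure StdFamily (μ : Measure Ω) (ξ : ι → Ω → ℝ) (κ : ι → ℝ) (K : ℝ) : Prop where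
  indep : iIndepFun ξ μ
  meas : ∀ i, Measurable (ξ i)
  mean : ∀ i, ∫ ω, ξ i ω ∂μ = 0
  one_le : 1 ≤ K
  var : ∀ i, ∫ ω, (ξ i ω) ^ 2 ∂μ = 1
  fourth : ∀ i, ∫ ω, (ξ i ω) ^ 4 ∂μ = κ i + 3
  l3 : ∀ i, L3Le μ (ξ i) K
  l3_sq : ∀ i, L3Le μ (fun ω => ξ i ω ^ 2 - 1) K


lemma StdFamily.hasInt_sq [IsProbabilityMeasure μ] (h : StdFamily μ ξ κ K) (a : ι) :
    HasInt μ (fun ω => ξ a ω ^ 2) 1 :=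
  ⟨by simpa [sq] using (h.l3 a).integrable_mul (h.l3 a), h.var a⟩

lemma StdFamily.hasInt_fst [IsProbabilityMeasure μ] (h : StdFamily μ ξ κ K) (a : ι) :
    HasInt μ (ξ a) 0 := ⟨(h.l3 a).integrable, h.mean a⟩

lemma StdFamily.hasInt_sq_sub_one [IsProbabilityMeasure μ] (h : StdFamily μ ξ κ K) (a : ι) :
    HasInt μ (fun ω => ξ a ω ^ 2 - 1) 0 := by
  have := (h.hasInt_sq a).1
  refine ⟨(h.l3_sq a).integrable, ?_⟩
  rw [integral_sub this (integrable_const _), h.var]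
  simp

lemma StdFamily.hasInt_sq_sub_one_sq [IsProbabilityMeasure μ] (h : StdFamily μ ξ κ K) (a : ι) :
    HasInt μ (fun ω => (ξ a ω ^ 2 - 1) * (ξ a ω ^ 2 - 1)) (κ a + 2) := by
  have i2 := (h.hasInt_sq a).1
  have i := (h.l3_sq a).integrable_mul (h.l3_sq a)
  refine ⟨i, ?_⟩
  have i4 : Integrable (fun ω => ξ a ω ^ 4) μ := by
    refine ((i.add (i2.const_mul 2)).sub (integrable_const 1)).congr
      (Eventually.of_forall fun ω => ?_)
    simp only [Pi.add_apply, Pi.sub_apply]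
    ring
  exact (((HasInt.intro i4 (h.fourth a)).add ((h.hasInt_sq a).const_mul (-2))).add
    (⟨integrable_const 1, by simp⟩ : HasInt μ (fun _ => (1 : ℝ)) 1)).congr
    (fun ω => by ring) (w := κ a + 2) (by ring) |>.2

/-- The new term is independent of the past and centred, hence orthogonal to |X|X; the factor 3 is
that of `L3Le.add_of_orthogonal`. -/
lemma StdFamily.l3Le_linForm [IsProbabilityMeasure μ] (h : StdFamily μ ξ κ K) (s : Finset ι)
    (c : ι → ℝ) : L3Le μ (linForm ξ s c) √(3 * K ^ 2 * ∑ j ∈ s, c j ^ 2) := by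
  classical
  induction s using Finset.induction_on with
  | empty =>
    rw [show linForm ξ ∅ c = fun _ => 0 by funext; simp [linForm]]
    exact l3Le_zero (Real.sqrt_nonneg _)
  | insert a s ha ih =>
    have hd := (h.l3 a).const_mul (c a)
    have hpast := (dependsOnlyOn_linForm ξ s c)
    have h0 : ∫ ω, |linForm ξ s c ω| * linForm ξ s c ω * (c a * ξ a ω) ∂μ = 0 := by
      have hi := ((hpast.comp measurable_norm).mul hpast).indepFun h.indep h.meas ha
        (measurable_const_mul (c a))
      rw [show (fun ω => |linForm ξ s c ω| * linForm ξ s c ω * (c a * ξ a ω)) = fun ω =>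
        (‖linForm ξ s c ω‖ * linForm ξ s c ω) * (c a * ξ a ω) from rfl,
        hi.integral_fun_mul_eq_mul_integral (ih.aesm.norm.mul ih.aesm) hd.aesm,
        integral_const_mul, h.mean]
      simp
    have := ih.add_of_orthogonal hd h0
    rw [show linForm ξ (insert a s) c = fun ω => linForm ξ s c ω + c a * ξ a ω from
      funext fun ω => linForm_insert ξ ha c ω]
    refine this.mono (le_of_eq ?_)
    have hs : 0 ≤ ∑ j ∈ s, c j ^ 2 := Finset.sum_nonneg fun _ _ => sq_nonneg _
    rw [Real.sq_sqrt (by positivity), Finset.sum_insert ha, mul_pow, sq_abs]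
    ring_nf

lemma StdFamily.l3Le_linForm_mul [IsProbabilityMeasure μ] (h : StdFamily μ ξ κ K) {s : Finset ι}
    {a : ι} (ha : a ∉ s) (c : ι → ℝ) : L3Le μ (fun ω => linForm ξ s c ω * ξ a ω)
      (√(3 * K ^ 2 * ∑ j ∈ s, c j ^ 2) * K) := by
  have hl := h.l3Le_linForm s c
  have hi := ((dependsOnlyOn_linForm ξ s c).comp (measurable_norm.pow_const 3)).indepFun
    h.indep h.meas ha (measurable_norm.pow_const 3)
  have e : (fun ω => |linForm ξ s c ω * ξ a ω| ^ 3)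
      = fun ω => ‖linForm ξ s c ω‖ ^ 3 * ‖ξ a ω‖ ^ 3 := by
    funext ω; rw [abs_mul, mul_pow]; rfl
  have hK : 0 ≤ K := (h.l3 a).nonneg
  refine ⟨hl.aesm.mul (h.l3 a).aesm, ?_, by positivity, ?_⟩
  · rw [e]
    exact hi.integrable_mul hl.int (h.l3 a).int
  · rw [e, hi.integral_fun_mul_eq_mul_integral hl.int.1 (h.l3 a).int.1, mul_pow]
    exact mul_le_mul hl.le (h.l3 a).le (integral_nonneg fun ω => by positivity)
      (by positivity)

/-- Third absolute moment of a quadratic form. -/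
lemma StdFamily.l3Le_quadForm [IsProbabilityMeasure μ] (h : StdFamily μ ξ κ K) (s : Finset ι)
    (C : Matrix ι ι ℝ) :
    L3Le μ (quadForm ξ s C) √(72 * K ^ 4 * ∑ i ∈ s, ∑ j ∈ s, C i j ^ 2) := by
  classical
  induction s using Finset.induction_on with
  | empty =>
    rw [show quadForm ξ ∅ C = fun _ => 0 by funext; simp [quadForm]]
    exact l3Le_zero (Real.sqrt_nonneg _)
  | insert a s ha ih =>
    have hK1 := h.one_le
    have hK : 0 ≤ K := zero_le_one.trans hK1
    set c : ι → ℝ := fun j => C a j + C j a with hc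
    have hl := h.l3Le_linForm s c
    have hly := h.l3Le_linForm_mul ha c
    have hz := (h.l3_sq a).const_mul (C a a)
    have hd := hly.add_of_le hz
    have hpq := dependsOnlyOn_quadForm ξ s C
    have hpl := dependsOnlyOn_linForm ξ s c
    have hp := (hpq.comp measurable_norm).mul hpq
    -- Each part of the increment is a function of the past times a centred function of the new
    -- variable.
    have h0 : ∫ ω, |quadForm ξ s C ω| * quadForm ξ s C ω *
        (linForm ξ s c ω * ξ a ω + C a a * (ξ a ω ^ 2 - 1)) ∂μ = 0 := by
      have h1 : HasInt μ (fun ω => ‖quadForm ξ s C ω‖ * quadForm ξ s C ω * linForm ξ s c ω * ξ a ω)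
          ((∫ ω, ‖quadForm ξ s C ω‖ * quadForm ξ s C ω * linForm ξ s c ω ∂μ) * 0) :=
        HasInt.mul_of_indep ⟨ih.abs_mul_self_mul hl, rfl⟩ (h.hasInt_fst a)
          ((hp.mul hpl).indepFun h.indep h.meas ha measurable_id)
      have h2 : HasInt μ (fun ω => ‖quadForm ξ s C ω‖ * quadForm ξ s C ω * (ξ a ω ^ 2 - 1))
          ((∫ ω, ‖quadForm ξ s C ω‖ * quadForm ξ s C ω ∂μ) * 0) :=
        HasInt.mul_of_indep ⟨by simpa using ih.abs_mul_self_mul l3Le_one, rfl⟩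
          (h.hasInt_sq_sub_one a)
          (hp.indepFun h.indep h.meas ha (g := fun x => x ^ 2 - 1) (by fun_prop))
      refine ((h1.add (h2.const_mul (C a a))).congr (w := 0) (fun ω => ?_) (by ring)).2
      simp only [Real.norm_eq_abs]
      ring
    have := ih.add_of_orthogonal hd h0
    rw [show quadForm ξ (insert a s) C = fun ω => quadForm ξ s C ω +
      (linForm ξ s c ω * ξ a ω + C a a * (ξ a ω ^ 2 - 1)) from
      funext fun ω => quadForm_insert ξ ha C ω]
    refine this.mono (Real.sqrt_le_sqrt ?_)
    have hs : 0 ≤ ∑ i ∈ s, ∑ j ∈ s, C i j ^ 2 :=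
      Finset.sum_nonneg fun _ _ => Finset.sum_nonneg fun _ _ => sq_nonneg _
    -- The constant 72 is 3·4·3·2: orthogonal addition, the square of the factor 2 in
    -- `L3Le.add_of_le`, the linear form, and (x + y)² ≤ 2(x² + y²).
    have hcs : ∑ j ∈ s, c j ^ 2 ≤ 2 * (∑ j ∈ s, C a j ^ 2 + ∑ j ∈ s, C j a ^ 2) := by
      rw [← Finset.sum_add_distrib, Finset.mul_sum]
      refine Finset.sum_le_sum fun j _ => ?_
      simp only [hc]
      nlinarith [sq_nonneg (C a j - C j a)]
    have hc0 : 0 ≤ ∑ j ∈ s, c j ^ 2 := Finset.sum_nonneg fun _ _ => sq_nonneg _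
    rw [Real.sq_sqrt (by positivity), mul_pow, Real.sq_sqrt (by positivity), mul_pow _ K,
      Real.sq_sqrt (by positivity), mul_pow |C a a|, sq_abs]
    simp only [Finset.sum_insert ha, Finset.sum_add_distrib]
    have hK4 : K ^ 2 ≤ K ^ 4 := pow_le_pow_right₀ hK1 (by norm_num)
    have e1 : K ^ 4 * ∑ j ∈ s, c j ^ 2
        ≤ K ^ 4 * (2 * (∑ j ∈ s, C a j ^ 2 + ∑ j ∈ s, C j a ^ 2)) :=
      mul_le_mul_of_nonneg_left hcs (by positivity)
    have e2 : K ^ 2 * C a a ^ 2 ≤ K ^ 4 * C a a ^ 2 :=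
      mul_le_mul_of_nonneg_right hK4 (sq_nonneg _)
    have e3 : 0 ≤ K ^ 4 * C a a ^ 2 := by positivity
    nlinarith [e1, e2, e3]

lemma StdFamily.hasInt_linForm [IsProbabilityMeasure μ] (h : StdFamily μ ξ κ K) (s : Finset ι)
    (c : ι → ℝ) : HasInt μ (linForm ξ s c) 0 :=
  (HasInt.sum (s := s) fun j _ => (h.hasInt_fst j).const_mul (c j)).congr (fun _ => rfl) (by simp)

lemma StdFamily.hasInt_linForm_mul_linForm [IsProbabilityMeasure μ] (h : StdFamily μ ξ κ K)
    (s : Finset ι) (c d : ι → ℝ) :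
    HasInt μ (fun ω => linForm ξ s c ω * linForm ξ s d ω) (∑ j ∈ s, c j * d j) := by
  classical
  induction s using Finset.induction_on with
  | empty =>
    exact HasInt.congr ⟨integrable_zero _ _ _, integral_zero _ _⟩ (fun ω => by simp [linForm])
      (by simp)
  | insert a s ha ih =>
    have h1 := (h.hasInt_linForm s c).mul_of_indep (h.hasInt_fst a)
      ((dependsOnlyOn_linForm ξ s c).indepFun h.indep h.meas ha measurable_id)
    have h2 := (h.hasInt_linForm s d).mul_of_indep (h.hasInt_fst a)
      ((dependsOnlyOn_linForm ξ s d).indepFun h.indep h.meas ha measurable_id)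
    refine (((ih.add (h1.const_mul (d a))).add (h2.const_mul (c a))).add
      ((h.hasInt_sq a).const_mul (c a * d a))).congr (fun ω => ?_) ?_
    · rw [linForm_insert ξ ha, linForm_insert ξ ha]
      ring
    · rw [Finset.sum_insert ha]
      ring

lemma StdFamily.hasInt_quadForm [IsProbabilityMeasure μ] (h : StdFamily μ ξ κ K)
    (s : Finset ι) (C : Matrix ι ι ℝ) : HasInt μ (quadForm ξ s C) 0 := by
  classical
  induction s using Finset.induction_on with
  | empty =>
    exact HasInt.congr ⟨integrable_zero _ _ _, integral_zero _ _⟩ (fun ω => by simp [quadForm])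
      (by simp)
  | insert a s ha ih =>
    have h1 := (h.hasInt_linForm s fun j => C a j + C j a).mul_of_indep (h.hasInt_fst a)
      ((dependsOnlyOn_linForm ξ s _).indepFun h.indep h.meas ha measurable_id)
    exact (ih.add (h1.add ((h.hasInt_sq_sub_one a).const_mul (C a a)))).congr
      (fun ω => quadForm_insert ξ ha C ω) (by ring)

/-- Covariance of two quadratic forms. -/
lemma StdFamily.hasInt_quadForm_mul_quadForm [IsProbabilityMeasure μ] (h : StdFamily μ ξ κ K)
    (s : Finset ι) (C D : Matrix ι ι ℝ) :
    HasInt μ (fun ω => quadForm ξ s C ω * quadForm ξ s D ω)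
      (∑ i ∈ s, ∑ j ∈ s, C i j * (D i j + D j i) + ∑ i ∈ s, κ i * (C i i * D i i)) := by
  classical
  induction s using Finset.induction_on with
  | empty =>
    exact HasInt.congr ⟨integrable_zero _ _ _, integral_zero _ _⟩ (fun ω => by simp [quadForm])
      (by simp)
  | insert a s ha ih =>
    set c : ι → ℝ := fun j => C a j + C j a with hc
    set d : ι → ℝ := fun j => D a j + D j a with hd
    have pC := dependsOnlyOn_quadForm ξ s C
    have pD := dependsOnlyOn_quadForm ξ s D
    have pc := dependsOnlyOn_linForm ξ s c
    have pd := dependsOnlyOn_linForm ξ s d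
    have lC := h.l3Le_quadForm s C
    have lD := h.l3Le_quadForm s D
    have lc := h.l3Le_linForm s c
    have ld := h.l3Le_linForm s d
    have mz : Measurable fun x : ℝ => x ^ 2 - 1 := by fun_prop
    have x1 := h.hasInt_fst a
    have z1 := h.hasInt_sq_sub_one a
    have xz : HasInt μ (fun ω => ξ a ω * (ξ a ω ^ 2 - 1))
      (∫ ω, ξ a ω * (ξ a ω ^ 2 - 1) ∂μ) := ⟨(h.l3 a).integrable_mul (h.l3_sq a), rfl⟩
    -- The product of the two enlarged forms is expanded into products of a past factor and a
    -- function of the new variable. Besides the induction hypothesis only `t5` and `t8` have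
    -- non-zero mean: in the others a factor is centred, and in `t6` and `t7`, where the third
    -- moment of the new variable appears, it is the linear form.
    have t1 := HasInt.mul_of_indep ⟨lC.integrable_mul ld, rfl⟩ x1
      ((pC.mul pd).indepFun h.indep h.meas ha measurable_id)
    have t2 := HasInt.mul_of_indep ⟨lD.integrable_mul lc, rfl⟩ x1
      ((pD.mul pc).indepFun h.indep h.meas ha measurable_id)
    have t3 := (h.hasInt_quadForm s C).mul_of_indep z1 (pC.indepFun h.indep h.meas ha mz)
    have t4 := (h.hasInt_quadForm s D).mul_of_indep z1 (pD.indepFun h.indep h.meas ha mz)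
    have t5 := (h.hasInt_linForm_mul_linForm s c d).mul_of_indep (h.hasInt_sq a)
      ((pc.mul pd).indepFun h.indep h.meas ha (g := fun x => x ^ 2) (by fun_prop))
    have t6 := (h.hasInt_linForm s c).mul_of_indep xz
      (pc.indepFun h.indep h.meas ha (g := fun x => x * (x ^ 2 - 1)) (by fun_prop))
    have t7 := (h.hasInt_linForm s d).mul_of_indep xz
      (pd.indepFun h.indep h.meas ha (g := fun x => x * (x ^ 2 - 1)) (by fun_prop))
    have t8 := h.hasInt_sq_sub_one_sq a
    refine ((((((((ih.add t1).add t2).add (t3.const_mul (D a a))).add (t4.const_mul (C a a))).add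
      t5).add (t6.const_mul (D a a))).add (t7.const_mul (C a a))).add
      (t8.const_mul (C a a * D a a))).congr (fun ω => ?_) ?_
    · rw [quadForm_insert ξ ha, quadForm_insert ξ ha]
      ring
    · simp only [Finset.sum_insert ha, Finset.sum_add_distrib]
      have e : ∑ j ∈ s, c j * d j = ∑ j ∈ s, C a j * (D a j + D j a)
          + ∑ i ∈ s, C i a * (D i a + D a i) := by
        rw [← Finset.sum_add_distrib]
        exact Finset.sum_congr rfl fun j _ => by simp only [hc, hd]; ring
      rw [e]
      ring

end QuadraticForms

/-! ### Standardized errors and random effects. -/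

section Standardization

variable {Ω : Type*} [MeasurableSpace Ω] {μ : Measure Ω}

/-- The entry point of the sixth moments: both ξ and ξ² - 1 satisfy the pointwise bound. The
constant works because 1 + S ≤ 1 + |S| ≤ (1 + |S|)³. -/
lemma l3Le_of_sixth [IsProbabilityMeasure μ] {X Y : Ω → ℝ} {S : ℝ} (hX : MemLp X 6 μ)
    (hS : ∫ ω, X ω ^ 6 ∂μ ≤ S) (hY : AEStronglyMeasurable Y μ)
    (hle : ∀ ω, |Y ω| ^ 3 ≤ 1 + X ω ^ 6) : L3Le μ Y (1 + |S|) := by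
  have i6 : Integrable (fun ω => X ω ^ 6) μ := by
    have := MemLp.integrable_norm_pow (p := 6) (by exact_mod_cast hX) (by norm_num)
    refine this.congr (Eventually.of_forall fun ω => ?_)
    simp only [Real.norm_eq_abs]
    exact Even.pow_abs (by decide) _
  have iR := (integrable_const (μ := μ) (1 : ℝ)).add i6
  refine ⟨hY, ?_, by positivity, ?_⟩
  · refine iR.mono' (hY.norm.pow 3) (Eventually.of_forall fun ω => ?_)
    rw [Real.norm_of_nonneg (by positivity)]
    exact hle ω
  · refine (integral_mono_of_nonneg (Eventually.of_forall fun ω => by positivity) iR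
      (Eventually.of_forall hle)).trans ?_
    simp only [Pi.add_apply]
    rw [integral_add (integrable_const _) i6]
    have h1 : 1 + |S| ≤ (1 + |S|) ^ 3 := le_self_pow₀ (by linarith [abs_nonneg S]) (by norm_num)
    simp only [integral_const, probReal_univ, smul_eq_mul, mul_one]
    linarith [le_abs_self S]

lemma abs_cube_le_one_add_pow_six (x : ℝ) : |x| ^ 3 ≤ 1 + x ^ 6 := by
  have : x ^ 6 = (|x| ^ 3) ^ 2 := by rw [← pow_mul]; exact (Even.pow_abs (by decide) x).symm
  rw [this]
  nlinarith [sq_nonneg (|x| ^ 3 - 1), abs_nonneg x]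

lemma abs_sq_sub_one_cube_le (x : ℝ) : |x ^ 2 - 1| ^ 3 ≤ 1 + x ^ 6 := by
  have h6 : x ^ 6 = (x ^ 2) ^ 3 := by ring
  rcases le_total 1 (x ^ 2) with h | h
  · rw [abs_of_nonneg (by linarith), h6]
    have := pow_le_pow_left₀ (by linarith : 0 ≤ x ^ 2 - 1) (by linarith : x ^ 2 - 1 ≤ x ^ 2) 3
    linarith
  · have h1 : |x ^ 2 - 1| ≤ 1 := by rw [abs_le]; constructor <;> nlinarith [sq_nonneg x]
    have := pow_le_one₀ (n := 3) (abs_nonneg _) h1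
    have : 0 ≤ x ^ 6 := by positivity
    linarith

lemma sqrt_mul_sqrt_of_posDef {n : ℕ} {R : Matrix (Fin n) (Fin n) ℝ} (hR : R.PosDef) :
    CFC.sqrt R * CFC.sqrt R = R :=
  CFC.sqrt_mul_sqrt_self R hR.posSemidef.nonneg

lemma transpose_sqrt {n : ℕ} (R : Matrix (Fin n) (Fin n) ℝ) : (CFC.sqrt R)ᵀ = CFC.sqrt R :=
  (Matrix.nonneg_iff_posSemidef.1 (CFC.sqrt_nonneg R)).isHermitian

lemma isUnit_det_sqrt {n : ℕ} {R : Matrix (Fin n) (Fin n) ℝ} (hR : R.PosDef) :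
    IsUnit (CFC.sqrt R).det := by
  rw [isUnit_iff_ne_zero]
  intro h
  have := hR.det_pos
  rw [← sqrt_mul_sqrt_of_posDef hR, Matrix.det_mul, h, mul_zero] at this
  exact this.false

lemma standardized_moments [IsProbabilityMeasure μ] {n : ℕ} {R : Matrix (Fin n) (Fin n) ℝ}
    (hR : R.PosDef) {x : Ω → Fin n → ℝ} (mean : ∀ i, ∫ ω, x ω i ∂μ = 0)
    (cov : ∀ i j, ∫ ω, x ω i * x ω j ∂μ = R i j)
    (hL : ∀ i, MemLp (fun ω => ((CFC.sqrt R)⁻¹ *ᵥ x ω) i) 6 μ) (i : Fin n) :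
    ∫ ω, ((CFC.sqrt R)⁻¹ *ᵥ x ω) i ∂μ = 0 ∧ ∫ ω, ((CFC.sqrt R)⁻¹ *ᵥ x ω) i ^ 2 ∂μ = 1 := by
  have hu := isUnit_det_sqrt hR
  -- The values of the integrals in `cov` do not give integrability, as a non-integrable function
  -- has integral 0 by convention. Square integrability comes from writing x as √R times its
  -- standardized version.
  have hx : ∀ j, MemLp (fun ω => x ω j) 2 μ := by
    intro j
    have : (fun ω => x ω j)
        = fun ω => ∑ l, CFC.sqrt R j l * ((CFC.sqrt R)⁻¹ *ᵥ x ω) l := by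
      funext ω
      have : CFC.sqrt R *ᵥ ((CFC.sqrt R)⁻¹ *ᵥ x ω) = x ω := by
        rw [Matrix.mulVec_mulVec, Matrix.mul_nonsing_inv _ hu, Matrix.one_mulVec]
      exact (congrFun this j).symm
    rw [this]
    exact memLp_finsetSum _ fun l _ => ((hL l).mono_exponent (by norm_num)).const_mul _
  have hxy : ∀ j l, HasInt μ (fun ω => x ω j * x ω l) (R j l) := fun j l =>
    ⟨(hx j).integrable_mul (hx l), cov j l⟩
  have hx1 : ∀ j, HasInt μ (fun ω => x ω j) 0 := fun j =>
    ⟨(hx j).integrable (by norm_num), mean j⟩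
  set T := (CFC.sqrt R)⁻¹ with hT
  constructor
  · exact ((HasInt.sum (s := Finset.univ) fun j _ => (hx1 j).const_mul (T i j)).congr
      (fun ω => rfl) (w := 0) (by simp)).2
  · have e : (T * R * Tᵀ) i i = 1 := by
      have : T * R * Tᵀ = 1 := by
        rw [hT, Matrix.transpose_nonsing_inv, transpose_sqrt]
        nth_rewrite 2 [← sqrt_mul_sqrt_of_posDef hR]
        rw [← Matrix.mul_assoc, Matrix.nonsing_inv_mul _ hu, Matrix.one_mul,
          Matrix.mul_nonsing_inv _ hu]
      rw [this, Matrix.one_apply_eq]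
    refine ((HasInt.sum (s := Finset.univ) fun j _ => HasInt.sum (s := Finset.univ) fun l _ =>
      (hxy j l).const_mul (T i j * T i l)).congr (fun ω => ?_) (w := 1) ?_).2
    · simp only [sq, Matrix.mulVec, dotProduct]
      rw [Finset.sum_mul_sum]
      exact Finset.sum_congr rfl fun j _ => Finset.sum_congr rfl fun l _ => by ring
    · rw [← e]
      simp only [Matrix.mul_apply, Finset.sum_mul, Matrix.transpose_apply]
      rw [Finset.sum_comm]
      exact Finset.sum_congr rfl fun j _ => Finset.sum_congr rfl fun l _ => by ring

/-- Merges errors and random effects into one independent family, so that a quadratic form in Zv + ε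
is a quadratic form in a single standardized vector. -/
lemma iIndepFun_sumElim {ι τ : Type*} {f : ι → Ω → ℝ} {g : τ → Ω → ℝ} (hf : iIndepFun f μ)
    (hg : iIndepFun g μ) (hfg : IndepFun (fun ω i => f i ω) (fun ω j => g j ω) μ) :
    iIndepFun (Sum.elim f g) μ := by
  classical
  rw [iIndepFun_iff_measure_inter_preimage_eq_mul] at hf hg ⊢
  intro s A hA
  have hA1 : ∀ i ∈ s.toLeft, MeasurableSet (A (Sum.inl i)) := fun i hi => hA _ (by simpa using hi)
  have hA2 : ∀ i ∈ s.toRight, MeasurableSet (A (Sum.inr i)) := fun i hi => hA _ (by simpa using hi)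
  have e1 : (⋂ i ∈ s, Sum.elim f g i ⁻¹' A i)
      = (fun ω i => f i ω) ⁻¹' (⋂ i ∈ s.toLeft, (fun x : ι → ℝ => x i) ⁻¹' A (Sum.inl i)) ∩
        (fun ω j => g j ω) ⁻¹' (⋂ j ∈ s.toRight, (fun x : τ → ℝ => x j) ⁻¹' A (Sum.inr j)) := by
    ext ω
    simp only [Set.mem_iInter, Set.mem_preimage, Set.mem_inter_iff, Finset.mem_toLeft,
      Finset.mem_toRight, Sum.forall, Sum.elim_inl, Sum.elim_inr]
  rw [e1, hfg.measure_inter_preimage_eq_mul _ _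
    (Finset.measurableSet_biInter _ fun i hi => (measurable_pi_apply i) (hA1 i hi))
    (Finset.measurableSet_biInter _ fun j hj => (measurable_pi_apply j) (hA2 j hj))]
  conv_rhs => rw [← Finset.toLeft_disjSum_toRight (u := s)]
  rw [Finset.prod_disjSum]
  congr 1
  · simp only [Set.preimage_iInter, Sum.elim_inl]
    exact hf s.toLeft hA1
  · simp only [Set.preimage_iInter, Sum.elim_inr]
    exact hg s.toRight hA2

end Standardization

/-! ### Centred quadratic forms in Zv + ε. -/

section CenteredQuad

variable {N m p k : ℕ}

/-- `C ↦ uᵀ C u - tr(C Σ)`. -/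
def centeredQuad (Sg : Matrix (Fin N) (Fin N) ℝ) (u : Fin N → ℝ) :
    Matrix (Fin N) (Fin N) ℝ →ₗ[ℝ] ℝ where
  toFun C := u ⬝ᵥ (C *ᵥ u) - (C * Sg).trace
  map_add' C D := by
    rw [Matrix.add_mulVec, dotProduct_add, Matrix.add_mul, Matrix.trace_add]
    ring
  map_smul' r C := by
    rw [Matrix.smul_mulVec, dotProduct_smul, Matrix.smul_mul, Matrix.trace_smul,
      RingHom.id_apply, smul_sub]

lemma centeredQuad_apply (Sg : Matrix (Fin N) (Fin N) ℝ) (u : Fin N → ℝ)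
    (C : Matrix (Fin N) (Fin N) ℝ) :
    centeredQuad Sg u C = u ⬝ᵥ (C *ᵥ u) - (C * Sg).trace := rfl

/-- Since uᵀu = q(1) + tr Σ, the single variable q(1) controls q(C) for all C at once, including
matrices evaluated at a random parameter. -/
lemma abs_centeredQuad_le (Sg : Matrix (Fin N) (Fin N) ℝ) (u : Fin N → ℝ) {c : ℝ}
    (hc : specNorm Sg ≤ c) (C : Matrix (Fin N) (Fin N) ℝ) :
    |centeredQuad Sg u C| ≤ specNorm C * (2 * c * N + |centeredQuad Sg u 1|) := by
  have h1 := abs_dotProduct_mulVec_le C u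
  have h2 := abs_trace_mul_le_specNorm C Sg
  have h3 : ∑ i, u i ^ 2 ≤ c * N + |centeredQuad Sg u 1| := by
    have h4 := le_abs_self (centeredQuad Sg u 1)
    have h5 := (le_abs_self _).trans (abs_trace_le_specNorm Sg)
    have h6 : (N : ℝ) * specNorm Sg ≤ N * c := mul_le_mul_of_nonneg_left hc (by positivity)
    rw [centeredQuad_apply, Matrix.one_mulVec, Matrix.one_mul] at h4 ⊢
    have : u ⬝ᵥ u = ∑ i, u i ^ 2 := Finset.sum_congr rfl fun i _ => (sq _).symm
    rw [this] at h4 ⊢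
    linarith
  have hC := specNorm_nonneg C
  have h7 : (N : ℝ) * (specNorm C * specNorm Sg) ≤ N * (specNorm C * c) :=
    mul_le_mul_of_nonneg_left (mul_le_mul_of_nonneg_left hc hC) (by positivity)
  have h8 := mul_le_mul_of_nonneg_left h3 hC
  have h9 := abs_sub (u ⬝ᵥ (C *ᵥ u)) (C * Sg).trace
  rw [← centeredQuad_apply] at h9
  linarith

variable (M : MixedModel N m p k) {Ω : Type*}

/-- The standardized errors and random effects. -/
noncomputable def stdErrors (ψ : Fin k → ℝ) (ε : Ω → Fin N → ℝ) (v : Ω → Fin m → ℝ) :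
    Fin N ⊕ Fin m → Ω → ℝ :=
  Sum.elim (fun i ω => ((CFC.sqrt (M.Re ψ))⁻¹ *ᵥ ε ω) i)
    (fun i ω => ((CFC.sqrt (M.Rv ψ))⁻¹ *ᵥ v ω) i)

/-- The matrix mapping the standardized variables to `Z v + ε`. -/
noncomputable def mixMatrix (ψ : Fin k → ℝ) : Matrix (Fin N) (Fin N ⊕ Fin m) ℝ :=
  Matrix.fromCols (CFC.sqrt (M.Re ψ)) (M.Z * CFC.sqrt (M.Rv ψ))

variable {M} {ψ : Fin k → ℝ} {Ke Kv S : ℝ} {ε : Ω → Fin N → ℝ} {v : Ω → Fin m → ℝ}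

lemma mixMatrix_mul_transpose (hRe : (M.Re ψ).PosDef) (hRv : (M.Rv ψ).PosDef) :
    mixMatrix M ψ * (mixMatrix M ψ)ᵀ = M.Sig ψ := by
  rw [mixMatrix, Matrix.transpose_fromCols, Matrix.fromCols_mul_fromRows, transpose_sqrt,
    sqrt_mul_sqrt_of_posDef hRe, Matrix.transpose_mul, transpose_sqrt, MixedModel.Sig]
  congr 1
  nth_rewrite 3 [← sqrt_mul_sqrt_of_posDef hRv]
  simp only [Matrix.mul_assoc]

lemma mixMatrix_mulVec_stdErrors (hRe : (M.Re ψ).PosDef) (hRv : (M.Rv ψ).PosDef) (ω : Ω) :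
    mixMatrix M ψ *ᵥ (fun i => stdErrors M ψ ε v i ω) = M.Z *ᵥ v ω + ε ω := by
  have : (fun i => stdErrors M ψ ε v i ω) = Sum.elim ((CFC.sqrt (M.Re ψ))⁻¹ *ᵥ ε ω)
      ((CFC.sqrt (M.Rv ψ))⁻¹ *ᵥ v ω) := by
    funext i
    rcases i with i | i <;> rfl
  rw [this, mixMatrix, Matrix.fromCols_mulVec, Sum.elim_comp_inl, Sum.elim_comp_inr,
    Matrix.mulVec_mulVec, Matrix.mulVec_mulVec, Matrix.mul_assoc,
    Matrix.mul_nonsing_inv _ (isUnit_det_sqrt hRe), Matrix.mul_nonsing_inv _ (isUnit_det_sqrt hRv),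
    Matrix.mul_one, Matrix.one_mulVec, add_comm]

/-- With T the mixing matrix, u = Tx for the standardized vector x and TTᵀ = Σ, so uᵀCu = xᵀ(TᵀCT)x
and tr(CΣ) = tr(TᵀCT). -/
lemma centeredQuad_eq_quadForm (hRe : (M.Re ψ).PosDef) (hRv : (M.Rv ψ).PosDef)
    (C : Matrix (Fin N) (Fin N) ℝ) (ω : Ω) :
    centeredQuad (M.Sig ψ) (M.Z *ᵥ v ω + ε ω) C
      = quadForm (stdErrors M ψ ε v) Finset.univ ((mixMatrix M ψ)ᵀ * C * mixMatrix M ψ) ω := by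
  rw [centeredQuad_apply, quadForm, ← mixMatrix_mulVec_stdErrors hRe hRv (ε := ε) (v := v) ω,
    ← mixMatrix_mul_transpose hRe hRv]
  congr 1
  · set x := fun i => stdErrors M ψ ε v i ω with hx
    have : (mixMatrix M ψ *ᵥ x) ⬝ᵥ (C *ᵥ (mixMatrix M ψ *ᵥ x))
        = x ⬝ᵥ (((mixMatrix M ψ)ᵀ * C * mixMatrix M ψ) *ᵥ x) := by
      conv_lhs => arg 1; rw [← Matrix.vecMul_transpose]
      rw [← Matrix.dotProduct_mulVec, Matrix.mulVec_mulVec, Matrix.mulVec_mulVec]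
    rw [this]
    simp only [dotProduct, Matrix.mulVec, Finset.mul_sum]
    exact Finset.sum_congr rfl fun i _ => Finset.sum_congr rfl fun j _ => by
      simp only [hx]; ring
  · rw [← Matrix.mul_assoc, Matrix.trace_mul_comm, ← Matrix.mul_assoc]
    rfl

lemma sum_mul_mixMatrix (hRe : (M.Re ψ).PosDef) (hRv : (M.Rv ψ).PosDef)
    (C D : Matrix (Fin N) (Fin N) ℝ) :
    ∑ i, ∑ j, ((mixMatrix M ψ)ᵀ * C * mixMatrix M ψ) i j *
      ((mixMatrix M ψ)ᵀ * D * mixMatrix M ψ) j i = (C * M.Sig ψ * D * M.Sig ψ).trace := by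
  rw [← mixMatrix_mul_transpose hRe hRv]
  have : (C * (mixMatrix M ψ * (mixMatrix M ψ)ᵀ) * D * (mixMatrix M ψ * (mixMatrix M ψ)ᵀ)).trace
      = (((mixMatrix M ψ)ᵀ * C * mixMatrix M ψ)
          * ((mixMatrix M ψ)ᵀ * D * mixMatrix M ψ)).trace := by
    rw [← Matrix.mul_assoc _ (mixMatrix M ψ), Matrix.trace_mul_comm]
    simp only [Matrix.mul_assoc]
  rw [this]
  exact Finset.sum_congr rfl fun i _ => Matrix.mul_apply.symm

/-- The sum of squares equals tr(CΣCᵀΣ), to which Cauchy–Schwarz applies. -/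
lemma sum_sq_mixMatrix_le (hRe : (M.Re ψ).PosDef) (hRv : (M.Rv ψ).PosDef)
    (C : Matrix (Fin N) (Fin N) ℝ) :
    ∑ i, ∑ j, ((mixMatrix M ψ)ᵀ * C * mixMatrix M ψ) i j ^ 2
      ≤ (specNorm (M.Sig ψ) * frob C) ^ 2 := by
  have e : ∀ i j, ((mixMatrix M ψ)ᵀ * Cᵀ * mixMatrix M ψ) j i
      = ((mixMatrix M ψ)ᵀ * C * mixMatrix M ψ) i j := by
    intro i j
    have : (mixMatrix M ψ)ᵀ * Cᵀ * mixMatrix M ψ = ((mixMatrix M ψ)ᵀ * C * mixMatrix M ψ)ᵀ := by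
      rw [Matrix.transpose_mul, Matrix.transpose_mul, Matrix.transpose_transpose, Matrix.mul_assoc]
    rw [this, Matrix.transpose_apply]
  have h := sum_mul_mixMatrix (M := M) (ψ := ψ) hRe hRv C Cᵀ
  simp only [e, ← sq] at h
  rw [h, Matrix.mul_assoc (C * _)]
  refine ((le_abs_self _).trans (abs_trace_mul_le _ _)).trans ?_
  have h1 := frob_mul_le_mul_specNorm C (M.Sig ψ)
  have h2 := frob_mul_le_mul_specNorm Cᵀ (M.Sig ψ)
  rw [frob_transpose] at h2
  rw [sq, mul_comm (specNorm _)]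
  exact mul_le_mul h1 h2 (frob_nonneg _) (mul_nonneg (frob_nonneg _) (specNorm_nonneg _))

variable [MeasurableSpace Ω] {μ : Measure Ω}

lemma stdFamily_stdErrors [IsProbabilityMeasure μ] (h : M.ErrorLaw μ ψ Ke Kv S ε v) :
    StdFamily μ (stdErrors M ψ ε v) (Sum.elim (fun _ => Ke) (fun _ => Kv)) (1 + |S|) := by
  have hme : ∀ i, Measurable fun ω => ((CFC.sqrt (M.Re ψ))⁻¹ *ᵥ ε ω) i := fun i => by
    have := h.measurable_e
    simp only [Matrix.mulVec, dotProduct]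
    fun_prop
  have hmv : ∀ i, Measurable fun ω => ((CFC.sqrt (M.Rv ψ))⁻¹ *ᵥ v ω) i := fun i => by
    have := h.measurable_v
    simp only [Matrix.mulVec, dotProduct]
    fun_prop
  have he := standardized_moments h.posDef_e h.mean_e h.cov_e h.memLp_e
  have hv := standardized_moments h.posDef_v h.mean_v h.cov_v h.memLp_v
  refine ⟨?_, ?_, ?_, by linarith [abs_nonneg S], ?_, ?_, ?_, ?_⟩
  · refine iIndepFun_sumElim h.indep_e h.indep_v ?_
    refine h.indep.comp (φ := fun x i => ((CFC.sqrt (M.Re ψ))⁻¹ *ᵥ x) i)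
      (ψ := fun x i => ((CFC.sqrt (M.Rv ψ))⁻¹ *ᵥ x) i) ?_ ?_ <;>
    · simp only [Matrix.mulVec, dotProduct]
      fun_prop
  · rintro (i | i)
    · exact hme i
    · exact hmv i
  · rintro (i | i)
    · exact (he i).1
    · exact (hv i).1
  · rintro (i | i)
    · exact (he i).2
    · exact (hv i).2
  · rintro (i | i)
    · exact h.fourth_e i
    · exact h.fourth_v i
  · rintro (i | i)
    · exact l3Le_of_sixth (h.memLp_e i) (h.sixth_e i) (hme i).aestronglyMeasurable
        fun ω => abs_cube_le_one_add_pow_six _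
    · exact l3Le_of_sixth (h.memLp_v i) (h.sixth_v i) (hmv i).aestronglyMeasurable
        fun ω => abs_cube_le_one_add_pow_six _
  · rintro (i | i)
    · exact l3Le_of_sixth (h.memLp_e i) (h.sixth_e i)
        (((hme i).pow_const 2).sub_const 1).aestronglyMeasurable fun ω => abs_sq_sub_one_cube_le _
    · exact l3Le_of_sixth (h.memLp_v i) (h.sixth_v i)
        (((hmv i).pow_const 2).sub_const 1).aestronglyMeasurable fun ω => abs_sq_sub_one_cube_le _

/-- The main probabilistic estimate. Its dependence on the Frobenius norm gives O(√N) for the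
weights themselves and O(1) for the difference between projected and original weights. -/
lemma l3Le_centeredQuad [IsProbabilityMeasure μ] (h : M.ErrorLaw μ ψ Ke Kv S ε v)
    (C : Matrix (Fin N) (Fin N) ℝ) :
    L3Le μ (fun ω => centeredQuad (M.Sig ψ) (M.Z *ᵥ v ω + ε ω) C)
      (9 * (1 + |S|) ^ 2 * specNorm (M.Sig ψ) * frob C) := by
  have e := (stdFamily_stdErrors h).l3Le_quadForm Finset.univ
    ((mixMatrix M ψ)ᵀ * C * mixMatrix M ψ)
  rw [show (fun ω => centeredQuad (M.Sig ψ) (M.Z *ᵥ v ω + ε ω) C) = _ from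
    funext fun ω => centeredQuad_eq_quadForm h.posDef_e h.posDef_v C ω]
  refine e.mono ?_
  have h0 := specNorm_nonneg (M.Sig ψ)
  have h1 := frob_nonneg C
  have hS := abs_nonneg S
  -- The factor 9 absorbs √72.
  rw [Real.sqrt_le_left (by positivity)]
  have := mul_le_mul_of_nonneg_left (sum_sq_mixMatrix_le h.posDef_e h.posDef_v C)
    (by positivity : 0 ≤ 72 * (1 + |S|) ^ 4)
  refine this.trans ?_
  have h2 : 0 ≤ (1 + |S|) ^ 4 * (specNorm (M.Sig ψ) * frob C) ^ 2 := by positivity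
  nlinarith [h2]

lemma integral_centeredQuad [IsProbabilityMeasure μ] (h : M.ErrorLaw μ ψ Ke Kv S ε v)
    (C : Matrix (Fin N) (Fin N) ℝ) :
    ∫ ω, centeredQuad (M.Sig ψ) (M.Z *ᵥ v ω + ε ω) C ∂μ = 0 := by
  simp only [centeredQuad_eq_quadForm h.posDef_e h.posDef_v]
  exact ((stdFamily_stdErrors h).hasInt_quadForm _ _).2

/-- Covariance of two quadratic forms in `Z v + ε`. -/
lemma integral_centeredQuad_mul [IsProbabilityMeasure μ] (h : M.ErrorLaw μ ψ Ke Kv S ε v)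
    (C D : Matrix (Fin N) (Fin N) ℝ) (hD : D.IsSymm) :
    ∫ ω, centeredQuad (M.Sig ψ) (M.Z *ᵥ v ω + ε ω) C
        * centeredQuad (M.Sig ψ) (M.Z *ᵥ v ω + ε ω) D ∂μ
      = 2 * (C * M.Sig ψ * D * M.Sig ψ).trace + (Ke * M.he ψ C D + Kv * M.hv ψ C D) := by
  simp only [centeredQuad_eq_quadForm h.posDef_e h.posDef_v]
  rw [((stdFamily_stdErrors h).hasInt_quadForm_mul_quadForm _ _ _).2]
  congr 1
  -- Symmetry of D merges the two terms D_ij + D_ji into 2D_ji.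
  · have hs : ∀ i j, ((mixMatrix M ψ)ᵀ * D * mixMatrix M ψ) i j
        = ((mixMatrix M ψ)ᵀ * D * mixMatrix M ψ) j i := by
      intro i j
      have : ((mixMatrix M ψ)ᵀ * D * mixMatrix M ψ)ᵀ = (mixMatrix M ψ)ᵀ * D * mixMatrix M ψ := by
        rw [Matrix.transpose_mul, Matrix.transpose_mul, hD.eq, Matrix.transpose_transpose,
          Matrix.mul_assoc]
      exact congrFun (congrFun this j) i
    rw [← sum_mul_mixMatrix h.posDef_e h.posDef_v, Finset.mul_sum]
    refine Finset.sum_congr rfl fun i _ => ?_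
    rw [Finset.mul_sum]
    refine Finset.sum_congr rfl fun j _ => ?_
    rw [hs i j]
    ring
  · have e1 : ∀ (F : Matrix (Fin N) (Fin N) ℝ) i,
        ((mixMatrix M ψ)ᵀ * F * mixMatrix M ψ) (Sum.inl i) (Sum.inl i)
          = (CFC.sqrt (M.Re ψ) * F * CFC.sqrt (M.Re ψ)) i i := by
      intro F i
      rw [mixMatrix, Matrix.transpose_fromCols, Matrix.fromRows_mul, Matrix.fromRows_mul_fromCols,
        transpose_sqrt]
      rfl
    have e2 : ∀ (F : Matrix (Fin N) (Fin N) ℝ) i,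
        ((mixMatrix M ψ)ᵀ * F * mixMatrix M ψ) (Sum.inr i) (Sum.inr i)
          = (CFC.sqrt (M.Rv ψ) * M.Zᵀ * F * M.Z * CFC.sqrt (M.Rv ψ)) i i := by
      intro F i
      rw [mixMatrix, Matrix.transpose_fromCols, Matrix.fromRows_mul, Matrix.fromRows_mul_fromCols,
        Matrix.transpose_mul, transpose_sqrt, transpose_sqrt, Matrix.fromBlocks_apply₂₂,
        ← Matrix.mul_assoc]
    rw [Fintype.sum_sum_type, MixedModel.he, MixedModel.hv, Finset.mul_sum, Finset.mul_sum]
    simp only [e1, e2, Sum.elim_inl, Sum.elim_inr]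

end CenteredQuad

/-! ### Existence, localization and Taylor expansion of zeros of the score. -/

section Expansion

variable {k N : ℕ}

/-- Regularity at sample size `N` with constant `c` of the equations `q(V_a) = tr(V_a D)`. -/
structure EstSystem (Θ : Set (Fin k → ℝ)) (ψ₀ : Fin k → ℝ) (c : ℝ) (V : Weights N k)
    (D : (Fin k → ℝ) → Matrix (Fin N) (Fin N) ℝ) (A : Matrix (Fin k) (Fin k) ℝ)
    (H : Fin k → Matrix (Fin k) (Fin k) ℝ) : Prop where
  smooth_V : ∀ a, EntrySmooth 3 Θ (V a)
  smooth_D : EntrySmooth 3 Θ D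
  bound_V : ∀ a, DerivBound specNorm Θ 3 (V a) c
  bound_D : ∀ b, DerivBound specNorm Θ 2 (pderiv b D) c
  D_zero : D ψ₀ = 0
  ident : ∀ ψ ∈ Θ, N * ‖ψ - ψ₀‖ ≤ c * ‖fun a => (V a ψ * D ψ).trace‖
  coercive : ∀ h, N * ‖h‖ ≤ c * ‖A *ᵥ h‖
  grad : ∀ a b, |(V a ψ₀ * pderiv b D ψ₀).trace - A a b| ≤ c
  hess : ∀ a b d, |(pderiv b (V a) ψ₀ * pderiv d D ψ₀).trace
    + (V a ψ₀ * pderiv b (pderiv d D) ψ₀).trace / 2 - H a b d| ≤ c * √N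

/-- The estimating functions. -/
def score (V : Weights N k) (D : (Fin k → ℝ) → Matrix (Fin N) (Fin N) ℝ)
    (q : Matrix (Fin N) (Fin N) ℝ →ₗ[ℝ] ℝ) (ψ : Fin k → ℝ) (a : Fin k) : ℝ :=
  q (V a ψ) - (V a ψ * D ψ).trace

lemma mulVec_apply_eq_sum (A : Matrix (Fin k) (Fin k) ℝ) (x : Fin k → ℝ) (a : Fin k) :
    (A *ᵥ x) a = ∑ b, x b * A a b := by
  rw [Matrix.mulVec, dotProduct]
  exact Finset.sum_congr rfl fun b _ => mul_comm _ _

lemma isUnit_det_of_coercive {A : Matrix (Fin k) (Fin k) ℝ} {c n : ℝ} (hn : 0 < n)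
    (h : ∀ x, n * ‖x‖ ≤ c * ‖A *ᵥ x‖) : IsUnit A.det := by
  rw [← Matrix.isUnit_iff_isUnit_det, ← Matrix.mulVec_injective_iff_isUnit]
  intro x y hxy
  have := h (x - y)
  rw [Matrix.mulVec_sub, sub_eq_zero.2 hxy, norm_zero, mul_zero] at this
  have h2 : ‖x - y‖ ≤ 0 := by
    by_contra h3
    exact absurd (mul_pos hn (not_le.1 h3)) (not_lt.2 this)
  exact sub_eq_zero.1 (norm_le_zero_iff.1 h2)

lemma norm_inv_mulVec_le {A : Matrix (Fin k) (Fin k) ℝ} {c n : ℝ} (hn : 0 < n)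
    (h : ∀ x, n * ‖x‖ ≤ c * ‖A *ᵥ x‖) (y : Fin k → ℝ) : n * ‖A⁻¹ *ᵥ y‖ ≤ c * ‖y‖ := by
  have := h (A⁻¹ *ᵥ y)
  rwa [Matrix.mulVec_mulVec, Matrix.mul_nonsing_inv _ (isUnit_det_of_coercive hn h),
    Matrix.one_mulVec] at this

/-- A quantitative inverse function theorem with radius uniform in the sample size: f deviates from
the linear map -A by n/(2c), while the inverse of A has norm at most c/n. The margin n/c - n/(2c) =
n/(2c) is what bounds f(x₀). -/
lemma exists_zero_of_approx_linear {A : Matrix (Fin k) (Fin k) ℝ} {c n ρ : ℝ} (hn : 0 < n)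
    (hc : 0 < c) (hρ : 0 ≤ ρ) (h : ∀ x, n * ‖x‖ ≤ c * ‖A *ᵥ x‖)
    {f : (Fin k → ℝ) → (Fin k → ℝ)} {x₀ : Fin k → ℝ}
    (hf : ∀ x ∈ Metric.closedBall x₀ ρ, ∀ y ∈ Metric.closedBall x₀ ρ,
      ‖f x - f y + A *ᵥ (x - y)‖ ≤ n / (2 * c) * ‖x - y‖)
    (h₀ : ‖f x₀‖ ≤ n / (2 * c) * ρ) : ∃ x ∈ Metric.closedBall x₀ ρ, f x = 0 := by
  let f' : (Fin k → ℝ) →L[ℝ] (Fin k → ℝ) := -(Matrix.mulVecLin A).toContinuousLinearMap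
  have hu := isUnit_det_of_coercive hn h
  let f'symm : f'.NonlinearRightInverse :=
    { toFun := fun y => -(A⁻¹ *ᵥ y)
      nnnorm := ⟨c / n, by positivity⟩
      bound' := fun y => by
        have := norm_inv_mulVec_le hn h y
        rw [norm_neg]
        change _ ≤ c / n * ‖y‖
        rw [div_mul_eq_mul_div, le_div_iff₀ hn]
        linarith
      right_inv' := fun y => by
        simp [f', Matrix.mulVec_neg, Matrix.mulVec_mulVec, Matrix.mul_nonsing_inv _ hu] }
  have ha : ApproximatesLinearOn f f' (Metric.closedBall x₀ ρ) ⟨n / (2 * c), by positivity⟩ := by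
    intro x hx y hy
    have e : f' (x - y) = -(A *ᵥ (x - y)) := rfl
    rw [e, sub_neg_eq_add]
    exact hf x hx y hy
  have hs := ha.surjOn_closedBall_of_nonlinearRightInverse f'symm hρ subset_rfl
  have hm : (0 : Fin k → ℝ) ∈ Metric.closedBall (f x₀)
      (((f'symm.nnnorm : ℝ)⁻¹ - (⟨n / (2 * c), by positivity⟩ : NNReal)) * ρ) := by
    rw [mem_closedBall_iff_norm, zero_sub, norm_neg]
    refine h₀.trans (le_of_eq ?_)
    change _ = ((c / n)⁻¹ - n / (2 * c)) * ρ
    field_simp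
    ring
  obtain ⟨x, hx, hx0⟩ := hs hm
  exact ⟨x, hx, hx0⟩

variable {Θ : Set (Fin k → ℝ)} {ψ₀ : Fin k → ℝ} {c : ℝ} {V : Weights N k}
  {D : (Fin k → ℝ) → Matrix (Fin N) (Fin N) ℝ} {A : Matrix (Fin k) (Fin k) ℝ}
  {H : Fin k → Matrix (Fin k) (Fin k) ℝ} {q : Matrix (Fin N) (Fin N) ℝ →ₗ[ℝ] ℝ}

/-- At a zero the trace in the identification inequality equals q(V_a(ψ)), so small noise forces ψ
close to ψ₀. -/
lemma EstSystem.norm_sub_le_of_score_eq_zero (hs : EstSystem Θ ψ₀ c V D A H) (hc : 0 ≤ c)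
    {ψ : Fin k → ℝ} (hψ : ψ ∈ Θ) (h0 : score V D q ψ = 0) {B : ℝ} (hB : 0 ≤ B)
    (h : ∀ a, |q (V a ψ)| ≤ B) : N * ‖ψ - ψ₀‖ ≤ c * B := by
  refine (hs.ident ψ hψ).trans (mul_le_mul_of_nonneg_left ?_ hc)
  rw [pi_norm_le_iff_of_nonneg hB]
  intro a
  have := congrFun h0 a
  rw [score, Pi.zero_apply, sub_eq_zero] at this
  rw [← this]
  exact h a

/-- A solution is within `ρ` of `ψ₀` if `q` is small on a fine net. -/
lemma EstSystem.norm_sub_le_of_net (hs : EstSystem Θ ψ₀ c V D A H) (hΘ : IsOpen Θ)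
    (hΘc : Convex ℝ Θ) (hc : 1 ≤ c) (hN : 0 < N)
    (hq : ∀ C, |q C| ≤ specNorm C * (c * N + |q 1|)) {ρ ε κ : ℝ} (hκ0 : 0 ≤ κ) (hκ : κ ≤ 1)
    (hε0 : 0 ≤ ε) (hq1 : |q 1| ≤ N * κ) {J : Set (Fin k → ℝ)} (hJΘ : J ⊆ Θ)
    (hJ : ∀ ψ ∈ Θ, ‖ψ - ψ₀‖ ≤ 2 * c ^ 3 → ∃ θ ∈ J, ‖ψ - θ‖ ≤ ε)
    (hnet : ∀ θ ∈ J, ∀ a, |q (V a θ)| ≤ N * κ) (hsmall : c * (κ + 2 * k * c ^ 2 * ε) ≤ ρ)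
    {ψ : Fin k → ℝ} (hψ : ψ ∈ Θ) (h0 : score V D q ψ = 0) : ‖ψ - ψ₀‖ ≤ ρ := by
  have hN' : (0 : ℝ) < N := by exact_mod_cast hN
  have hc0 : 0 ≤ c := by linarith
  have hq2 : c * N + |q 1| ≤ 2 * c * N := by nlinarith
  -- Crude a priori bound, which confines all zeros to a bounded part of Θ and makes a finite net
  -- sufficient.
  have h1 : ‖ψ - ψ₀‖ ≤ 2 * c ^ 3 := by
    have := hs.norm_sub_le_of_score_eq_zero hc0 hψ h0 (B := c * (2 * c * N)) (by positivity)
      fun a => (hq _).trans (mul_le_mul ((hs.bound_V a).le hψ) hq2 (by positivity) hc0)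
    refine le_of_mul_le_mul_left (this.trans (le_of_eq ?_)) hN'
    ring
  obtain ⟨θ, hθJ, hθ⟩ := hJ ψ hψ h1
  -- The noise is Lipschitz in ψ with constant 2kc²N, so its smallness passes from the net to ψ.
  have h2 : ∀ a, |q (V a ψ)| ≤ N * (κ + 2 * k * c ^ 2 * ε) := by
    intro a
    have := abs_sub_le_of_pderiv_bound hΘ hΘc (n := 2) (hs.smooth_V a) q (C := c * (2 * c * N))
      (fun b φ hφ => (hq _).trans
        (mul_le_mul (((hs.bound_V a).bound_pderiv b).le hφ) hq2 (by positivity) hc0))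
      (hJΘ hθJ) hψ
    have h3 : (k : ℝ) * (c * (2 * c * N)) * ‖ψ - θ‖ ≤ k * (c * (2 * c * N)) * ε :=
      mul_le_mul_of_nonneg_left hθ (by positivity)
    have h4 := hnet θ hθJ a
    have h5 := abs_add_le (q (V a ψ) - q (V a θ)) (q (V a θ))
    rw [sub_add_cancel] at h5
    linarith
  have := hs.norm_sub_le_of_score_eq_zero hc0 hψ h0 (by positivity) h2
  have h3 := mul_le_mul_of_nonneg_left hsmall hN'.le
  refine le_of_mul_le_mul_left (this.trans ((le_of_eq ?_).trans h3)) hN'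
  ring

section Local

variable {ρ : ℝ}

lemma EstSystem.smooth_mul (hs : EstSystem Θ ψ₀ c V D A H) (a : Fin k) :
    EntrySmooth 3 Θ (fun ψ => V a ψ * D ψ) := (hs.smooth_V a).mul hs.smooth_D

/-- D itself is bounded only near ψ₀: it vanishes there and its derivatives are bounded. The factor
8 = 2³ comes from the Leibniz rule. -/
lemma EstSystem.bound_mul (hs : EstSystem Θ ψ₀ c V D A H) (hΘ : IsOpen Θ) (hΘc : Convex ℝ Θ)
    (hψ₀ : ψ₀ ∈ Θ) (hc : 1 ≤ c) (hρ : ρ ≤ 1) (hb : Metric.ball ψ₀ ρ ⊆ Θ) (a : Fin k) :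
    DerivBound specNorm (Metric.ball ψ₀ ρ) 3 (fun ψ => V a ψ * D ψ) (8 * (k + 1) * c ^ 2) := by
  have hc0 : 0 ≤ c := by linarith
  have h0 : DerivBound specNorm (Metric.ball ψ₀ ρ) 3 D ((k + 1) * c) := by
    refine ⟨fun ψ hψ => ?_, fun b => (hs.bound_D b).weaken hb
      (by nlinarith [mul_nonneg (Nat.cast_nonneg (α := ℝ) k) hc0])⟩
    have := specNorm_sub_le_of_pderiv_bound hΘ hΘc (n := 2) hs.smooth_D hc0
      (fun b φ hφ => (hs.bound_D b).le hφ) hψ₀ (hb hψ)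
    rw [hs.D_zero, sub_zero] at this
    have h1 : ‖ψ - ψ₀‖ ≤ 1 := (mem_ball_iff_norm.1 hψ).le.trans hρ
    have h2 : (k : ℝ) * c * ‖ψ - ψ₀‖ ≤ k * c * 1 := mul_le_mul_of_nonneg_left h1 (by positivity)
    nlinarith
  refine (DerivBound.mul Metric.isOpen_ball specNorm_add_le specNorm_mul_le specNorm_nonneg hc0
    (by positivity) ((hs.smooth_V a).mono hb) (hs.smooth_D.mono hb)
    ((hs.bound_V a).weaken hb le_rfl) h0).weaken subset_rfl (le_of_eq ?_)
  ring

lemma EstSystem.pderiv_mul_center (hs : EstSystem Θ ψ₀ c V D A H) (hΘ : IsOpen Θ)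
    (hψ₀ : ψ₀ ∈ Θ) (a b : Fin k) :
    pderiv b (fun ψ => V a ψ * D ψ) ψ₀ = V a ψ₀ * pderiv b D ψ₀ := by
  have := pderiv_mul hΘ (n := 2) (hs.smooth_V a) hs.smooth_D b hψ₀
  simp only at this
  rw [this, hs.D_zero, mul_zero, zero_add]

lemma EstSystem.pderiv_pderiv_mul_center (hs : EstSystem Θ ψ₀ c V D A H) (hΘ : IsOpen Θ)
    (hψ₀ : ψ₀ ∈ Θ) (a b d : Fin k) :
    pderiv b (pderiv d (fun ψ => V a ψ * D ψ)) ψ₀ = pderiv d (V a) ψ₀ * pderiv b D ψ₀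
      + (pderiv b (V a) ψ₀ * pderiv d D ψ₀ + V a ψ₀ * pderiv b (pderiv d D) ψ₀) := by
  have sV := hs.smooth_V a
  have sD := hs.smooth_D
  have sV' := sV.smooth_pderiv (n := 2) hΘ d
  have sD' := sD.smooth_pderiv (n := 2) hΘ d
  rw [pderiv_congr hΘ (pderiv_mul hΘ (n := 2) sV sD d) b hψ₀,
    pderiv_add hΘ (n := 1) (sV'.mul (sD.of_le (by norm_num)))
      ((sV.of_le (by norm_num)).mul sD') b hψ₀]
  have h1 := pderiv_mul hΘ (n := 1) sV' (sD.of_le (by norm_num)) b hψ₀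
  have h2 := pderiv_mul hΘ (n := 1) (sV.of_le (by norm_num)) sD' b hψ₀
  simp only at h1 h2 ⊢
  rw [h1, h2, hs.D_zero, mul_zero, zero_add]

/-- Near `ψ₀` the estimating functions are approximately linear with derivative `-A`. -/
lemma EstSystem.abs_score_sub_le (hs : EstSystem Θ ψ₀ c V D A H) (hΘ : IsOpen Θ)
    (hΘc : Convex ℝ Θ) (hψ₀ : ψ₀ ∈ Θ) (hc : 1 ≤ c) (hρ0 : 0 < ρ) (hρ : ρ ≤ 1)
    (hb : Metric.ball ψ₀ ρ ⊆ Θ)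
    (hq : ∀ C, |q C| ≤ specNorm C * (c * N + |q 1|)) {κ : ℝ} (hκ : κ ≤ 1)
    (hq1 : |q 1| ≤ N * κ) (hq2 : ∀ a b, |q (pderiv b (V a) ψ₀)| ≤ N * κ)
    {x y : Fin k → ℝ} (hx : x ∈ Metric.ball ψ₀ ρ) (hy : y ∈ Metric.ball ψ₀ ρ) (a : Fin k) :
    |(score V D q x - score V D q y + A *ᵥ (x - y)) a|
      ≤ (N * (k * κ + (2 * k ^ 2 * c ^ 2 + 8 * k ^ 2 * (k + 1) * c ^ 2) * ρ) + k * c)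
        * ‖x - y‖ := by
  have hN' : (0 : ℝ) ≤ N := Nat.cast_nonneg _
  have hc0 : 0 ≤ c := by linarith
  have hq3 : c * N + |q 1| ≤ 2 * c * N := by nlinarith
  have cB := convex_ball ψ₀ ρ
  have oB : IsOpen (Metric.ball ψ₀ ρ) := Metric.isOpen_ball
  have hψB : ψ₀ ∈ Metric.ball ψ₀ ρ := Metric.mem_ball_self hρ0
  have sV := (hs.smooth_V a).mono hb
  have sVD := (hs.smooth_mul a).mono hb
  have bVD := hs.bound_mul hΘ hΘc hψ₀ hc hρ hb a
  have h1 : ∀ b, ∀ ψ ∈ Metric.ball ψ₀ ρ, |q (pderiv b (V a) ψ)|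
      ≤ N * κ + k * (c * (2 * c * N)) * ρ := by
    intro b ψ hψ
    have := abs_sub_le_of_pderiv_bound oB cB (n := 1) (sV.smooth_pderiv (n := 2) oB b) q
      (C := c * (2 * c * N)) (fun d φ hφ => (hq _).trans
        (mul_le_mul ((((hs.bound_V a).bound_pderiv b).bound_pderiv d).le (hb hφ)) hq3
          (by positivity) hc0)) hψB hψ
    have h3 := mul_le_mul_of_nonneg_left (mem_ball_iff_norm.1 hψ).le
      (by positivity : 0 ≤ (k : ℝ) * (c * (2 * c * N)))
    have h4 := hq2 a b
    have h5 := abs_add_le (q (pderiv b (V a) ψ) - q (pderiv b (V a) ψ₀)) (q (pderiv b (V a) ψ₀))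
    rw [sub_add_cancel] at h5
    linarith
  have e1 := abs_sub_le_of_pderiv_bound oB cB (n := 2) sV q h1 hy hx
  set tr := Matrix.traceLinearMap (Fin N) ℝ ℝ with htr
  have h2 : ∀ b, ∀ ψ ∈ Metric.ball ψ₀ ρ, |tr (pderiv b (fun ψ => V a ψ * D ψ) ψ) - A a b|
      ≤ k * (N * (8 * (k + 1) * c ^ 2)) * ρ + c := by
    intro b ψ hψ
    have := abs_sub_le_of_pderiv_bound oB cB (n := 1) (sVD.smooth_pderiv (n := 2) oB b) tr
      (C := N * (8 * (k + 1) * c ^ 2)) (fun d φ hφ => (abs_trace_le_specNorm _).trans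
        (mul_le_mul_of_nonneg_left (((bVD.bound_pderiv b).bound_pderiv d).le hφ) hN')) hψB hψ
    have h3 := mul_le_mul_of_nonneg_left (mem_ball_iff_norm.1 hψ).le
      (by positivity : 0 ≤ (k : ℝ) * (N * (8 * (k + 1) * c ^ 2)))
    have h4 := hs.grad a b
    rw [← hs.pderiv_mul_center hΘ hψ₀] at h4
    have h5 := abs_add_le (tr (pderiv b (fun ψ => V a ψ * D ψ) ψ)
      - tr (pderiv b (fun ψ => V a ψ * D ψ) ψ₀)) (tr (pderiv b (fun ψ => V a ψ * D ψ) ψ₀) - A a b)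
    rw [sub_add_sub_cancel] at h5
    have h6 : tr (pderiv b (fun ψ => V a ψ * D ψ) ψ₀)
      = (pderiv b (fun ψ => V a ψ * D ψ) ψ₀).trace := rfl
    rw [← h6] at h4
    linarith
  have e2 := abs_sub_sub_le_of_pderiv_near oB cB (n := 2) sVD tr h2 hy hx
  have e3 : (score V D q x - score V D q y + A *ᵥ (x - y)) a = (q (V a x) - q (V a y))
      - (tr (V a x * D x) - tr (V a y * D y) - ∑ b, (x - y) b * A a b) := by
    rw [Pi.add_apply, Pi.sub_apply, mulVec_apply_eq_sum, score, score]
    simp only [htr, Matrix.traceLinearMap_apply]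
    ring
  rw [e3]
  refine (abs_sub _ _).trans ((add_le_add e1 e2).trans (le_of_eq ?_))
  ring

lemma abs_sum_sum_mul_mul_le {x y : Fin k → ℝ} {F : Matrix (Fin k) (Fin k) ℝ} {B : ℝ}
    (hF : ∀ b d, |F b d| ≤ B) : |∑ b, x b * ∑ d, y d * F b d| ≤ k ^ 2 * B * (‖x‖ * ‖y‖) := by
  refine (abs_sum_mul_le fun b => abs_sum_mul_le fun d => hF b d).trans (le_of_eq ?_)
  ring

/-- Third order expansion of the estimating equations at a solution. -/
lemma EstSystem.abs_expansion_le (hs : EstSystem Θ ψ₀ c V D A H) (hΘ : IsOpen Θ)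
    (hΘc : Convex ℝ Θ) (hψ₀ : ψ₀ ∈ Θ) (hc : 1 ≤ c) (hρ0 : 0 < ρ) (hρ : ρ ≤ 1)
    (hb : Metric.ball ψ₀ ρ ⊆ Θ)
    (hq : ∀ C, |q C| ≤ specNorm C * (c * N + |q 1|)) {z : ℝ} (hz0 : 0 ≤ z) (hz1 : z ≤ 1)
    (hz : 1 ≤ N * z ^ 2)
    (hq1 : |q 1| ≤ N * z) (hq2 : ∀ a b d, |q (pderiv b (pderiv d (V a)) ψ₀)| ≤ N * z)
    {ψ : Fin k → ℝ} (hψ : ψ ∈ Metric.ball ψ₀ ρ) (h0 : score V D q ψ = 0) {C₁ : ℝ} (hC₁ : 0 ≤ C₁)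
    (hδ : ‖ψ - ψ₀‖ ≤ C₁ * z) (a : Fin k) :
    |(A *ᵥ (ψ - ψ₀)) a - q (V a ψ₀) - ∑ b, (ψ - ψ₀) b * q (pderiv b (V a) ψ₀)
      + ∑ b, (ψ - ψ₀) b * ∑ d, (ψ - ψ₀) d * H a b d|
      ≤ (k ^ 3 * (2 * c ^ 2 + 8 * (k + 1) * c ^ 2) * C₁ ^ 3 + k * c * C₁
          + 2 * k ^ 2 * c * C₁ ^ 2) * (N * z ^ 3) := by
  have hN' : (0 : ℝ) ≤ N := Nat.cast_nonneg _
  have hc0 : 0 ≤ c := by linarith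
  have hq3 : c * N + |q 1| ≤ 2 * c * N := by nlinarith
  -- Because Nz² ≥ 1, the error c√N in the Hessian is of the order Nz of the noise.
  have hsq : √N ≤ N * z := by
    rw [Real.sqrt_le_left (by positivity), mul_pow]
    nlinarith
  have cB := convex_ball ψ₀ ρ
  have oB : IsOpen (Metric.ball ψ₀ ρ) := Metric.isOpen_ball
  have hψB : ψ₀ ∈ Metric.ball ψ₀ ρ := Metric.mem_ball_self hρ0
  have sV := (hs.smooth_V a).mono hb
  have sVD := (hs.smooth_mul a).mono hb
  have bVD := hs.bound_mul hΘ hΘc hψ₀ hc hρ hb a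
  set tr := Matrix.traceLinearMap (Fin N) ℝ ℝ with htr
  set δ := ψ - ψ₀ with hδdef
  have t1 := abs_taylor_two_le_of_pderiv_bound oB cB sV q (C := c * (2 * c * N))
    (fun b d e φ hφ => (hq _).trans (mul_le_mul
      (((((hs.bound_V a).bound_pderiv e).bound_pderiv d).bound_pderiv b).le (hb hφ)) hq3
        (by positivity) hc0)) hψB hψ
  have t2 := abs_taylor_two_le_of_pderiv_bound oB cB sVD tr (C := N * (8 * (k + 1) * c ^ 2))
    (fun b d e φ hφ => (abs_trace_le_specNorm _).trans (mul_le_mul_of_nonneg_left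
      ((((bVD.bound_pderiv e).bound_pderiv d).bound_pderiv b).le hφ) hN')) hψB hψ
  rw [← hδdef] at t1 t2
  have t3 : |∑ b, δ b * (A a b - (V a ψ₀ * pderiv b D ψ₀).trace)| ≤ k * c * ‖δ‖ :=
    abs_sum_mul_le fun b => by rw [abs_sub_comm]; exact hs.grad a b
  have t4 : |∑ b, δ b * ∑ d, δ d * q (pderiv d (pderiv b (V a)) ψ₀)|
      ≤ k ^ 2 * (N * z) * (‖δ‖ * ‖δ‖) :=
    abs_sum_sum_mul_mul_le (F := fun b d => q (pderiv d (pderiv b (V a)) ψ₀))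
      fun b d => hq2 a d b
  have t5 : |∑ b, δ b * ∑ d, δ d * (H a b d - ((pderiv b (V a) ψ₀ * pderiv d D ψ₀).trace
      + (V a ψ₀ * pderiv b (pderiv d D) ψ₀).trace / 2))| ≤ k ^ 2 * (c * √N) * (‖δ‖ * ‖δ‖) :=
    abs_sum_sum_mul_mul_le (F := fun b d => H a b d - ((pderiv b (V a) ψ₀ * pderiv d D ψ₀).trace
      + (V a ψ₀ * pderiv b (pderiv d D) ψ₀).trace / 2))
      fun b d => by rw [abs_sub_comm]; exact hs.hess a b d
  -- Contraction with δ twice identifies the two mixed terms of the product rule, so half the second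
  -- derivative of tr(V_aD) becomes exactly the expression compared with H.
  have hh : (∑ b, δ b * ∑ d, δ d * tr (pderiv d (pderiv b (fun ψ => V a ψ * D ψ)) ψ₀)) / 2
      = ∑ b, δ b * ∑ d, δ d * ((pderiv b (V a) ψ₀ * pderiv d D ψ₀).trace
      + (V a ψ₀ * pderiv b (pderiv d D) ψ₀).trace / 2) := by
    have sw : ∀ F : Fin k → Fin k → ℝ, ∑ b, δ b * ∑ d, δ d * F d b
      = ∑ b, δ b * ∑ d, δ d * F b d := by
      intro F
      simp only [Finset.mul_sum]
      rw [Finset.sum_comm]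
      exact Finset.sum_congr rfl fun b _ => Finset.sum_congr rfl fun d _ => by ring
    have e : ∀ b d, tr (pderiv d (pderiv b (fun ψ => V a ψ * D ψ)) ψ₀)
        = (pderiv b (V a) ψ₀ * pderiv d D ψ₀).trace + ((pderiv d (V a) ψ₀ * pderiv b D ψ₀).trace
          + (V a ψ₀ * pderiv d (pderiv b D) ψ₀).trace) := fun b d => by
      rw [htr, Matrix.traceLinearMap_apply, hs.pderiv_pderiv_mul_center hΘ hψ₀, Matrix.trace_add,
        Matrix.trace_add]
    simp only [e, mul_add, Finset.sum_add_distrib]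
    have s1 := sw fun b d => (pderiv b (V a) ψ₀ * pderiv d D ψ₀).trace
    have s2 := sw fun b d => (V a ψ₀ * pderiv b (pderiv d D) ψ₀).trace
    have s3 : ∑ b, δ b * ∑ d, δ d * ((V a ψ₀ * pderiv b (pderiv d D) ψ₀).trace / 2)
        = (∑ b, δ b * ∑ d, δ d * (V a ψ₀ * pderiv b (pderiv d D) ψ₀).trace) / 2 := by
      simp only [Finset.mul_sum, Finset.sum_div]
      exact Finset.sum_congr rfl fun b _ => Finset.sum_congr rfl fun d _ => by ring
    rw [s1, s2, s3]
    ring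
  rw [hh] at t2
  have hz' : tr (V a ψ₀ * D ψ₀) = 0 := by rw [hs.D_zero, mul_zero, map_zero]
  have hsol : q (V a ψ) = tr (V a ψ * D ψ) := by
    have := congrFun h0 a
    rwa [score, Pi.zero_apply, sub_eq_zero] at this
  have hg : ∀ b, tr (pderiv b (fun ψ => V a ψ * D ψ) ψ₀) = (V a ψ₀ * pderiv b D ψ₀).trace :=
    fun b => by rw [hs.pderiv_mul_center hΘ hψ₀]; rfl
  simp only [hz', hg] at t2
  simp only [mul_sub, Finset.sum_sub_distrib] at t3 t5
  have h3 : ‖δ‖ ^ 3 ≤ C₁ ^ 3 * z ^ 3 := by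
    rw [← mul_pow]; exact pow_le_pow_left₀ (norm_nonneg _) hδ 3
  have h2 : ‖δ‖ * ‖δ‖ ≤ C₁ ^ 2 * z ^ 2 := by
    rw [← mul_pow, ← sq]; exact pow_le_pow_left₀ (norm_nonneg _) hδ 2
  have b1 : (k : ℝ) ^ 3 * (c * (2 * c * N)) * ‖δ‖ ^ 3
      ≤ k ^ 3 * (c * (2 * c * N)) * (C₁ ^ 3 * z ^ 3) :=
    mul_le_mul_of_nonneg_left h3 (by positivity)
  have b2 : (k : ℝ) ^ 3 * (N * (8 * (k + 1) * c ^ 2)) * ‖δ‖ ^ 3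
      ≤ k ^ 3 * (N * (8 * (k + 1) * c ^ 2)) * (C₁ ^ 3 * z ^ 3) :=
    mul_le_mul_of_nonneg_left h3 (by positivity)
  -- The O(1) error in the gradient contributes O(z), which is O(Nz³) by Nz² ≥ 1. A gradient error
  -- of order √N would be too large here.
  have b3 : (k : ℝ) * c * ‖δ‖ ≤ k * c * C₁ * (N * z ^ 3) := by
    have : (k : ℝ) * c * ‖δ‖ ≤ k * c * (C₁ * z) := mul_le_mul_of_nonneg_left hδ (by positivity)
    have h5 := mul_le_mul_of_nonneg_left hz (by positivity : 0 ≤ (k : ℝ) * c * C₁ * z)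
    nlinarith
  have b4 : (k : ℝ) ^ 2 * (N * z) * (‖δ‖ * ‖δ‖) ≤ k ^ 2 * (N * z) * (C₁ ^ 2 * z ^ 2) :=
    mul_le_mul_of_nonneg_left h2 (by positivity)
  have b4' : (k : ℝ) ^ 2 * (N * z) * (C₁ ^ 2 * z ^ 2) ≤ c * (k ^ 2 * (N * z) * (C₁ ^ 2 * z ^ 2)) :=
    le_mul_of_one_le_left (by positivity) hc
  have b5 : (k : ℝ) ^ 2 * (c * √N) * (‖δ‖ * ‖δ‖) ≤ k ^ 2 * (c * (N * z)) * (C₁ ^ 2 * z ^ 2) :=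
    mul_le_mul (by gcongr) h2 (by positivity) (by positivity)
  rw [mulVec_apply_eq_sum]
  rw [abs_le] at t1 t2 t3 t4 t5 ⊢
  constructor <;> nlinarith only [t1, t2, t3, t4, t5, b1, b2, b3, b4, b4', b5, hsol]

end Local

end Expansion

/-! ### Expansion of the estimator on the whole sample space. -/

section PathwiseExpansion

variable {k : ℕ}

lemma abs_quadratic_sub_le {x y : Fin k → ℝ} {F : Matrix (Fin k) (Fin k) ℝ} {B : ℝ}
    (hF : ∀ b d, |F b d| ≤ B) :
    |∑ b, x b * ∑ d, x d * F b d - ∑ b, y b * ∑ d, y d * F b d|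
      ≤ k ^ 2 * B * (‖x - y‖ * (‖x‖ + ‖y‖)) := by
  have e : ∑ b, x b * ∑ d, x d * F b d - ∑ b, y b * ∑ d, y d * F b d
      = ∑ b, (x - y) b * ∑ d, x d * F b d + ∑ b, y b * ∑ d, (x - y) d * F b d := by
    simp only [Finset.mul_sum, ← Finset.sum_add_distrib, ← Finset.sum_sub_distrib, Pi.sub_apply]
    exact Finset.sum_congr rfl fun b _ => Finset.sum_congr rfl fun d _ => by ring
  rw [e]
  have h1 := abs_sum_sum_mul_mul_le (x := x - y) (y := x) hF
  have h2 := abs_sum_sum_mul_mul_le (x := y) (y := x - y) hF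
  refine (abs_add_le _ _).trans ((add_le_add h1 h2).trans (le_of_eq ?_))
  ring

/-- Passage from the expansion in `δ` on the event `z ≤ κ` to the expansion in the first order
approximation `d` on the whole sample space. -/
lemma expansion_of_local {n z c κ C₁ C₃ : ℝ} (hn : 0 < n) (hz : 0 < z)
    (hc : 1 ≤ c) (hκ : 0 < κ) (hκ1 : κ ≤ 1) (hC₁ : 0 ≤ C₁) (hC₃ : 0 ≤ C₃)
    {A : Matrix (Fin k) (Fin k) ℝ} {H : Fin k → Fin k → Fin k → ℝ}
    {q : Fin k → Fin k → ℝ} {G δ d : Fin k → ℝ} (coer : ∀ h, n * ‖h‖ ≤ c * ‖A *ᵥ h‖)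
    (hA : ∀ a b, |A a b| ≤ 2 * c ^ 2 * n) (hH : ∀ a b e, |H a b e| ≤ 3 * c ^ 2 * n)
    (hG : ∀ a, |G a| ≤ n * z) (hq : ∀ a b, |q a b| ≤ n * z) (hd : A *ᵥ d = G)
    (hδ : ‖δ‖ ≤ C₁ * z)
    (hloc : z ≤ κ → ∀ a, |(A *ᵥ δ) a - G a - ∑ b, δ b * q a b
      + ∑ b, δ b * ∑ e, δ e * H a b e| ≤ C₃ * (n * z ^ 3)) :
    ∃ C₂ : ℝ, C₂ = (c * (k * C₁ + 3 * k ^ 2 * c ^ 2 * C₁ ^ 2 + C₃) + (C₁ + c) / κ) ∧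
    ‖δ - d‖ ≤ C₂ * z ^ 2 ∧
    ∀ a, |(A *ᵥ δ) a - G a - ∑ b, d b * q a b + ∑ b, d b * ∑ e, d e * H a b e|
      ≤ (C₃ + k * C₂ + 3 * k ^ 2 * c ^ 2 * C₂ * (C₁ + c)
          + (2 * k * c ^ 2 * C₁ + 1 + k * c + 3 * k ^ 2 * c ^ 4) / κ ^ 2) * (n * z ^ 3) := by
  have hc0 : 0 ≤ c := by linarith
  have hG' : ‖G‖ ≤ n * z := by
    rw [pi_norm_le_iff_of_nonneg (by positivity)]; exact hG
  have hdn : ‖d‖ ≤ c * z := by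
    have := coer d
    rw [hd] at this
    have h2 := mul_le_mul_of_nonneg_left hG' hc0
    refine le_of_mul_le_mul_left ((this.trans h2).trans (le_of_eq ?_)) hn
    ring
  set C₂ := c * (k * C₁ + 3 * k ^ 2 * c ^ 2 * C₁ ^ 2 + C₃) + (C₁ + c) / κ with hC₂
  have hC₂0 : 0 ≤ C₂ := by positivity
  have hC₂a : c * (k * C₁ + 3 * k ^ 2 * c ^ 2 * C₁ ^ 2 + C₃) ≤ C₂ := by
    rw [hC₂]; exact le_add_of_nonneg_right (by positivity)
  have hC₂b : (C₁ + c) / κ ≤ C₂ := by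
    rw [hC₂]; exact le_add_of_nonneg_left (by positivity)
  have lin : ∀ (x : Fin k → ℝ) a, |∑ b, x b * q a b| ≤ k * (n * z) * ‖x‖ := fun x a =>
    abs_sum_mul_le (hq a)
  have quad : ∀ (x : Fin k → ℝ) a, |∑ b, x b * ∑ e, x e * H a b e|
      ≤ k ^ 2 * (3 * c ^ 2 * n) * (‖x‖ * ‖x‖) := fun x a =>
    abs_sum_sum_mul_mul_le (F := H a) (hH a)
  have hδ2 : ‖δ‖ * ‖δ‖ ≤ C₁ ^ 2 * z ^ 2 := by
    rw [← sq, ← mul_pow]; exact pow_le_pow_left₀ (norm_nonneg _) hδ 2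
  have hd2 : ‖d‖ * ‖d‖ ≤ c ^ 2 * z ^ 2 := by
    rw [← sq, ← mul_pow]; exact pow_le_pow_left₀ (norm_nonneg _) hdn 2
  have hδd : ‖δ - d‖ ≤ C₂ * z ^ 2 := by
    rcases le_or_gt z κ with hzκ | hzκ
    · have h1 : ‖A *ᵥ (δ - d)‖ ≤ (k * C₁ + 3 * k ^ 2 * c ^ 2 * C₁ ^ 2 + C₃) * (n * z ^ 2) := by
        rw [pi_norm_le_iff_of_nonneg (by positivity)]
        intro a
        rw [Matrix.mulVec_sub, hd, Pi.sub_apply, Real.norm_eq_abs]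
        have l1 := lin δ a
        have l2 := quad δ a
        have l3 := hloc hzκ a
        have m1 : (k : ℝ) * (n * z) * ‖δ‖ ≤ k * (n * z) * (C₁ * z) :=
          mul_le_mul_of_nonneg_left hδ (by positivity)
        have m2 : (k : ℝ) ^ 2 * (3 * c ^ 2 * n) * (‖δ‖ * ‖δ‖)
            ≤ k ^ 2 * (3 * c ^ 2 * n) * (C₁ ^ 2 * z ^ 2) :=
          mul_le_mul_of_nonneg_left hδ2 (by positivity)
        have m3 : C₃ * (n * z ^ 3) ≤ C₃ * (n * z ^ 2) := by
          refine mul_le_mul_of_nonneg_left (mul_le_mul_of_nonneg_left ?_ hn.le) hC₃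
          exact pow_le_pow_of_le_one hz.le (hzκ.trans hκ1) (by norm_num)
        rw [abs_le] at l1 l2 l3 ⊢
        constructor <;> nlinarith only [l1, l2, l3, m1, m2, m3]
      have h2 := (coer (δ - d)).trans (mul_le_mul_of_nonneg_left h1 hc0)
      have h3 : n * ‖δ - d‖ ≤ n * (C₂ * z ^ 2) := by
        refine h2.trans ?_
        have := mul_le_mul_of_nonneg_right hC₂a (by positivity : 0 ≤ n * z ^ 2)
        nlinarith only [this]
      exact le_of_mul_le_mul_left h3 hn
    -- For z > κ nothing is expanded: δ and d are each O(z), and z ≤ z²/κ.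
    · have h1 : ‖δ - d‖ ≤ (C₁ + c) * z := (norm_sub_le _ _).trans (by linarith)
      have h2 : (C₁ + c) * z ≤ (C₁ + c) / κ * z ^ 2 := by
        rw [div_mul_eq_mul_div, le_div_iff₀ hκ]
        have := mul_le_mul_of_nonneg_left hzκ.le (by positivity : 0 ≤ (C₁ + c) * z)
        nlinarith only [this]
      exact h1.trans (h2.trans (mul_le_mul_of_nonneg_right hC₂b (by positivity)))
  refine ⟨C₂, rfl, hδd, fun a => ?_⟩
  have hX : 0 ≤ n * z ^ 3 := by positivity
  rcases le_or_gt z κ with hzκ | hzκ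
  · have l3 := hloc hzκ a
    have l1 := lin (δ - d) a
    have l2 := abs_quadratic_sub_le (x := δ) (y := d) (F := H a) (hH a)
    have m1 : (k : ℝ) * (n * z) * ‖δ - d‖ ≤ k * (n * z) * (C₂ * z ^ 2) :=
      mul_le_mul_of_nonneg_left hδd (by positivity)
    have m2 : (k : ℝ) ^ 2 * (3 * c ^ 2 * n) * (‖δ - d‖ * (‖δ‖ + ‖d‖))
        ≤ k ^ 2 * (3 * c ^ 2 * n) * (C₂ * z ^ 2 * (C₁ * z + c * z)) :=
      mul_le_mul_of_nonneg_left (mul_le_mul hδd (add_le_add hδ hdn) (by positivity)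
        (by positivity)) (by positivity)
    have m3 : 0 ≤ (2 * k * c ^ 2 * C₁ + 1 + k * c + 3 * k ^ 2 * c ^ 4) / κ ^ 2 * (n * z ^ 3) := by
      positivity
    simp only [Pi.sub_apply, sub_mul, Finset.sum_sub_distrib] at l1
    rw [abs_le] at l1 l2 l3 ⊢
    constructor <;> nlinarith only [l1, l2, l3, m1, m2, m3]
  -- For z > κ every term is bounded separately and absorbed into Nz³/κ², since powers of z/κ exceed
  -- 1.
  · have l0 : |(A *ᵥ δ) a| ≤ k * (2 * c ^ 2 * n) * ‖δ‖ := by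
      rw [mulVec_apply_eq_sum]; exact abs_sum_mul_le (hA a)
    have l1 := lin d a
    have l2 := quad d a
    have l3 := hG a
    have m0 : (k : ℝ) * (2 * c ^ 2 * n) * ‖δ‖ ≤ k * (2 * c ^ 2 * n) * (C₁ * z) :=
      mul_le_mul_of_nonneg_left hδ (by positivity)
    have m1 : (k : ℝ) * (n * z) * ‖d‖ ≤ k * (n * z) * (c * z) :=
      mul_le_mul_of_nonneg_left hdn (by positivity)
    have m2 : (k : ℝ) ^ 2 * (3 * c ^ 2 * n) * (‖d‖ * ‖d‖)
        ≤ k ^ 2 * (3 * c ^ 2 * n) * (c ^ 2 * z ^ 2) :=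
      mul_le_mul_of_nonneg_left hd2 (by positivity)
    have hr : 1 ≤ z / κ := by rw [le_div_iff₀ hκ]; linarith
    have p1 : n * z ≤ n * z ^ 3 / κ ^ 2 := by
      have : n * z ^ 3 / κ ^ 2 = n * z * (z / κ) ^ 2 := by field_simp
      rw [this]
      exact le_mul_of_one_le_right (by positivity) (one_le_pow₀ hr)
    have p2 : n * z ^ 2 ≤ n * z ^ 3 / κ ^ 2 := by
      have : n * z ^ 3 / κ ^ 2 = n * z ^ 2 * (z / κ / κ) := by field_simp
      rw [this]
      refine le_mul_of_one_le_right (by positivity) ?_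
      rw [le_div_iff₀ hκ]
      linarith
    have r0 := mul_le_mul_of_nonneg_left p1 (by positivity : 0 ≤ (k : ℝ) * (2 * c ^ 2) * C₁)
    have r1 := mul_le_mul_of_nonneg_left p2 (by positivity : 0 ≤ (k : ℝ) * c)
    have r2 := mul_le_mul_of_nonneg_left p2 (by positivity : 0 ≤ (k : ℝ) ^ 2 * 3 * c ^ 4)
    have m3 : 0 ≤ (C₃ + k * C₂ + 3 * k ^ 2 * c ^ 2 * C₂ * (C₁ + c)) * (n * z ^ 3) := by
      positivity
    have e : (2 * k * c ^ 2 * C₁ + 1 + k * c + 3 * k ^ 2 * c ^ 4) / κ ^ 2 * (n * z ^ 3)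
        = (2 * k * c ^ 2 * C₁ + 1 + k * c + 3 * k ^ 2 * c ^ 4) * (n * z ^ 3 / κ ^ 2) := by
      field_simp
    rw [add_mul, e]
    rw [abs_le] at l0 l1 l2 l3 ⊢
    constructor <;> nlinarith only [l0, l1, l2, l3, m0, m1, m2, m3, p1, r0, r1, r2]

/-- The centres are chosen in Θ, outside which the weights are not controlled. Bounded subsets of ℝᵏ
are totally bounded. -/
lemma exists_finite_net {Θ : Set (Fin k → ℝ)} (ψ₀ : Fin k → ℝ) (R : ℝ) {ε : ℝ} (hε : 0 < ε) :
    ∃ J : Finset (Fin k → ℝ), (J : Set (Fin k → ℝ)) ⊆ Θ ∧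
      ∀ ψ ∈ Θ, ‖ψ - ψ₀‖ ≤ R → ∃ θ ∈ (J : Set (Fin k → ℝ)), ‖ψ - θ‖ ≤ ε := by
  have htb : TotallyBounded (Θ ∩ Metric.closedBall ψ₀ R) :=
    (isCompact_closedBall ψ₀ R).totallyBounded.subset Set.inter_subset_right
  obtain ⟨J, hJ, hfin, hcov⟩ := Metric.finite_approx_of_totallyBounded htb ε hε
  refine ⟨hfin.toFinset, ?_, fun ψ hψ hR => ?_⟩
  · rw [hfin.coe_toFinset]
    exact hJ.trans Set.inter_subset_left
  · have := hcov ⟨hψ, mem_closedBall_iff_norm.2 hR⟩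
    simp only [Set.mem_iUnion, exists_prop] at this
    obtain ⟨θ, hθ, hm⟩ := this
    exact ⟨θ, by rwa [hfin.coe_toFinset], (mem_ball_iff_norm.1 hm).le⟩

variable {N : ℕ} {Θ : Set (Fin k → ℝ)} {ψ₀ : Fin k → ℝ} {c : ℝ} {V : Weights N k}
  {D : (Fin k → ℝ) → Matrix (Fin N) (Fin N) ℝ} {A : Matrix (Fin k) (Fin k) ℝ}
  {H : Fin k → Matrix (Fin k) (Fin k) ℝ}

lemma EstSystem.abs_A_le (hs : EstSystem Θ ψ₀ c V D A H) (hψ₀ : ψ₀ ∈ Θ) (hc : 1 ≤ c)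
    (hN : 1 ≤ (N : ℝ)) (a b : Fin k) : |A a b| ≤ 2 * c ^ 2 * N := by
  have h1 := hs.grad a b
  have h2 : |(V a ψ₀ * pderiv b D ψ₀).trace| ≤ N * (c * c) :=
    (abs_trace_mul_le_specNorm _ _).trans (mul_le_mul_of_nonneg_left
      (mul_le_mul ((hs.bound_V a).le hψ₀) ((hs.bound_D b).le hψ₀) (specNorm_nonneg _)
        (by linarith)) (by linarith))
  have h3 : c ≤ c ^ 2 * N := by nlinarith
  rw [abs_le] at h1 h2 ⊢
  constructor <;> linarith

lemma EstSystem.abs_H_le (hs : EstSystem Θ ψ₀ c V D A H) (hψ₀ : ψ₀ ∈ Θ) (hc : 1 ≤ c)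
    (hN : 1 ≤ (N : ℝ)) (a b d : Fin k) : |H a b d| ≤ 3 * c ^ 2 * N := by
  have h1 := hs.hess a b d
  have hc0 : 0 ≤ c := by linarith
  have h2 : |(pderiv b (V a) ψ₀ * pderiv d D ψ₀).trace| ≤ N * (c * c) :=
    (abs_trace_mul_le_specNorm _ _).trans (mul_le_mul_of_nonneg_left
      (mul_le_mul (((hs.bound_V a).bound_pderiv b).le hψ₀) ((hs.bound_D d).le hψ₀)
        (specNorm_nonneg _) hc0) (by linarith))
  have h3 : |(V a ψ₀ * pderiv b (pderiv d D) ψ₀).trace| ≤ N * (c * c) :=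
    (abs_trace_mul_le_specNorm _ _).trans (mul_le_mul_of_nonneg_left
      (mul_le_mul ((hs.bound_V a).le hψ₀) (((hs.bound_D d).bound_pderiv b).le hψ₀)
        (specNorm_nonneg _) hc0) (by linarith))
  have h4 : c * √N ≤ c ^ 2 * N := by
    have : √(N : ℝ) ≤ N := by
      rw [Real.sqrt_le_left (by linarith)]; nlinarith
    calc c * √N ≤ c * N := mul_le_mul_of_nonneg_left this hc0
      _ ≤ c ^ 2 * N := mul_le_mul_of_nonneg_right (by nlinarith) (by linarith)
  rw [abs_le] at h1 h2 h3 ⊢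
  constructor <;> nlinarith only [h1, h2, h3, h4]

/-- Stochastic expansion of the estimator, uniform over all sufficiently large systems: `z` bounds
the normalized quadratic forms, and the expansion holds pointwise on the sample space. -/
theorem exists_expansion (c R : ℝ) (hc : 1 ≤ c) (hR : 0 ≤ R) {Θ : Set (Fin k → ℝ)}
    (hΘ : IsOpen Θ) (hΘc : Convex ℝ Θ) {ψ₀ : Fin k → ℝ} (hψ₀ : ψ₀ ∈ Θ) :
    ∃ (J : Finset (Fin k → ℝ)) (C : ℝ) (N₀ : ℕ), (J : Set (Fin k → ℝ)) ⊆ Θ ∧ 0 ≤ C ∧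
      ∀ {N : ℕ}, N₀ ≤ N → ∀ {V : Weights N k} {D : (Fin k → ℝ) → Matrix (Fin N) (Fin N) ℝ}
        {A : Matrix (Fin k) (Fin k) ℝ} {H : Fin k → Matrix (Fin k) (Fin k) ℝ},
        EstSystem Θ ψ₀ c V D A H →
        ∀ (q : Matrix (Fin N) (Fin N) ℝ →ₗ[ℝ] ℝ) (z : ℝ) (ψ : Fin k → ℝ), 0 < z →
        1 ≤ N * z ^ 2 → (∀ C, |q C| ≤ specNorm C * (c * N + |q 1|)) → |q 1| ≤ N * z →
        (∀ a, |q (V a ψ₀)| ≤ N * z) → (∀ a b, |q (pderiv b (V a) ψ₀)| ≤ N * z) →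
        (∀ a b d, |q (pderiv b (pderiv d (V a)) ψ₀)| ≤ N * z) →
        (∀ θ ∈ J, ∀ a, |q (V a θ)| ≤ N * z) →
        ((∃ θ ∈ Θ, score V D q θ = 0) → ψ ∈ Θ ∧ score V D q ψ = 0) →
        ((¬ ∃ θ ∈ Θ, score V D q θ = 0) → ‖ψ‖ ≤ R) →
        ‖ψ - ψ₀‖ ≤ C * z ∧
        ‖ψ - ψ₀ - A⁻¹ *ᵥ (fun a => q (V a ψ₀))‖ ≤ C * z ^ 2 ∧
        ∀ a, |(A *ᵥ (ψ - ψ₀)) a - q (V a ψ₀)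
          - ∑ b, (A⁻¹ *ᵥ (fun a => q (V a ψ₀))) b * q (pderiv b (V a) ψ₀)
          + ∑ b, (A⁻¹ *ᵥ (fun a => q (V a ψ₀))) b
            * ∑ d, (A⁻¹ *ᵥ (fun a => q (V a ψ₀))) d * H a b d| ≤ C * (N * z ^ 3) := by
  have hc0 : 0 < c := by linarith
  obtain ⟨r, hr, hrΘ⟩ := Metric.isOpen_iff.1 hΘ ψ₀ hψ₀
  obtain ⟨E, hE⟩ : ∃ x : ℝ, x = 2 * k ^ 2 * c ^ 2 + 8 * k ^ 2 * (k + 1) * c ^ 2 := ⟨_, rfl⟩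
  have hE0 : 0 ≤ E := by rw [hE]; positivity
  -- Radius on which second derivatives perturb the linearization by at most N/(8c). The open ball
  -- of radius ρ₁ contains the closed ball of radius ρ = ρ₁/2 used for existence.
  obtain ⟨ρ₁, hρ₁⟩ : ∃ x : ℝ, x = min (min r 1) (1 / (8 * c * (E + 1))) := ⟨_, rfl⟩
  have hρ₁0 : 0 < ρ₁ := by rw [hρ₁]; positivity
  have hρ₁1 : ρ₁ ≤ 1 := hρ₁ ▸ (min_le_left _ _).trans (min_le_right _ _)
  have hρ₁Θ : Metric.ball ψ₀ ρ₁ ⊆ Θ :=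
    (Metric.ball_subset_ball (hρ₁ ▸ (min_le_left _ _).trans (min_le_left _ _))).trans hrΘ
  have hρ₁E : E * ρ₁ ≤ 1 / (8 * c) := by
    have h1 : ρ₁ ≤ 1 / (8 * c * (E + 1)) := hρ₁ ▸ min_le_right _ _
    calc E * ρ₁ ≤ (E + 1) * (1 / (8 * c * (E + 1))) :=
          mul_le_mul (by linarith) h1 hρ₁0.le (by linarith)
      _ = 1 / (8 * c) := by field_simp
  obtain ⟨ρ, hρ⟩ : ∃ x : ℝ, x = ρ₁ / 2 := ⟨_, rfl⟩
  have hρ0 : 0 < ρ := by rw [hρ]; positivity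
  have hρball : Metric.closedBall ψ₀ ρ ⊆ Metric.ball ψ₀ ρ₁ :=
    Metric.closedBall_subset_ball (by linarith)
  -- Mesh with 2kc³ε ≤ ρ/2.
  obtain ⟨ε, hε⟩ : ∃ x : ℝ, x = ρ / (4 * k * c ^ 3 + 1) := ⟨_, rfl⟩
  have hε0 : 0 < ε := by rw [hε]; positivity
  -- The second entry makes cκ ≤ ρ/2, for both existence and localization; the third makes kκ ≤
  -- 1/(8c), for the linearization.
  obtain ⟨κ, hκ⟩ : ∃ x : ℝ, x = min 1 (min (ρ / (2 * c)) (1 / (8 * c * (k + 1)))) := ⟨_, rfl⟩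
  have hκ0 : 0 < κ := by rw [hκ]; positivity
  have hκ1 : κ ≤ 1 := hκ ▸ min_le_left _ _
  have hκ2 : κ ≤ ρ / (2 * c) := hκ ▸ (min_le_right _ _).trans (min_le_left _ _)
  have hκ3 : κ ≤ 1 / (8 * c * (k + 1)) := hκ ▸ (min_le_right _ _).trans (min_le_right _ _)
  have hκk : k * κ ≤ 1 / (8 * c) := by
    calc (k : ℝ) * κ ≤ (k + 1) * (1 / (8 * c * (k + 1))) :=
          mul_le_mul (by linarith) hκ3 hκ0.le (by positivity)
      _ = 1 / (8 * c) := by field_simp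
  have hsmall : c * (κ + 2 * k * c ^ 2 * ε) ≤ ρ := by
    have h1 : c * κ ≤ ρ / 2 := by
      calc c * κ ≤ c * (ρ / (2 * c)) := mul_le_mul_of_nonneg_left hκ2 hc0.le
        _ = ρ / 2 := by field_simp
    have h2 : 2 * k * c ^ 3 * ε ≤ ρ / 2 := by
      rw [hε, mul_div_assoc', div_le_div_iff₀ (by positivity) (by norm_num)]
      nlinarith only [hρ0]
    linarith
  obtain ⟨J, hJΘ, hJ⟩ := exists_finite_net (Θ := Θ) ψ₀ (2 * c ^ 3) hε0
  -- The terms cover, in order: a solution when z ≤ κ; a solution when z > κ, where only ‖δ‖ ≤ c³ +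
  -- c²z is known (two terms); and the fallback value.
  obtain ⟨C₁, hC₁⟩ : ∃ x : ℝ, x = 2 * c + c ^ 3 / κ + c ^ 2 + (R + ‖ψ₀‖) / κ := ⟨_, rfl⟩
  have hC₁0 : 0 ≤ C₁ := by rw [hC₁]; positivity
  obtain ⟨C₃, hC₃⟩ : ∃ x : ℝ, x = k ^ 3 * (2 * c ^ 2 + 8 * (k + 1) * c ^ 2) * C₁ ^ 3 + k * c * C₁
          + 2 * k ^ 2 * c * C₁ ^ 2 := ⟨_, rfl⟩
  have hC₃0 : 0 ≤ C₃ := by rw [hC₃]; positivity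
  obtain ⟨C₂, hC₂⟩ : ∃ x : ℝ, x = c * (k * C₁ + 3 * k ^ 2 * c ^ 2 * C₁ ^ 2 + C₃)
    + (C₁ + c) / κ := ⟨_, rfl⟩
  have hC₂0 : 0 ≤ C₂ := by rw [hC₂]; positivity
  obtain ⟨C₄, hC₄⟩ : ∃ x : ℝ, x = C₃ + k * C₂ + 3 * k ^ 2 * c ^ 2 * C₂ * (C₁ + c)
          + (2 * k * c ^ 2 * C₁ + 1 + k * c + 3 * k ^ 2 * c ^ 4) / κ ^ 2 := ⟨_, rfl⟩
  have hC₄0 : 0 ≤ C₄ := by rw [hC₄]; positivity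
  -- The lower bound on N makes the gradient error kc at most N/(8c). The three errors of the
  -- linearization then add up to less than N/(2c).
  refine ⟨J, C₁ + C₂ + C₄, max 1 ⌈8 * c ^ 2 * k⌉₊, hJΘ, by positivity, ?_⟩
  intro N hN V D A H hs q z ψ hz0 hNz hq hq1 hqV hqV1 hqV2 hqJ hsol hfall
  have hN1 : 1 ≤ N := (le_max_left _ _).trans hN
  have hN1' : (1 : ℝ) ≤ N := by exact_mod_cast hN1
  have hNpos : (0 : ℝ) < N := by linarith
  have hNk : 8 * c ^ 2 * k ≤ N := (Nat.le_ceil _).trans (by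
    exact_mod_cast (le_max_right _ _).trans hN)
  have hkc : (k : ℝ) * c ≤ N * (1 / (8 * c)) := by
    rw [mul_one_div, le_div_iff₀ (by positivity)]
    nlinarith only [hNk]
  -- properties on the event `z ≤ κ`
  have good : z ≤ κ → ψ ∈ Metric.ball ψ₀ ρ₁ ∧ score V D q ψ = 0 ∧ ‖ψ - ψ₀‖ ≤ 2 * c * z := by
    intro hzκ
    have hq1κ : |q 1| ≤ N * κ := hq1.trans (mul_le_mul_of_nonneg_left hzκ hNpos.le)
    have lip : ∀ x ∈ Metric.closedBall ψ₀ ρ, ∀ y ∈ Metric.closedBall ψ₀ ρ,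
        ‖score V D q x - score V D q y + A *ᵥ (x - y)‖ ≤ N / (2 * c) * ‖x - y‖ := by
      intro x hx y hy
      rw [pi_norm_le_iff_of_nonneg (by positivity)]
      intro a
      refine (hs.abs_score_sub_le hΘ hΘc hψ₀ hc hρ₁0 hρ₁1 hρ₁Θ hq hκ1 hq1κ
        (fun a b => (hqV1 a b).trans (mul_le_mul_of_nonneg_left hzκ hNpos.le))
        (hρball hx) (hρball hy) a).trans (mul_le_mul_of_nonneg_right ?_ (norm_nonneg _))
      have h1 : N * (k * κ + E * ρ₁) ≤ N * (1 / (8 * c) + 1 / (8 * c)) :=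
        mul_le_mul_of_nonneg_left (add_le_add hκk hρ₁E) hNpos.le
      have h2 : (N : ℝ) / (2 * c) = N * (1 / (8 * c) + 1 / (8 * c)) + N * (1 / (8 * c))
          + N * (1 / (8 * c)) := by
        field_simp; norm_num
      have h3 : 0 ≤ N * (1 / (8 * c)) := by positivity
      rw [← hE]
      linarith
    have sc0 : ∀ a, score V D q ψ₀ a = q (V a ψ₀) := fun a => by
      rw [score, hs.D_zero, mul_zero, Matrix.trace_zero, sub_zero]
    have hsc0 : ‖score V D q ψ₀‖ ≤ N * z := by
      rw [pi_norm_le_iff_of_nonneg (by positivity)]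
      intro a
      rw [sc0]
      exact hqV a
    have hex : ∃ θ ∈ Θ, score V D q θ = 0 := by
      obtain ⟨θ, hθ, h0⟩ := exists_zero_of_approx_linear hNpos hc0 hρ0.le hs.coercive lip (by
        refine hsc0.trans ?_
        have := mul_le_mul_of_nonneg_left (hzκ.trans hκ2) hNpos.le
        refine this.trans (le_of_eq ?_)
        field_simp)
      exact ⟨θ, hρ₁Θ (hρball hθ), h0⟩
    obtain ⟨hψΘ, hψ0⟩ := hsol hex
    have hψρ : ψ ∈ Metric.closedBall ψ₀ ρ := by
      rw [mem_closedBall_iff_norm]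
      exact hs.norm_sub_le_of_net hΘ hΘc hc hN1 hq hκ0.le hκ1 hε0.le hq1κ hJΘ hJ
        (fun θ hθ a => (hqJ θ hθ a).trans (mul_le_mul_of_nonneg_left hzκ hNpos.le)) hsmall hψΘ hψ0
    refine ⟨hρball hψρ, hψ0, ?_⟩
    have h1 := lip ψ hψρ ψ₀ (Metric.mem_closedBall_self hρ0.le)
    rw [hψ0, zero_sub] at h1
    have h2 : ‖A *ᵥ (ψ - ψ₀)‖ ≤ N / (2 * c) * ‖ψ - ψ₀‖ + N * z := by
      have := norm_add_le (-score V D q ψ₀ + A *ᵥ (ψ - ψ₀)) (score V D q ψ₀)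
      rw [show -score V D q ψ₀ + A *ᵥ (ψ - ψ₀) + score V D q ψ₀ = A *ᵥ (ψ - ψ₀) by abel] at this
      linarith
    have h3 := (hs.coercive (ψ - ψ₀)).trans (mul_le_mul_of_nonneg_left h2 hc0.le)
    have h4 : c * (N / (2 * c) * ‖ψ - ψ₀‖ + N * z) = N * (‖ψ - ψ₀‖ / 2 + c * z) := by
      field_simp
    rw [h4] at h3
    have h5 := le_of_mul_le_mul_left h3 hNpos
    linarith
  have hδ : ‖ψ - ψ₀‖ ≤ C₁ * z := by
    have t1 : 0 ≤ 2 * c * z := by positivity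
    have t2 : 0 ≤ c ^ 3 / κ * z := by positivity
    have t3 : 0 ≤ c ^ 2 * z := by positivity
    have t4 : 0 ≤ (R + ‖ψ₀‖) / κ * z := by positivity
    have e : C₁ * z = 2 * c * z + c ^ 3 / κ * z + c ^ 2 * z + (R + ‖ψ₀‖) / κ * z := by
      rw [hC₁]; ring
    rw [e]
    rcases le_or_gt z κ with hzκ | hzκ
    · have := (good hzκ).2.2
      linarith
    -- For z > κ a constant is at most a multiple of z; this absorbs the bounded fallback values.
    · have big : ∀ x : ℝ, 0 ≤ x → x ≤ x / κ * z := fun x hx => by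
        rw [div_mul_eq_mul_div, le_div_iff₀ hκ0]
        exact mul_le_mul_of_nonneg_left hzκ.le hx
      by_cases hex : ∃ θ ∈ Θ, score V D q θ = 0
      · obtain ⟨hψΘ, hψ0⟩ := hsol hex
        have h1 := hs.norm_sub_le_of_score_eq_zero hc0.le hψΘ hψ0
          (B := c * (c * N + N * z)) (by positivity) fun a => (hq _).trans
            (mul_le_mul ((hs.bound_V a).le hψΘ) (by linarith) (by positivity) hc0.le)
        have h2 : ‖ψ - ψ₀‖ ≤ c ^ 3 + c ^ 2 * z := by
          refine le_of_mul_le_mul_left (h1.trans (le_of_eq ?_)) hNpos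
          ring
        have := big (c ^ 3) (by positivity)
        linarith
      · have h1 := (norm_sub_le ψ ψ₀).trans (add_le_add_left (hfall hex) _)
        have := big (R + ‖ψ₀‖) (by positivity)
        linarith
  have hd : A *ᵥ (A⁻¹ *ᵥ (fun a => q (V a ψ₀))) = fun a => q (V a ψ₀) := by
    rw [Matrix.mulVec_mulVec, Matrix.mul_nonsing_inv _ (isUnit_det_of_coercive hNpos hs.coercive),
      Matrix.one_mulVec]
  obtain ⟨C₂', hC₂', e2, e3⟩ := expansion_of_local (q := fun a b => q (pderiv b (V a) ψ₀))
    (H := fun a => H a)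
    hNpos hz0 hc hκ0 hκ1 hC₁0 hC₃0 hs.coercive (hs.abs_A_le hψ₀ hc hN1')
    (hs.abs_H_le hψ₀ hc hN1') hqV hqV1 hd hδ (fun hzκ a => by
      obtain ⟨g1, g2, -⟩ := good hzκ
      rw [hC₃]
      exact hs.abs_expansion_le hΘ hΘc hψ₀ hc hρ₁0 hρ₁1 hρ₁Θ hq hz0.le (hzκ.trans hκ1) hNz hq1
        hqV2 g1 g2 hC₁0 hδ a)
  rw [← hC₂] at hC₂'
  subst hC₂'
  refine ⟨hδ.trans (mul_le_mul_of_nonneg_right (by linarith) hz0.le),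
    e2.trans (mul_le_mul_of_nonneg_right (by linarith) (by positivity)), fun a =>
    (e3 a).trans (mul_le_mul_of_nonneg_right (by rw [← hC₄]; linarith) (by positivity))⟩

end PathwiseExpansion

/-! ### From the pointwise expansion to mean and covariance. -/

section MomentBounds

variable {Ω : Type*} [MeasurableSpace Ω] {μ : Measure Ω}

lemma L3Le.of_abs_le {X Z : Ω → ℝ} {a : ℝ} (hZ : L3Le μ Z a) (hX : AEStronglyMeasurable X μ)
    {C : ℝ} (hC : 0 ≤ C) (h : ∀ ω, |X ω| ≤ C * Z ω) : L3Le μ X (C * a) := by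
  have hp : ∀ ω, |X ω| ^ 3 ≤ C ^ 3 * |Z ω| ^ 3 := fun ω => by
    rw [← mul_pow]
    exact pow_le_pow_left₀ (abs_nonneg _)
      ((h ω).trans (mul_le_mul_of_nonneg_left (le_abs_self _) hC)) 3
  refine ⟨hX, (hZ.int.const_mul (C ^ 3)).mono' (hX.norm.pow 3) (Eventually.of_forall fun ω => ?_),
    mul_nonneg hC hZ.nonneg, ?_⟩
  · rw [Real.norm_of_nonneg (by positivity)]
    exact hp ω
  · refine (integral_mono_of_nonneg (Eventually.of_forall fun ω => by positivity)
      (hZ.int.const_mul (C ^ 3)) (Eventually.of_forall hp)).trans ?_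
    rw [integral_const_mul, mul_pow]
    exact mul_le_mul_of_nonneg_left hZ.le (by positivity)

lemma L3Le.sum {τ : Type*} {s : Finset τ} {X : τ → Ω → ℝ} {a : ℝ} (ha : 0 ≤ a)
    (h : ∀ i ∈ s, L3Le μ (X i) a) : L3Le μ (fun ω => ∑ i ∈ s, X i ω) (s.card * a) := by
  have hm : AEStronglyMeasurable (fun ω => ∑ i ∈ s, X i ω) μ :=
    Finset.aestronglyMeasurable_fun_sum s fun i hi => (h i hi).aesm
  have hp : ∀ ω, |∑ i ∈ s, X i ω| ^ 3 ≤ (s.card : ℝ) ^ 2 * ∑ i ∈ s, |X i ω| ^ 3 := by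
    intro ω
    refine (pow_le_pow_left₀ (abs_nonneg _) (Finset.abs_sum_le_sum_abs _ _) 3).trans ?_
    rcases s.eq_empty_or_nonempty with rfl | hs
    · simp
    have := pow_sum_div_card_le_sum_pow (s := s) (f := fun i => |X i ω|)
      (fun i _ => abs_nonneg _) 2
    have hc : (0 : ℝ) < (s.card : ℝ) ^ 2 := by
      have := hs.card_pos
      positivity
    rwa [div_le_iff₀ hc, mul_comm] at this
  have hi : Integrable (fun ω => (s.card : ℝ) ^ 2 * ∑ i ∈ s, |X i ω| ^ 3) μ :=
    (integrable_finsetSum s fun i hi => (h i hi).int).const_mul _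
  refine ⟨hm, hi.mono' (hm.norm.pow 3) (Eventually.of_forall fun ω => ?_), by positivity, ?_⟩
  · rw [Real.norm_of_nonneg (by positivity)]
    exact hp ω
  · refine (integral_mono_of_nonneg (Eventually.of_forall fun ω => by positivity) hi
      (Eventually.of_forall hp)).trans ?_
    rw [integral_const_mul, integral_finsetSum s fun i hi => (h i hi).int]
    have : ∑ i ∈ s, ∫ ω, |X i ω| ^ 3 ∂μ ≤ s.card * a ^ 3 := by
      rw [← nsmul_eq_mul]
      exact Finset.sum_le_card_nsmul _ _ _ fun i hi => (h i hi).le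
    refine (mul_le_mul_of_nonneg_left this (by positivity)).trans (le_of_eq ?_)
    ring

lemma abs_integral_sub_le {X Y Z : Ω → ℝ} {v : ℝ} (hX : Integrable X μ) (hY : Integrable Y μ)
    (hZ : Integrable Z μ) (h : ∀ ω, |X ω - Y ω| ≤ Z ω) (hv : ∫ ω, Z ω ∂μ ≤ v) :
    |∫ ω, X ω ∂μ - ∫ ω, Y ω ∂μ| ≤ v := by
  rw [← integral_sub hX hY]
  refine (abs_integral_le_integral_abs).trans (le_trans ?_ hv)
  exact integral_mono (hX.sub hY).abs hZ h

variable {k N : ℕ} {q : Ω → Matrix (Fin N) (Fin N) ℝ →ₗ[ℝ] ℝ} {κ : ℝ}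

/-- Write q(C)q(D) - q(C')q(D') = q(C - C')q(D) + q(C')q(D - D'). In the application e = O(1) and f
= O(√N). -/
lemma abs_integral_mul_sub_le [IsProbabilityMeasure μ]
    (hq : ∀ C, L3Le μ (fun ω => q ω C) (κ * frob C))
    {e f : ℝ} (he : 0 ≤ e) (hf : 0 ≤ f)
    {C D C' D' : Matrix (Fin N) (Fin N) ℝ} (hC : frob (C - C') ≤ e) (hD : frob (D - D') ≤ e)
    (hfD : frob D ≤ f) (hfC : frob C' ≤ f) :
    |∫ ω, q ω C * q ω D ∂μ - ∫ ω, q ω C' * q ω D' ∂μ| ≤ 2 * κ ^ 2 * (e * f) := by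
  have e1 := ((HasInt.intro ((hq C').integrable_mul (hq D')) rfl).add
    ((HasInt.intro ((hq (C - C')).integrable_mul (hq D)) rfl).add
      (HasInt.intro ((hq C').integrable_mul (hq (D - D'))) rfl))).congr
    (g := fun ω => q ω C * q ω D) (fun ω => by rw [map_sub, map_sub]; ring) rfl
  rw [e1.2, add_sub_cancel_left]
  have h1 := (hq (C - C')).abs_integral_mul_le (hq D)
  have h2 := (hq C').abs_integral_mul_le (hq (D - D'))
  have h3 : frob (C - C') * frob D ≤ e * f := mul_le_mul hC hfD (frob_nonneg _) he
  have h4 : frob C' * frob (D - D') ≤ f * e := mul_le_mul hfC hD (frob_nonneg _) hf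
  have h5 := mul_le_mul_of_nonneg_left h3 (sq_nonneg κ)
  have h6 := mul_le_mul_of_nonneg_left h4 (sq_nonneg κ)
  refine (abs_add_le _ _).trans ?_
  nlinarith only [h1, h2, h5, h6]

/-- Here and below n w² = 1, so w stands for n^{-1/2}, and errors are recorded as powers of w. -/
lemma abs_inv_le_of_coercive {A : Matrix (Fin k) (Fin k) ℝ} {c n w : ℝ} (hn : 0 < n)
    (hw : n * w ^ 2 = 1) (h : ∀ x, n * ‖x‖ ≤ c * ‖A *ᵥ x‖) (hc : 0 ≤ c) (a b : Fin k) :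
    |A⁻¹ a b| ≤ c * w ^ 2 := by
  have h1 := norm_inv_mulVec_le hn h (Pi.single b 1)
  rw [Matrix.mulVec_single_one] at h1
  have h2 : ‖(Pi.single b 1 : Fin k → ℝ)‖ ≤ 1 := by
    rw [pi_norm_le_iff_of_nonneg zero_le_one]
    intro i
    rcases eq_or_ne i b with rfl | hi
    · simp
    · simp [hi]
  have h3 := norm_le_pi_norm (A⁻¹.col b) a
  rw [Matrix.col_apply, Real.norm_eq_abs] at h3
  have h4 := mul_le_mul_of_nonneg_left h2 hc
  have h5 := mul_le_mul_of_nonneg_left h3 hn.le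
  have : |A⁻¹ a b| = w ^ 2 * (n * |A⁻¹ a b|) := by
    rw [← mul_assoc, mul_comm (w ^ 2), hw, one_mul]
  rw [this, mul_comm c]
  exact mul_le_mul_of_nonneg_left (by linarith) (sq_nonneg w)

variable {V₀ W₀ : Fin k → Matrix (Fin N) (Fin N) ℝ}
  {V₁ W₁ : Fin k → Fin k → Matrix (Fin N) (Fin N) ℝ}
  {A : Matrix (Fin k) (Fin k) ℝ} {H : Fin k → Matrix (Fin k) (Fin k) ℝ}
  {δ : Ω → Fin k → ℝ} {z : Ω → ℝ} {n w b c C e f : ℝ}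

/-- Leading term of the second moments. -/
noncomputable def leadCov (μ : Measure Ω) (q : Ω → Matrix (Fin N) (Fin N) ℝ →ₗ[ℝ] ℝ)
    (W₀ : Fin k → Matrix (Fin N) (Fin N) ℝ) (A : Matrix (Fin k) (Fin k) ℝ) (a d : Fin k) : ℝ :=
  ∑ i, ∑ j, A⁻¹ a i * A⁻¹ d j * ∫ ω, q ω (W₀ i) * q ω (W₀ j) ∂μ

/-- Leading term of `A E δ`. -/
noncomputable def leadScore (μ : Measure Ω) (q : Ω → Matrix (Fin N) (Fin N) ℝ →ₗ[ℝ] ℝ)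
    (W₀ : Fin k → Matrix (Fin N) (Fin N) ℝ) (W₁ : Fin k → Fin k → Matrix (Fin N) (Fin N) ℝ)
    (A : Matrix (Fin k) (Fin k) ℝ) (H : Fin k → Matrix (Fin k) (Fin k) ℝ) (a : Fin k) : ℝ :=
  ∑ b, ∑ i, A⁻¹ b i * (∫ ω, q ω (W₁ a b) * q ω (W₀ i) ∂μ)
    - ∑ b, ∑ d, H a b d * leadCov μ q W₀ A d b

lemma inv_mulVec_apply (x : Fin k → ℝ) (a : Fin k) : (A⁻¹ *ᵥ x) a = ∑ i, A⁻¹ a i * x i := rfl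

lemma l3Le_inv_mulVec (hq : ∀ C, L3Le μ (fun ω => q ω C) (κ * frob C)) (a : Fin k) :
    L3Le μ (fun ω => (A⁻¹ *ᵥ fun i => q ω (V₀ i)) a) (κ * frob (∑ i, A⁻¹ a i • V₀ i)) := by
  have : (fun ω => (A⁻¹ *ᵥ fun i => q ω (V₀ i)) a) = fun ω => q ω (∑ i, A⁻¹ a i • V₀ i) := by
    funext ω
    rw [map_sum, inv_mulVec_apply]
    simp only [map_smul, smul_eq_mul]
  rw [this]
  exact hq _

variable [IsProbabilityMeasure μ]

lemma abs_integral_first_mul_sub_leadCov_le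
    (hq : ∀ C, L3Le μ (fun ω => q ω C) (κ * frob C)) (hn : 0 < n) (hw0 : 0 < w)
    (hw : n * w ^ 2 = 1) (coer : ∀ x, n * ‖x‖ ≤ c * ‖A *ᵥ x‖) (hc : 0 ≤ c) (he : 0 ≤ e)
    (hf : 0 ≤ f) (hV₀ : ∀ i, frob (V₀ i) ≤ f * (n * w)) (hW₀ : ∀ i, frob (W₀ i) ≤ f * (n * w))
    (hVW₀ : ∀ i, frob (V₀ i - W₀ i) ≤ e) (a d : Fin k) :
    |∫ ω, (A⁻¹ *ᵥ fun i => q ω (V₀ i)) a * (A⁻¹ *ᵥ fun i => q ω (V₀ i)) d ∂μ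
      - leadCov μ q W₀ A a d| ≤ 2 * k ^ 2 * c ^ 2 * κ ^ 2 * e * f * w ^ 3 := by
  have h1 : HasInt μ (fun ω => (A⁻¹ *ᵥ fun i => q ω (V₀ i)) a * (A⁻¹ *ᵥ fun i => q ω (V₀ i)) d)
      (∑ i, ∑ j, A⁻¹ a i * A⁻¹ d j * ∫ ω, q ω (V₀ i) * q ω (V₀ j) ∂μ) := by
    refine (HasInt.sum (s := Finset.univ) fun i _ => HasInt.sum (s := Finset.univ) fun j _ =>
      (HasInt.intro ((hq (V₀ i)).integrable_mul (hq (V₀ j))) rfl).const_mul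
        (A⁻¹ a i * A⁻¹ d j)).congr (fun ω => ?_) rfl
    rw [inv_mulVec_apply, inv_mulVec_apply, Finset.sum_mul_sum]
    exact Finset.sum_congr rfl fun i _ => Finset.sum_congr rfl fun j _ => by ring
  rw [h1.2, leadCov, ← Finset.sum_sub_distrib]
  simp only [← Finset.sum_sub_distrib, ← mul_sub]
  have hb : ∀ i j, |A⁻¹ a i * A⁻¹ d j * (∫ ω, q ω (V₀ i) * q ω (V₀ j) ∂μ
      - ∫ ω, q ω (W₀ i) * q ω (W₀ j) ∂μ)|
      ≤ (c * w ^ 2) * (c * w ^ 2) * (2 * κ ^ 2 * (e * (f * (n * w)))) := by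
    intro i j
    rw [abs_mul, abs_mul]
    refine mul_le_mul (mul_le_mul (abs_inv_le_of_coercive hn hw coer hc a i)
      (abs_inv_le_of_coercive hn hw coer hc d j) (abs_nonneg _) (by positivity))
      (abs_integral_mul_sub_le hq he (by positivity) (hVW₀ i) (hVW₀ j) (hV₀ j) (hW₀ i))
      (abs_nonneg _) (by positivity)
  refine (Finset.abs_sum_le_sum_abs _ _).trans ((Finset.sum_le_sum fun i _ =>
    (Finset.abs_sum_le_sum_abs _ _).trans (Finset.sum_le_sum fun j _ => hb i j)).trans
      (le_of_eq ?_))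
  simp only [Finset.sum_const, Finset.card_univ, Fintype.card_fin, nsmul_eq_mul]
  linear_combination (2 * k ^ 2 * c ^ 2 * κ ^ 2 * e * f * w ^ 3) * hw

lemma L3Le.integral_sq_le {X : Ω → ℝ} {a : ℝ} (hX : L3Le μ X a) : ∫ ω, X ω ^ 2 ∂μ ≤ a ^ 2 := by
  have := (le_abs_self _).trans (hX.abs_integral_mul_le hX)
  simpa only [sq] using this

lemma L3Le.integrable_sq {X : Ω → ℝ} {a : ℝ} (hX : L3Le μ X a) :
    Integrable (fun ω => X ω ^ 2) μ := by
  simpa only [sq] using hX.integrable_mul hX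

/-- The expansion holding pointwise gives the mean of `δ`. -/
lemma abs_mean_le (hq : ∀ C, L3Le μ (fun ω => q ω C) (κ * frob C))
    (hq0 : ∀ C, ∫ ω, q ω C ∂μ = 0) (hz : L3Le μ z (b * w)) (hC : 0 ≤ C)
    (hδm : ∀ a, AEStronglyMeasurable (fun ω => δ ω a) μ) (h1 : ∀ ω, ‖δ ω‖ ≤ C * z ω)
    (h2 : ∀ ω, ‖δ ω - A⁻¹ *ᵥ (fun i => q ω (V₀ i))‖ ≤ C * z ω ^ 2) (a : Fin k) :
    |∫ ω, δ ω a ∂μ| ≤ C * b ^ 2 * w ^ 2 := by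
  have lδ := hz.of_abs_le (hδm a) hC fun ω => (norm_le_pi_norm (δ ω) a).trans (h1 ω)
  have ld := l3Le_inv_mulVec (V₀ := V₀) (A := A) hq a
  have hd0 : ∫ ω, (A⁻¹ *ᵥ fun i => q ω (V₀ i)) a ∂μ = 0 := by
    refine ((HasInt.sum (s := Finset.univ) fun i _ => (HasInt.intro (hq (V₀ i)).integrable
      (hq0 (V₀ i))).const_mul (A⁻¹ a i)).congr (fun ω => rfl) (w := 0) ?_).2
    simp
  have := abs_integral_sub_le lδ.integrable ld.integrable (hz.integrable_sq.const_mul C)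
    (v := C * b ^ 2 * w ^ 2) (fun ω => (norm_le_pi_norm _ a).trans (h2 ω)) (by
      rw [integral_const_mul]
      refine (mul_le_mul_of_nonneg_left hz.integral_sq_le hC).trans (le_of_eq ?_)
      ring)
  rwa [hd0, sub_zero] at this

/-- With d the first order approximation, δ_aδ_b - d_ad_b = δ_a(δ_b - d_b) + (δ_a - d_a)d_b = O(z³);
the remaining error is that of replacing V by W. -/
lemma abs_integral_mul_sub_leadCov_le
    (hq : ∀ C, L3Le μ (fun ω => q ω C) (κ * frob C)) (hn : 0 < n) (hw0 : 0 < w)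
    (hw : n * w ^ 2 = 1) (coer : ∀ x, n * ‖x‖ ≤ c * ‖A *ᵥ x‖) (hc : 0 ≤ c) (he : 0 ≤ e)
    (hf : 0 ≤ f) (hV₀ : ∀ i, frob (V₀ i) ≤ f * (n * w)) (hW₀ : ∀ i, frob (W₀ i) ≤ f * (n * w))
    (hVW₀ : ∀ i, frob (V₀ i - W₀ i) ≤ e) (hz : L3Le μ z (b * w)) (hz0 : ∀ ω, 0 ≤ z ω) (hC : 0 ≤ C)
    (hqz : ∀ ω i, |q ω (V₀ i)| ≤ n * z ω)
    (hδm : ∀ a, AEStronglyMeasurable (fun ω => δ ω a) μ) (h1 : ∀ ω, ‖δ ω‖ ≤ C * z ω)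
    (h2 : ∀ ω, ‖δ ω - A⁻¹ *ᵥ (fun i => q ω (V₀ i))‖ ≤ C * z ω ^ 2) (a d : Fin k) :
    |∫ ω, δ ω a * δ ω d ∂μ - leadCov μ q W₀ A a d|
      ≤ (C * (C + c) * b ^ 3 + 2 * k ^ 2 * c ^ 2 * κ ^ 2 * e * f) * w ^ 3 := by
  have lδ := fun a => hz.of_abs_le (hδm a) hC fun ω => (norm_le_pi_norm (δ ω) a).trans (h1 ω)
  have ld := l3Le_inv_mulVec (V₀ := V₀) (A := A) hq
  have hd : ∀ ω, ‖A⁻¹ *ᵥ (fun i => q ω (V₀ i))‖ ≤ c * z ω := by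
    intro ω
    have t1 := norm_inv_mulVec_le hn coer (fun i => q ω (V₀ i))
    have t2 : ‖fun i => q ω (V₀ i)‖ ≤ n * z ω := by
      rw [pi_norm_le_iff_of_nonneg (mul_nonneg hn.le (hz0 ω))]
      exact hqz ω
    have t3 := mul_le_mul_of_nonneg_left t2 hc
    refine le_of_mul_le_mul_left ((t1.trans t3).trans (le_of_eq ?_)) hn
    ring
  have e1 := abs_integral_first_mul_sub_leadCov_le hq hn hw0 hw coer hc he hf hV₀ hW₀ hVW₀ a d
  have hz3 : ∀ ω, |z ω| ^ 3 = z ω ^ 3 := fun ω => by rw [abs_of_nonneg (hz0 ω)]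
  have e2 := abs_integral_sub_le ((lδ a).integrable_mul (lδ d)) ((ld a).integrable_mul (ld d))
    (hz.int.const_mul (C * (C + c))) (v := C * (C + c) * b ^ 3 * w ^ 3) (fun ω => by
      have t1 := (norm_le_pi_norm _ a).trans (h1 ω)
      have t2 := (norm_le_pi_norm _ a).trans (h2 ω)
      have t3 := (norm_le_pi_norm _ d).trans (h2 ω)
      have t4 := (norm_le_pi_norm _ d).trans (hd ω)
      rw [Real.norm_eq_abs] at t1 t2 t3 t4
      rw [Pi.sub_apply] at t2 t3
      have e3 : δ ω a * δ ω d - (A⁻¹ *ᵥ fun i => q ω (V₀ i)) a * (A⁻¹ *ᵥ fun i => q ω (V₀ i)) d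
        = δ ω a * (δ ω d - (A⁻¹ *ᵥ fun i => q ω (V₀ i)) d)
          + (δ ω a - (A⁻¹ *ᵥ fun i => q ω (V₀ i)) a) * (A⁻¹ *ᵥ fun i => q ω (V₀ i)) d := by ring
      rw [e3, hz3]
      refine (abs_add_le _ _).trans ?_
      rw [abs_mul, abs_mul]
      have u1 := mul_le_mul t1 t3 (abs_nonneg _) (mul_nonneg hC (hz0 ω))
      have u2 := mul_le_mul t2 t4 (abs_nonneg _) (mul_nonneg hC (sq_nonneg _))
      refine (add_le_add u1 u2).trans (le_of_eq ?_)
      ring) (by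
      rw [integral_const_mul]
      refine (mul_le_mul_of_nonneg_left hz.le (by positivity)).trans (le_of_eq ?_)
      ring)
  have := abs_sub_le (∫ ω, δ ω a * δ ω d ∂μ) (∫ ω, (A⁻¹ *ᵥ fun i => q ω (V₀ i)) a *
    (A⁻¹ *ᵥ fun i => q ω (V₀ i)) d ∂μ) (leadCov μ q W₀ A a d)
  refine this.trans ((add_le_add e2 e1).trans (le_of_eq ?_))
  ring

lemma abs_covariance_sub_leadCov_le
    (hq : ∀ C, L3Le μ (fun ω => q ω C) (κ * frob C)) (hq0 : ∀ C, ∫ ω, q ω C ∂μ = 0)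
    (hn : 0 < n) (hw0 : 0 < w) (hw1 : w ≤ 1)
    (hw : n * w ^ 2 = 1) (coer : ∀ x, n * ‖x‖ ≤ c * ‖A *ᵥ x‖) (hc : 0 ≤ c) (he : 0 ≤ e)
    (hf : 0 ≤ f) (hV₀ : ∀ i, frob (V₀ i) ≤ f * (n * w)) (hW₀ : ∀ i, frob (W₀ i) ≤ f * (n * w))
    (hVW₀ : ∀ i, frob (V₀ i - W₀ i) ≤ e) (hz : L3Le μ z (b * w)) (hz0 : ∀ ω, 0 ≤ z ω) (hC : 0 ≤ C)
    (hqz : ∀ ω i, |q ω (V₀ i)| ≤ n * z ω)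
    (hδm : ∀ a, AEStronglyMeasurable (fun ω => δ ω a) μ) (h1 : ∀ ω, ‖δ ω‖ ≤ C * z ω)
    (h2 : ∀ ω, ‖δ ω - A⁻¹ *ᵥ (fun i => q ω (V₀ i))‖ ≤ C * z ω ^ 2) (a d : Fin k) :
    |covariance (fun ω => δ ω a) (fun ω => δ ω d) μ - leadCov μ q W₀ A a d|
      ≤ (C * (C + c) * b ^ 3 + 2 * k ^ 2 * c ^ 2 * κ ^ 2 * e * f + C ^ 2 * b ^ 4) * w ^ 3 := by
  have lδ := fun a => hz.of_abs_le (hδm a) hC fun ω => (norm_le_pi_norm (δ ω) a).trans (h1 ω)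
  have L2 := fun a => (lδ a).memLp.mono_exponent (p := 2) (by norm_num)
  have e1 := abs_integral_mul_sub_leadCov_le hq hn hw0 hw coer hc he hf hV₀ hW₀ hVW₀ hz hz0 hC
    hqz hδm h1 h2 a d
  have m1 := abs_mean_le hq hq0 hz hC hδm h1 h2 a
  have m2 := abs_mean_le hq hq0 hz hC hδm h1 h2 d
  rw [covariance_eq_sub (L2 a) (L2 d)]
  -- The first order term is centred, so each mean is O(w²) and their product is O(w⁴).
  have e2 : |(∫ ω, δ ω a ∂μ) * ∫ ω, δ ω d ∂μ| ≤ C ^ 2 * b ^ 4 * w ^ 3 := by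
    rw [abs_mul]
    refine (mul_le_mul m1 m2 (abs_nonneg _) (by positivity)).trans ?_
    have : w ^ 4 ≤ w ^ 3 := pow_le_pow_of_le_one hw0.le hw1 (by norm_num)
    have := mul_le_mul_of_nonneg_left this (by positivity : 0 ≤ C ^ 2 * b ^ 4)
    nlinarith only [this]
  simp only [Pi.mul_apply]
  rw [sub_right_comm]
  refine (abs_sub _ _).trans ((add_le_add e1 e2).trans (le_of_eq ?_))
  ring

/-- Take expectations in the second order expansion, where q(V_a) has mean zero. The errors in A E δ
are O(w), and A⁻¹ gains w². -/
lemma norm_mean_sub_le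
    (hq : ∀ C, L3Le μ (fun ω => q ω C) (κ * frob C)) (hq0 : ∀ C, ∫ ω, q ω C ∂μ = 0)
    (hn : 0 < n) (hw0 : 0 < w)
    (hw : n * w ^ 2 = 1) (coer : ∀ x, n * ‖x‖ ≤ c * ‖A *ᵥ x‖) (hc : 0 ≤ c) (he : 0 ≤ e)
    (hf : 0 ≤ f) (hb : 0 ≤ b)
    (hV₀ : ∀ i, frob (V₀ i) ≤ f * (n * w)) (hW₀ : ∀ i, frob (W₀ i) ≤ f * (n * w))
    (hVW₀ : ∀ i, frob (V₀ i - W₀ i) ≤ e)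
    (hW₁ : ∀ i j, frob (W₁ i j) ≤ f * (n * w))
    (hVW₁ : ∀ i j, frob (V₁ i j - W₁ i j) ≤ e) (hH : ∀ i j l, |H i j l| ≤ 3 * c ^ 2 * n)
    (hz : L3Le μ z (b * w)) (hz0 : ∀ ω, 0 ≤ z ω) (hC : 0 ≤ C)
    (hδm : ∀ a, AEStronglyMeasurable (fun ω => δ ω a) μ) (h1 : ∀ ω, ‖δ ω‖ ≤ C * z ω)
    (h3 : ∀ ω a, |(A *ᵥ δ ω) a - q ω (V₀ a)
          - ∑ b, (A⁻¹ *ᵥ (fun a => q ω (V₀ a))) b * q ω (V₁ a b)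
          + ∑ b, (A⁻¹ *ᵥ (fun a => q ω (V₀ a))) b
            * ∑ d, (A⁻¹ *ᵥ (fun a => q ω (V₀ a))) d * H a b d| ≤ C * (n * z ω ^ 3)) :
    ‖(fun a => ∫ ω, δ ω a ∂μ) - A⁻¹ *ᵥ leadScore μ q W₀ W₁ A H‖
      ≤ c * (C * b ^ 3 + 2 * k ^ 2 * c * κ ^ 2 * e * f + 6 * k ^ 4 * c ^ 4 * κ ^ 2 * e * f)
        * w ^ 3 := by
  have lδ := fun a => hz.of_abs_le (hδm a) hC fun ω => (norm_le_pi_norm (δ ω) a).trans (h1 ω)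
  have ld := l3Le_inv_mulVec (V₀ := V₀) (A := A) hq
  have hu := isUnit_det_of_coercive hn coer
  set dd : Ω → Fin k → ℝ := fun ω => A⁻¹ *ᵥ (fun a => q ω (V₀ a)) with hdd
  set T := C * b ^ 3 + 2 * k ^ 2 * c * κ ^ 2 * e * f + 6 * k ^ 4 * c ^ 4 * κ ^ 2 * e * f with hT
  have hT0 : 0 ≤ T := by positivity
  have key : ∀ a, |(A *ᵥ (fun a => ∫ ω, δ ω a ∂μ)) a - leadScore μ q W₀ W₁ A H a|
      ≤ T * w := by
    intro a
    have i1 : HasInt μ (fun ω => (A *ᵥ δ ω) a) ((A *ᵥ (fun a => ∫ ω, δ ω a ∂μ)) a) := by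
      rw [mulVec_apply_eq_sum]
      refine (HasInt.sum (s := Finset.univ) fun i _ =>
        (HasInt.intro (lδ i).integrable rfl).const_mul (A a i)).congr
        (fun ω => rfl) (Finset.sum_congr rfl fun i _ => mul_comm _ _)
    have i2 : HasInt μ (fun ω => ∑ b, dd ω b * q ω (V₁ a b))
        (∑ b, ∑ i, A⁻¹ b i * (∫ ω, q ω (V₁ a b) * q ω (V₀ i) ∂μ)) := by
      refine (HasInt.sum (s := Finset.univ) fun b _ => HasInt.sum (s := Finset.univ) fun i _ =>
        (HasInt.intro ((hq (V₁ a b)).integrable_mul (hq (V₀ i))) rfl).const_mul (A⁻¹ b i)).congr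
        (fun ω => Finset.sum_congr rfl fun b _ => ?_) rfl
      simp only [hdd]
      rw [inv_mulVec_apply, Finset.sum_mul]
      exact Finset.sum_congr rfl fun i _ => by ring
    have i3 : HasInt μ (fun ω => ∑ b, dd ω b * ∑ d, dd ω d * H a b d)
        (∑ b, ∑ d, H a b d * (∫ ω, dd ω d * dd ω b ∂μ)) := by
      refine (HasInt.sum (s := Finset.univ) fun b _ => HasInt.sum (s := Finset.univ) fun d _ =>
        (HasInt.intro ((ld d).integrable_mul (ld b)) rfl).const_mul (H a b d)).congr
        (fun ω => Finset.sum_congr rfl fun b _ => ?_) rfl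
      rw [Finset.mul_sum]
      exact Finset.sum_congr rfl fun d _ => by ring
    have i0 : HasInt μ (fun ω => q ω (V₀ a)) 0 := HasInt.intro (hq _).integrable (hq0 _)
    have iR := (i0.add i2).add (i3.const_mul (-1))
    have hz3 : ∀ ω, |z ω| ^ 3 = z ω ^ 3 := fun ω => by rw [abs_of_nonneg (hz0 ω)]
    have e1 := abs_integral_sub_le i1.1 iR.1 (hz.int.const_mul (C * n)) (v := C * b ^ 3 * w)
      (fun ω => by
        rw [hz3]
        refine le_trans (le_of_eq ?_) ((h3 ω a).trans (le_of_eq (by ring)))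
        congr 1
        simp only [hdd]
        ring) (by
        rw [integral_const_mul]
        refine (mul_le_mul_of_nonneg_left hz.le (by positivity)).trans (le_of_eq ?_)
        linear_combination (C * b ^ 3 * w) * hw)
    rw [i1.2, iR.2] at e1
    have e2 : |∑ b, ∑ i, A⁻¹ b i * (∫ ω, q ω (V₁ a b) * q ω (V₀ i) ∂μ)
        - ∑ b, ∑ i, A⁻¹ b i * (∫ ω, q ω (W₁ a b) * q ω (W₀ i) ∂μ)|
        ≤ 2 * k ^ 2 * c * κ ^ 2 * e * f * w := by
      simp only [← Finset.sum_sub_distrib, ← mul_sub]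
      have hb' : ∀ b i, |A⁻¹ b i * (∫ ω, q ω (V₁ a b) * q ω (V₀ i) ∂μ
          - ∫ ω, q ω (W₁ a b) * q ω (W₀ i) ∂μ)|
          ≤ (c * w ^ 2) * (2 * κ ^ 2 * (e * (f * (n * w)))) := by
        intro b i
        rw [abs_mul]
        exact mul_le_mul (abs_inv_le_of_coercive hn hw coer hc b i)
          (abs_integral_mul_sub_le hq he (by positivity) (hVW₁ a b) (hVW₀ i) (hV₀ i) (hW₁ a b))
          (abs_nonneg _) (by positivity)
      refine (Finset.abs_sum_le_sum_abs _ _).trans ((Finset.sum_le_sum fun i _ =>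
        (Finset.abs_sum_le_sum_abs _ _).trans (Finset.sum_le_sum fun j _ => hb' i j)).trans
          (le_of_eq ?_))
      simp only [Finset.sum_const, Finset.card_univ, Fintype.card_fin, nsmul_eq_mul]
      linear_combination (2 * k ^ 2 * c * κ ^ 2 * e * f * w) * hw
    have e3 : |∑ b, ∑ d, H a b d * (∫ ω, dd ω d * dd ω b ∂μ)
        - ∑ b, ∑ d, H a b d * leadCov μ q W₀ A d b|
        ≤ 6 * k ^ 4 * c ^ 4 * κ ^ 2 * e * f * w := by
      simp only [← Finset.sum_sub_distrib, ← mul_sub]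
      have hb' : ∀ b d, |H a b d * (∫ ω, dd ω d * dd ω b ∂μ - leadCov μ q W₀ A d b)|
          ≤ (3 * c ^ 2 * n) * (2 * k ^ 2 * c ^ 2 * κ ^ 2 * e * f * w ^ 3) := by
        intro b d
        rw [abs_mul]
        exact mul_le_mul (hH a b d)
          (abs_integral_first_mul_sub_leadCov_le hq hn hw0 hw coer hc he hf hV₀ hW₀ hVW₀ d b)
          (abs_nonneg _) (by positivity)
      refine (Finset.abs_sum_le_sum_abs _ _).trans ((Finset.sum_le_sum fun i _ =>
        (Finset.abs_sum_le_sum_abs _ _).trans (Finset.sum_le_sum fun j _ => hb' i j)).trans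
          (le_of_eq ?_))
      simp only [Finset.sum_const, Finset.card_univ, Fintype.card_fin, nsmul_eq_mul]
      linear_combination (6 * k ^ 4 * c ^ 4 * κ ^ 2 * e * f * w) * hw
    rw [leadScore, hT]
    rw [abs_le] at e1 e2 e3 ⊢
    constructor <;> linarith
  have e4 := norm_inv_mulVec_le hn coer
    (A *ᵥ (fun a => ∫ ω, δ ω a ∂μ) - leadScore μ q W₀ W₁ A H)
  rw [Matrix.mulVec_sub, Matrix.mulVec_mulVec, Matrix.nonsing_inv_mul _ hu,
    Matrix.one_mulVec] at e4
  have e5 : ‖A *ᵥ (fun a => ∫ ω, δ ω a ∂μ) - leadScore μ q W₀ W₁ A H‖ ≤ T * w := by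
    rw [pi_norm_le_iff_of_nonneg (by positivity)]
    exact key
  have e6 := e4.trans (mul_le_mul_of_nonneg_left e5 hc)
  refine le_of_mul_le_mul_left (e6.trans (le_of_eq ?_)) hn
  linear_combination (-(c * T * w)) * hw

end MomentBounds

/-! ### Regularity of the projected weights and of the estimating equations. -/

section SingleModel

variable {N m p k : ℕ}

/-- The bounds of the sequence of models, for a single member, with a common constant. -/
structure ModelBound (Θ : Set (Fin k → ℝ)) (ψ₀ : Fin k → ℝ) (c : ℝ) (M : MixedModel N m p k)
    (W : Weights N k) (L : (Fin k → ℝ) → Matrix (Fin p) (Fin N) ℝ) : Prop where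
  symm_W : ∀ a, (W a ψ₀).IsSymm
  smooth_Sig : EntrySmooth 3 Θ M.Sig
  smooth_W : ∀ a, EntrySmooth 3 Θ (W a)
  smooth_L : EntrySmooth 3 Θ L
  bound_Sig₀ : specNorm (M.Sig ψ₀) ≤ c
  bound_dSig : ∀ b, DerivBound specNorm Θ 2 (pderiv b M.Sig) c
  bound_W : ∀ a, DerivBound specNorm Θ 3 (W a) c
  bound_XL : DerivBound frob Θ 3 (fun ψ => M.X * L ψ) c
  unbiased : ∀ ψ ∈ Θ, L ψ * M.X = 1
  ident : ∀ ψ ∈ Θ, N * ‖ψ - ψ₀‖ ≤ c * ‖fun a => (W a ψ * (M.Sig ψ - M.Sig ψ₀)).trace‖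

/-- The weights `Qᵀ W_a Q` of the estimating equations. -/
def projWeights (M : MixedModel N m p k) (W : Weights N k)
    (L : (Fin k → ℝ) → Matrix (Fin p) (Fin N) ℝ) : Weights N k :=
  fun a ψ => (M.Q L ψ)ᵀ * W a ψ * M.Q L ψ

/-- The difference `Qᵀ W_a Q - W_a`. -/
def projError (M : MixedModel N m p k) (W : Weights N k)
    (L : (Fin k → ℝ) → Matrix (Fin p) (Fin N) ℝ) : Weights N k :=
  fun a ψ => -(W a ψ * (M.X * L ψ) + (M.X * L ψ)ᵀ * (W a ψ * M.Q L ψ))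

variable {Θ : Set (Fin k → ℝ)} {ψ₀ : Fin k → ℝ} {c : ℝ} {M : MixedModel N m p k}
  {W : Weights N k} {L : (Fin k → ℝ) → Matrix (Fin p) (Fin N) ℝ}

lemma projWeights_eq_add (M : MixedModel N m p k) (W : Weights N k)
    (L : (Fin k → ℝ) → Matrix (Fin p) (Fin N) ℝ) (a : Fin k) :
    projWeights M W L a = fun ψ => W a ψ + projError M W L a ψ := by
  funext ψ
  rw [projWeights, projError, MixedModel.Q, Matrix.transpose_sub, Matrix.transpose_one]
  noncomm_ring

/-- The estimating equations at `θ`, in terms of the centred errors. -/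
lemma solves_iff_score_eq_zero {θ : Fin k → ℝ} (hθ : L θ * M.X = 1) (β : Fin p → ℝ)
    (ε : Fin N → ℝ) (v : Fin m → ℝ) :
    M.Solves W L (M.obs β ε v) θ ↔ score (projWeights M W L) (fun ψ => M.Sig ψ - M.Sig ψ₀)
      (centeredQuad (M.Sig ψ₀) (M.Z *ᵥ v + ε)) θ = 0 := by
  -- Unbiasedness removes Xβ from the residuals, so y may be replaced by Zv + ε.
  have hX : M.Q L θ * M.X = 0 := by
    rw [MixedModel.Q, Matrix.sub_mul, Matrix.mul_assoc, hθ, Matrix.mul_one, Matrix.one_mul,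
      sub_self]
  have hy : M.Q L θ *ᵥ M.obs β ε v = M.Q L θ *ᵥ (M.Z *ᵥ v + ε) := by
    rw [MixedModel.obs, add_assoc, Matrix.mulVec_add, Matrix.mulVec_mulVec, hX,
      Matrix.zero_mulVec, zero_add]
  have hf : ∀ (F : Matrix (Fin N) (Fin N) ℝ) (y : Fin N → ℝ),
      y ⬝ᵥ (((M.Q L θ)ᵀ * F * M.Q L θ) *ᵥ y) = (M.Q L θ *ᵥ y) ⬝ᵥ (F *ᵥ (M.Q L θ *ᵥ y)) := by
    intro F y
    rw [← Matrix.mulVec_mulVec, ← Matrix.mulVec_mulVec, Matrix.dotProduct_mulVec,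
      Matrix.vecMul_transpose]
  rw [MixedModel.Solves, funext_iff]
  refine forall_congr' fun a => ?_
  rw [score, centeredQuad_apply, projWeights, hf, hf, hy, Matrix.mul_sub, Matrix.trace_sub,
    Pi.zero_apply, sub_sub, add_sub_cancel]

namespace ModelBound

lemma smooth_XL (h : ModelBound Θ ψ₀ c M W L) : EntrySmooth 3 Θ (fun ψ => M.X * L ψ) :=
  (entrySmooth_const M.X).mul h.smooth_L

lemma smooth_Q (h : ModelBound Θ ψ₀ c M W L) : EntrySmooth 3 Θ (M.Q L) :=
  (entrySmooth_const 1).sub h.smooth_XL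

lemma smooth_projError (h : ModelBound Θ ψ₀ c M W L) (a : Fin k) :
    EntrySmooth 3 Θ (projError M W L a) := fun i j =>
  ((((h.smooth_W a).mul h.smooth_XL).add
    (h.smooth_XL.transpose.mul ((h.smooth_W a).mul h.smooth_Q))) i j).neg

lemma bound_Q (h : ModelBound Θ ψ₀ c M W L) (hΘ : IsOpen Θ) (hc : 1 ≤ c) :
    DerivBound specNorm Θ 3 (M.Q L) (2 * c) := by
  have e : M.Q L = fun ψ => 1 + -(M.X * L ψ) := funext fun ψ => sub_eq_add_neg _ _
  rw [e]
  have hs : EntrySmooth 3 Θ (fun ψ => -(M.X * L ψ)) := fun i j => (h.smooth_XL i j).neg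
  refine ((derivBound_const (c := 1) (by rw [specNorm_zero]; norm_num) specNorm_one_le).add hΘ
    specNorm_add_le (entrySmooth_const 1) hs
    (DerivBound.neg specNorm_neg (h.bound_XL.norm_mono specNorm_le_frob))).weaken
    subset_rfl ?_
  linarith

/-- Every term contains a factor XL, whose Frobenius norm is bounded along with its derivatives. The
Leibniz constants are 8c² for the first product and 8·c·(8·c·2c) = 128c³ for the second. -/
lemma bound_projError (h : ModelBound Θ ψ₀ c M W L) (hΘ : IsOpen Θ) (hc : 1 ≤ c) (a : Fin k) :
    DerivBound frob Θ 3 (projError M W L a) (136 * c ^ 3) := by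
  have hc0 : 0 ≤ c := by linarith
  have b1 := DerivBound.mul hΘ frob_add_le frob_mul_le_specNorm_mul frob_nonneg hc0 hc0
    (h.smooth_W a) h.smooth_XL (h.bound_W a) h.bound_XL
  have b2 := DerivBound.mul hΘ specNorm_add_le specNorm_mul_le specNorm_nonneg hc0
    (by positivity) (h.smooth_W a) h.smooth_Q (h.bound_W a) (h.bound_Q hΘ hc)
  have b3 := DerivBound.mul hΘ frob_add_le frob_mul_le_mul_specNorm specNorm_nonneg hc0
    (by positivity) h.smooth_XL.transpose ((h.smooth_W a).mul h.smooth_Q)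
    (h.bound_XL.transpose frob_transpose) b2
  refine (DerivBound.neg frob_neg (b1.add hΘ frob_add_le ((h.smooth_W a).mul h.smooth_XL)
    (h.smooth_XL.transpose.mul ((h.smooth_W a).mul h.smooth_Q)) b3)).weaken subset_rfl ?_
  nlinarith [mul_nonneg (sq_nonneg c) (sub_nonneg.2 hc)]

lemma bound_projWeights (h : ModelBound Θ ψ₀ c M W L) (hΘ : IsOpen Θ) (hc : 1 ≤ c) (a : Fin k) :
    DerivBound specNorm Θ 3 (projWeights M W L a) (137 * c ^ 3) := by
  rw [projWeights_eq_add]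
  refine ((h.bound_W a).add hΘ specNorm_add_le (h.smooth_W a) (h.smooth_projError a)
    ((h.bound_projError hΘ hc a).norm_mono specNorm_le_frob)).weaken subset_rfl ?_
  nlinarith [mul_nonneg (mul_nonneg (by linarith : 0 ≤ c) (sub_nonneg.2 hc))
    (by linarith : 0 ≤ c + 1)]

lemma pderiv_projWeights (h : ModelBound Θ ψ₀ c M W L) (hΘ : IsOpen Θ) (hψ₀ : ψ₀ ∈ Θ)
    (a b : Fin k) : pderiv b (projWeights M W L a) ψ₀
      = pderiv b (W a) ψ₀ + pderiv b (projError M W L a) ψ₀ := by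
  rw [projWeights_eq_add]
  exact pderiv_add hΘ (n := 2) (h.smooth_W a) (h.smooth_projError a) b hψ₀

/-- As `X L` is idempotent, replacing `W_a` by `Qᵀ W_a Q` changes traces by a bounded amount. -/
lemma abs_trace_projError_mul_le (h : ModelBound Θ ψ₀ c M W L) (hΘ : IsOpen Θ) (hψ₀ : ψ₀ ∈ Θ)
    (hc : 1 ≤ c) (a : Fin k) {F : Matrix (Fin N) (Fin N) ℝ} (hF : specNorm F ≤ c) :
    |(projError M W L a ψ₀ * F).trace| ≤ 3 * c ^ 5 := by
  have hc0 : 0 ≤ c := by linarith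
  have hP : M.X * L ψ₀ * (M.X * L ψ₀) = M.X * L ψ₀ := by
    rw [Matrix.mul_assoc, ← Matrix.mul_assoc (L ψ₀), h.unbiased ψ₀ hψ₀, Matrix.one_mul]
  have fP := h.bound_XL.le hψ₀
  have sW := (h.bound_W a).le hψ₀
  have sQ := (h.bound_Q hΘ hc).le hψ₀
  set P := M.X * L ψ₀ with hPd
  -- Idempotency doubles the factor P = XL, so that each trace pairs two matrices of bounded
  -- Frobenius norm and no power of N is lost.
  have e : projError M W L a ψ₀ * F = -((W a ψ₀ * P) * (P * F)
      + Pᵀ * (Pᵀ * (W a ψ₀ * M.Q L ψ₀ * F))) := by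
    have hP' : Pᵀ * Pᵀ = Pᵀ := by rw [← Matrix.transpose_mul, hP]
    rw [projError, ← hPd, ← Matrix.mul_assoc Pᵀ Pᵀ, hP', Matrix.mul_assoc (W a ψ₀) P (P * F),
      ← Matrix.mul_assoc P P F, hP]
    noncomm_ring
  rw [e, Matrix.trace_neg, abs_neg, Matrix.trace_add]
  have f1 : frob (W a ψ₀ * P) ≤ c * c :=
    (frob_mul_le_specNorm_mul _ _).trans (mul_le_mul sW fP (frob_nonneg _) hc0)
  have f2 : frob (P * F) ≤ c * c :=
    (frob_mul_le_mul_specNorm _ _).trans (mul_le_mul fP hF (specNorm_nonneg _) hc0)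
  have f3 : specNorm (W a ψ₀ * M.Q L ψ₀ * F) ≤ c * (2 * c) * c :=
    (specNorm_mul_le _ _).trans (mul_le_mul ((specNorm_mul_le _ _).trans
      (mul_le_mul sW sQ (specNorm_nonneg _) hc0)) hF (specNorm_nonneg _) (by positivity))
  have fP' : frob Pᵀ ≤ c := by rwa [frob_transpose]
  have f4 : frob (Pᵀ * (W a ψ₀ * M.Q L ψ₀ * F)) ≤ c * (c * (2 * c) * c) :=
    (frob_mul_le_mul_specNorm _ _).trans (mul_le_mul fP' f3 (specNorm_nonneg _) hc0)
  have t1 := (abs_trace_mul_le (W a ψ₀ * P) (P * F)).trans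
    (mul_le_mul f1 f2 (frob_nonneg _) (by positivity))
  have t2 := (abs_trace_mul_le Pᵀ (Pᵀ * (W a ψ₀ * M.Q L ψ₀ * F))).trans
    (mul_le_mul fP' f4 (frob_nonneg _) hc0)
  refine (abs_add_le _ _).trans ((add_le_add t1 t2).trans ?_)
  nlinarith [mul_nonneg (pow_nonneg hc0 4) (sub_nonneg.2 hc)]

lemma pderiv_Sig_sub (M : MixedModel N m p k) (ψ₀ : Fin k → ℝ) (b : Fin k) :
    pderiv b (fun ψ => M.Sig ψ - M.Sig ψ₀) = pderiv b M.Sig := pderiv_sub_const _ _ _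

lemma smooth_D (h : ModelBound Θ ψ₀ c M W L) :
    EntrySmooth 3 Θ (fun ψ => M.Sig ψ - M.Sig ψ₀) := h.smooth_Sig.sub (entrySmooth_const _)

/-- Identification in the limit `ψ → ψ₀`. -/
lemma coercive (h : ModelBound Θ ψ₀ c M W L) (hΘ : IsOpen Θ) (hψ₀ : ψ₀ ∈ Θ) (x : Fin k → ℝ) :
    N * ‖x‖ ≤ c * ‖M.A W ψ₀ *ᵥ x‖ := by
  let D := fun ψ => M.Sig ψ - M.Sig ψ₀
  let f : ℝ → Fin k → ℝ := fun s a => (W a (ψ₀ + s • x) * D (ψ₀ + s • x)).trace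
  have hD0 : D ψ₀ = 0 := sub_self _
  have hf : HasDerivAt f (M.A W ψ₀ *ᵥ x) 0 := by
    rw [hasDerivAt_pi]
    intro a
    have h0 : ψ₀ + (0 : ℝ) • x = ψ₀ := by rw [zero_smul, add_zero]
    have := EntrySmooth.hasDerivAt_line hΘ (n := 2) ((h.smooth_W a).mul h.smooth_D)
      (Matrix.traceLinearMap (Fin N) ℝ ℝ) (x := ψ₀) (h := x) (s := 0) (by rwa [h0])
    refine this.congr_deriv ?_
    rw [mulVec_apply_eq_sum]
    refine Finset.sum_congr rfl fun b _ => ?_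
    rw [h0, pderiv_mul hΘ (n := 2) (h.smooth_W a) h.smooth_D b hψ₀]
    change x b * (pderiv b (W a) ψ₀ * D ψ₀ + W a ψ₀ * pderiv b D ψ₀).trace = _
    rw [hD0, Matrix.mul_zero, zero_add, pderiv_Sig_sub]
    rfl
  have hf0 : f 0 = 0 := by
    funext a
    change (W a (ψ₀ + (0 : ℝ) • x) * D (ψ₀ + (0 : ℝ) • x)).trace = 0
    rw [zero_smul, add_zero, hD0, Matrix.mul_zero, Matrix.trace_zero]
  -- Identification at ψ₀ + sx is divided by s > 0, and s tends to 0.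
  have ht := (hf.tendsto_slope_zero_right).norm.const_mul c
  refine ge_of_tendsto ht ?_
  have hcont : Tendsto (fun s : ℝ => ψ₀ + s • x) (nhdsWithin 0 (Set.Ioi 0)) (nhds ψ₀) := by
    have : Tendsto (fun s : ℝ => ψ₀ + s • x) (nhds 0) (nhds (ψ₀ + (0 : ℝ) • x)) :=
      (Continuous.tendsto (by fun_prop) 0)
    rw [zero_smul, add_zero] at this
    exact this.mono_left nhdsWithin_le_nhds
  filter_upwards [hcont.eventually (hΘ.mem_nhds hψ₀), self_mem_nhdsWithin] with s hs hs0
  have hs0' : 0 < s := hs0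
  have := h.ident _ hs
  rw [add_sub_cancel_left, norm_smul, Real.norm_of_nonneg hs0'.le] at this
  rw [zero_add, hf0, sub_zero, norm_smul, norm_inv, Real.norm_of_nonneg hs0'.le]
  refine le_of_mul_le_mul_left ?_ hs0'
  calc s * (N * ‖x‖) = N * (s * ‖x‖) := by ring
    _ ≤ c * ‖f s‖ := this
    _ = s * (c * (s⁻¹ * ‖f s‖)) := by field_simp

lemma estSystem (h : ModelBound Θ ψ₀ c M W L) (hΘ : IsOpen Θ) (hΘc : Convex ℝ Θ)
    (hψ₀ : ψ₀ ∈ Θ) (hc : 1 ≤ c) (hN : 2 * (136 * k * c ^ 5) ≤ √N) :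
    EstSystem Θ ψ₀ (300 * c ^ 5) (projWeights M W L) (fun ψ => M.Sig ψ - M.Sig ψ₀)
      (M.A W ψ₀) (M.H W ψ₀) := by
  have hc0 : 0 ≤ c := by linarith
  have hc1 : c ≤ c ^ 5 := le_self_pow₀ hc (by norm_num)
  have hc3 : c ^ 3 ≤ c ^ 5 := pow_le_pow_right₀ hc (by norm_num)
  have hc4 : c ^ 4 ≤ c ^ 5 := pow_le_pow_right₀ hc (by norm_num)
  have hsq : √(N : ℝ) * √N = N := Real.mul_self_sqrt (Nat.cast_nonneg _)
  have key : ∀ {E F : Matrix (Fin N) (Fin N) ℝ} {r : ℝ}, frob E ≤ 136 * c ^ 3 → specNorm F ≤ r →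
      |(E * F).trace| ≤ 136 * c ^ 3 * (√N * r) := fun hE hF =>
    (abs_trace_mul_le _ _).trans (mul_le_mul hE ((frob_le_sqrt_mul_specNorm _).trans
      (mul_le_mul_of_nonneg_left hF (Real.sqrt_nonneg _))) (frob_nonneg _) (by positivity))
  refine ⟨fun a => ?_, h.smooth_D, fun a => (h.bound_projWeights hΘ hc a).weaken subset_rfl
    (by linarith), fun b => ?_, sub_self _, fun ψ hψ => ?_, fun x => ?_, fun a b => ?_,
    fun a b d => ?_⟩
  · rw [projWeights_eq_add]
    exact (h.smooth_W a).add (h.smooth_projError a)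
  · rw [pderiv_Sig_sub]
    exact (h.bound_dSig b).weaken subset_rfl (by linarith)
  -- Identification for W passes to the projected weights: the traces differ by O(√N)‖ψ - ψ₀‖, which
  -- for large N is at most half of N‖ψ - ψ₀‖ after multiplication by c.
  · have hD := specNorm_sub_le_of_pderiv_bound hΘ hΘc (n := 2) h.smooth_Sig hc0
      (fun b φ hφ => (h.bound_dSig b).le hφ) hψ₀ hψ
    have h1 : ‖fun a => (W a ψ * (M.Sig ψ - M.Sig ψ₀)).trace‖
        ≤ ‖fun a => (projWeights M W L a ψ * (M.Sig ψ - M.Sig ψ₀)).trace‖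
          + 136 * c ^ 3 * (√N * (k * c * ‖ψ - ψ₀‖)) := by
      rw [pi_norm_le_iff_of_nonneg (by positivity)]
      intro a
      have e2 := norm_le_pi_norm
        (fun a => (projWeights M W L a ψ * (M.Sig ψ - M.Sig ψ₀)).trace) a
      have e3 := key ((h.bound_projError hΘ hc a).le hψ) hD
      have e4 : (W a ψ * (M.Sig ψ - M.Sig ψ₀)).trace
          = (projWeights M W L a ψ * (M.Sig ψ - M.Sig ψ₀)).trace
            - (projError M W L a ψ * (M.Sig ψ - M.Sig ψ₀)).trace := by
        rw [projWeights_eq_add, Matrix.add_mul, Matrix.trace_add, add_sub_cancel_right]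
      rw [e4]
      exact (norm_sub_le _ _).trans (add_le_add e2 e3)
    have h2 := h.ident ψ hψ
    have h3 := mul_le_mul_of_nonneg_left h1 hc0
    have h4 := mul_le_mul_of_nonneg_left hN (Real.sqrt_nonneg (N : ℝ))
    rw [hsq] at h4
    have h5 := mul_le_mul_of_nonneg_right h4 (norm_nonneg (ψ - ψ₀))
    have h6 : N * ‖ψ - ψ₀‖
        ≤ 2 * c * ‖fun a => (projWeights M W L a ψ * (M.Sig ψ - M.Sig ψ₀)).trace‖ := by
      nlinarith only [h2, h3, h5]
    exact h6.trans (mul_le_mul_of_nonneg_right (by linarith) (norm_nonneg _))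
  · exact (h.coercive hΘ hψ₀ x).trans (mul_le_mul_of_nonneg_right (by linarith) (norm_nonneg _))
  · have e : (projWeights M W L a ψ₀ * pderiv b (fun ψ => M.Sig ψ - M.Sig ψ₀) ψ₀).trace
        - M.A W ψ₀ a b = (projError M W L a ψ₀ * pderiv b M.Sig ψ₀).trace := by
      rw [projWeights_eq_add, Matrix.add_mul, Matrix.trace_add, pderiv_Sig_sub]
      exact add_sub_cancel_left _ _
    rw [e]
    refine (h.abs_trace_projError_mul_le hΘ hψ₀ hc a ((h.bound_dSig b).le hψ₀)).trans ?_
    nlinarith [pow_nonneg hc0 5]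
  -- For the Hessian the plain bound O(√N) is enough. It gives 136·(3/2) = 204, the largest constant
  -- that 300 has to cover.
  · have e : (pderiv b (projWeights M W L a) ψ₀
          * pderiv d (fun ψ => M.Sig ψ - M.Sig ψ₀) ψ₀).trace
        + (projWeights M W L a ψ₀
          * pderiv b (pderiv d (fun ψ => M.Sig ψ - M.Sig ψ₀)) ψ₀).trace / 2 - M.H W ψ₀ a b d
        = (pderiv b (projError M W L a) ψ₀ * pderiv d M.Sig ψ₀).trace
          + (projError M W L a ψ₀ * pderiv b (pderiv d M.Sig) ψ₀).trace / 2 := by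
      rw [h.pderiv_projWeights hΘ hψ₀, pderiv_Sig_sub, projWeights_eq_add, Matrix.add_mul,
        Matrix.add_mul, Matrix.trace_add, Matrix.trace_add, MixedModel.H, Matrix.of_apply]
      ring
    rw [e]
    have t1 := key (((h.bound_projError hΘ hc a).bound_pderiv b).le hψ₀) ((h.bound_dSig d).le hψ₀)
    have t2 := key ((h.bound_projError hΘ hc a).le hψ₀)
      (((h.bound_dSig d).bound_pderiv b).le hψ₀)
    have h7 : 136 * c ^ 3 * (√N * c) ≤ 136 * c ^ 5 * √N := by
      have := mul_le_mul_of_nonneg_right hc4 (Real.sqrt_nonneg (N : ℝ))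
      nlinarith only [this]
    have h8 := mul_nonneg (pow_nonneg hc0 5) (Real.sqrt_nonneg (N : ℝ))
    rw [abs_le] at t1 t2 ⊢
    constructor <;> linarith

end ModelBound

end SingleModel

/-! ### The dominating variable, the leading terms, and bounds for one model. -/

section Moments

variable {Ω : Type*} [MeasurableSpace Ω] {μ : Measure Ω} {N m p k : ℕ}

lemma L3Le.abs {X : Ω → ℝ} {a : ℝ} (h : L3Le μ X a) : L3Le μ (fun ω => |X ω|) a :=
  ⟨h.aesm.norm, by simpa only [abs_abs] using h.int, h.nonneg, by simpa only [abs_abs] using h.le⟩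

variable [IsProbabilityMeasure μ]

/-- A random variable of order `n^{-1/2}` dominating finitely many normalized quadratic forms. -/
lemma exists_dominating {τ : Type*} [Fintype τ] {q : Ω → Matrix (Fin N) (Fin N) ℝ →ₗ[ℝ] ℝ}
    {κ f n w : ℝ} (hκ : 0 ≤ κ) (hf : 0 ≤ f) (hw0 : 0 < w) (hw : n * w ^ 2 = 1)
    (hq : ∀ C, L3Le μ (fun ω => q ω C) (κ * frob C)) {F : τ → Matrix (Fin N) (Fin N) ℝ}
    (hF : ∀ i, frob (F i) ≤ f * (n * w)) :
    ∃ z : Ω → ℝ, (∀ ω, 0 < z ω) ∧ (∀ ω, 1 ≤ n * z ω ^ 2) ∧ (∀ ω i, |q ω (F i)| ≤ n * z ω) ∧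
      L3Le μ z ((Fintype.card τ + 1) * (1 + κ * f) * w) := by
  have hn : 0 < n := by
    by_contra hn
    nlinarith [mul_nonneg (neg_nonneg.2 (not_lt.1 hn)) (sq_nonneg w)]
  -- The extra summand 1 makes z at least w, hence n z² ≥ 1.
  let G : Option τ → Ω → ℝ := fun o ω => o.elim 1 fun i => w * |q ω (F i)|
  have hs : ∀ ω, ∑ o, G o ω = 1 + w * ∑ i, |q ω (F i)| := fun ω => by
    rw [Fintype.sum_option, Finset.mul_sum]
    rfl
  have hS : ∀ ω, 0 ≤ ∑ i, |q ω (F i)| := fun ω => Finset.sum_nonneg fun i _ => abs_nonneg _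
  refine ⟨fun ω => w * ∑ o, G o ω, fun ω => ?_, fun ω => ?_, fun ω i => ?_, ?_⟩
  · change 0 < w * ∑ o, G o ω
    rw [hs]
    have := hS ω
    positivity
  · change 1 ≤ n * (w * ∑ o, G o ω) ^ 2
    rw [hs, mul_pow, ← mul_assoc, hw, one_mul]
    exact one_le_pow₀ (le_add_of_nonneg_right (mul_nonneg hw0.le (hS ω)))
  · have h1 := Finset.single_le_sum (fun i _ => abs_nonneg (q ω (F i))) (Finset.mem_univ i)
    have h2 : n * (w * ∑ o, G o ω) = n * w + ∑ i, |q ω (F i)| := by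
      rw [hs]
      linear_combination (∑ i, |q ω (F i)|) * hw
    rw [h2]
    have := mul_pos hn hw0
    linarith
  · have hG : ∀ o ∈ Finset.univ, L3Le μ (G o) (1 + κ * f) := by
      rintro (_ | i) _
      · exact l3Le_one.mono (le_add_of_nonneg_right (mul_nonneg hκ hf))
      · refine ((hq (F i)).abs.const_mul w).mono ?_
        rw [abs_of_pos hw0]
        have := mul_le_mul_of_nonneg_left (hF i) (mul_nonneg hw0.le hκ)
        have h3 : w * κ * (f * (n * w)) = κ * f := by linear_combination (κ * f) * hw
        nlinarith
    have := (L3Le.sum (add_nonneg zero_le_one (mul_nonneg hκ hf)) hG).const_mul w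
    refine this.mono (le_of_eq ?_)
    rw [abs_of_pos hw0, Finset.card_univ, Fintype.card_option]
    push_cast
    ring

section LeadingTerms

variable {M : MixedModel N m p k} {W : Weights N k} {ψ₀ : Fin k → ℝ} {Ke Kv S : ℝ}
  {ε : Ω → Fin N → ℝ} {v : Ω → Fin m → ℝ}

lemma leadCov_eq (h : M.ErrorLaw μ ψ₀ Ke Kv S ε v) (hW : ∀ a, (W a ψ₀).IsSymm) (a d : Fin k) :
    leadCov μ (fun ω => centeredQuad (M.Sig ψ₀) (M.Z *ᵥ v ω + ε ω)) (fun a => W a ψ₀) (M.A W ψ₀)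
      a d = M.asympCov W Ke Kv ψ₀ a d := by
  simp only [leadCov, integral_centeredQuad_mul h _ _ (hW _)]
  simp only [MixedModel.asympCov, Matrix.add_apply, Matrix.smul_apply, smul_eq_mul,
    Matrix.mul_apply (M := _ * _), Matrix.mul_apply (M := (M.A W ψ₀)⁻¹), Matrix.transpose_apply,
    Finset.sum_mul, Finset.mul_sum]
  rw [Finset.sum_comm, ← Finset.sum_add_distrib]
  refine Finset.sum_congr rfl fun i _ => ?_
  rw [← Finset.sum_add_distrib]
  refine Finset.sum_congr rfl fun j _ => ?_
  simp only [MixedModel.B, MixedModel.Bt, Matrix.of_apply]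
  ring

lemma inv_mulVec_leadScore_eq (h : M.ErrorLaw μ ψ₀ Ke Kv S ε v) (hW : ∀ a, (W a ψ₀).IsSymm) :
    (M.A W ψ₀)⁻¹ *ᵥ leadScore μ (fun ω => centeredQuad (M.Sig ψ₀) (M.Z *ᵥ v ω + ε ω))
      (fun a => W a ψ₀) (fun a b => pderiv b (W a) ψ₀) (M.A W ψ₀) (M.H W ψ₀)
      = M.asympBias W Ke Kv ψ₀ := by
  rw [MixedModel.asympBias, ← Matrix.mulVec_smul, ← Matrix.mulVec_add]
  congr 1
  funext a
  have ht : ∀ F G : Matrix (Fin k) (Fin k) ℝ, (F * G).trace = ∑ b, ∑ d, F b d * G d b :=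
    fun F G => rfl
  simp only [leadScore, leadCov_eq h hW, integral_centeredQuad_mul h _ _ (hW _)]
  have e : M.asympCov W Ke Kv ψ₀ = (2 : ℝ) • ((M.A W ψ₀)⁻¹ * M.B W ψ₀ * ((M.A W ψ₀)⁻¹)ᵀ)
    + (M.A W ψ₀)⁻¹ * M.Bt W Ke Kv ψ₀ * ((M.A W ψ₀)⁻¹)ᵀ := rfl
  have e1 : ∑ b, ∑ d, M.H W ψ₀ a b d * M.asympCov W Ke Kv ψ₀ d b
      = 2 * (M.H W ψ₀ a * (M.A W ψ₀)⁻¹ * M.B W ψ₀ * ((M.A W ψ₀)⁻¹)ᵀ).trace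
        + (M.H W ψ₀ a * (M.A W ψ₀)⁻¹ * M.Bt W Ke Kv ψ₀ * ((M.A W ψ₀)⁻¹)ᵀ).trace := by
    rw [← ht, e, Matrix.mul_add, Matrix.trace_add, Matrix.mul_smul, Matrix.trace_smul]
    simp only [Matrix.mul_assoc, smul_eq_mul]
  have e2 : ∑ b, ∑ i, (M.A W ψ₀)⁻¹ b i * (2 * (pderiv b (W a) ψ₀ * M.Sig ψ₀ * W i ψ₀
        * M.Sig ψ₀).trace + (Ke * M.he ψ₀ (pderiv b (W a) ψ₀) (W i ψ₀)
          + Kv * M.hv ψ₀ (pderiv b (W a) ψ₀) (W i ψ₀)))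
      = 2 * (M.K W ψ₀ a * ((M.A W ψ₀)⁻¹)ᵀ).trace
        + (M.Kt W Ke Kv ψ₀ a * ((M.A W ψ₀)⁻¹)ᵀ).trace := by
    rw [ht, ht]
    simp only [Finset.mul_sum, ← Finset.sum_add_distrib]
    refine Finset.sum_congr rfl fun b _ => Finset.sum_congr rfl fun i _ => ?_
    rw [Matrix.transpose_apply, MixedModel.K, MixedModel.Kt, Matrix.of_apply, Matrix.of_apply]
    ring
  rw [e1, e2]
  simp only [Pi.add_apply, Pi.smul_apply, smul_eq_mul, Matrix.trace_sub]
  ring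

end LeadingTerms

/-- Second moments of an estimator for a single large model. -/
theorem exists_moment_bounds (c R S : ℝ) (hc : 1 ≤ c) (hR : 0 ≤ R) {Θ : Set (Fin k → ℝ)}
    (hΘ : IsOpen Θ) (hΘc : Convex ℝ Θ) {ψ₀ : Fin k → ℝ} (hψ₀ : ψ₀ ∈ Θ) :
    ∃ (B : ℝ) (N₀ : ℕ), ∀ {N m : ℕ}, N₀ ≤ N → ∀ {M : MixedModel N m p k} {W : Weights N k}
      {L : (Fin k → ℝ) → Matrix (Fin p) (Fin N) ℝ}, ModelBound Θ ψ₀ c M W L →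
      ∀ {Ω : Type*} [MeasurableSpace Ω] {μ : Measure Ω} [IsProbabilityMeasure μ] {Ke Kv : ℝ}
        {ε : Ω → Fin N → ℝ} {v : Ω → Fin m → ℝ}, M.ErrorLaw μ ψ₀ Ke Kv S ε v →
      ∀ (β : Fin p → ℝ) {ψhat : Ω → Fin k → ℝ}, Measurable ψhat →
        (∀ ω, (∃ θ ∈ Θ, M.Solves W L (M.obs β (ε ω) (v ω)) θ) →
          ψhat ω ∈ Θ ∧ M.Solves W L (M.obs β (ε ω) (v ω)) (ψhat ω)) →
        (∀ ω, (¬ ∃ θ ∈ Θ, M.Solves W L (M.obs β (ε ω) (v ω)) θ) → ‖ψhat ω‖ ≤ R) →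
        IsUnit (M.A W ψ₀).det ∧ (∀ a, MemLp (fun ω => ψhat ω a) 2 μ) ∧
        (∀ a b, |covariance (fun ω => ψhat ω a) (fun ω => ψhat ω b) μ
          - M.asympCov W Ke Kv ψ₀ a b| ≤ B * (N : ℝ) ^ (-(3 / 2) : ℝ)) ∧
        ∀ a, |(∫ ω, (ψhat ω a - ψ₀ a) ∂μ) - M.asympBias W Ke Kv ψ₀ a|
          ≤ B * (N : ℝ) ^ (-(3 / 2) : ℝ) := by
  have hc0 : 0 ≤ c := by linarith
  obtain ⟨c', hc'⟩ : ∃ c' : ℝ, c' = 300 * c ^ 5 := ⟨_, rfl⟩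
  have h5 : c ≤ c ^ 5 := le_self_pow₀ hc (by norm_num)
  have h3 : c ^ 3 ≤ c ^ 5 := pow_le_pow_right₀ hc (by norm_num)
  have hc'1 : 1 ≤ c' := by rw [hc']; linarith
  have hc'0 : 0 ≤ c' := by linarith
  obtain ⟨J, C, N₀, hJΘ, hC, hexp⟩ := exists_expansion c' R hc'1 hR hΘ hΘc hψ₀
  obtain ⟨κ, hκ⟩ : ∃ κ : ℝ, κ = 9 * (1 + |S|) ^ 2 * c := ⟨_, rfl⟩
  have hκ0 : 0 ≤ κ := by rw [hκ]; positivity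
  -- Index set of the matrices on which z must dominate q: the identity, V_a, its first and second
  -- derivatives at ψ₀, and V_a on the net. Its cardinality does not depend on N, so the constant b
  -- is uniform.
  let τ := Unit ⊕ Fin k ⊕ (Fin k × Fin k) ⊕ (Fin k × Fin k × Fin k) ⊕ (J × Fin k)
  obtain ⟨b, hb⟩ : ∃ b : ℝ, b = (Fintype.card τ + 1) * (1 + κ * c') := ⟨_, rfl⟩
  have hb0 : 0 ≤ b := by rw [hb]; positivity
  obtain ⟨B₁, hB₁⟩ : ∃ B : ℝ, B = C * (C + c') * b ^ 3 + 2 * k ^ 2 * c' ^ 2 * κ ^ 2 * c' * c'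
    + C ^ 2 * b ^ 4 := ⟨_, rfl⟩
  obtain ⟨B₂, hB₂⟩ : ∃ B : ℝ, B = c' * (C * b ^ 3 + 2 * k ^ 2 * c' * κ ^ 2 * c' * c'
    + 6 * k ^ 4 * c' ^ 4 * κ ^ 2 * c' * c') := ⟨_, rfl⟩
  have hB₁0 : 0 ≤ B₁ := by rw [hB₁]; positivity
  have hB₂0 : 0 ≤ B₂ := by rw [hB₂]; positivity
  obtain ⟨N₁, hN₁⟩ := exists_nat_ge ((2 * (136 * k * c ^ 5)) ^ 2)
  refine ⟨B₁ + B₂, max (max N₀ N₁) 1, ?_⟩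
  intro N m hN M W L hM Ω _ μ _ Ke Kv ε v hlaw β ψhat hmeas hsol hfall
  have hN1 : 1 ≤ N := (le_max_right _ _).trans hN
  have hn1 : (1 : ℝ) ≤ N := by exact_mod_cast hN1
  have hn : (0 : ℝ) < N := by linarith
  have hNsq : 2 * (136 * k * c ^ 5) ≤ √(N : ℝ) := by
    refine Real.le_sqrt_of_sq_le (hN₁.trans ?_)
    exact_mod_cast (le_max_right N₀ N₁).trans ((le_max_left _ _).trans hN)
  have hE := hM.estSystem hΘ hΘc hψ₀ hc hNsq
  rw [← hc'] at hE
  obtain ⟨w, hw⟩ : ∃ w : ℝ, w = (√(N : ℝ))⁻¹ := ⟨_, rfl⟩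
  have hs0 : 0 < √(N : ℝ) := Real.sqrt_pos.2 hn
  have hw0 : 0 < w := by rw [hw]; positivity
  have hss := Real.sq_sqrt hn.le
  have hw2 : (N : ℝ) * w ^ 2 = 1 := by
    rw [hw, inv_pow, hss, mul_inv_cancel₀ hn.ne']
  have hw1 : w ≤ 1 := by
    rw [hw]
    exact inv_le_one_of_one_le₀ (Real.one_le_sqrt.2 hn1)
  have hnw : (N : ℝ) * w = √N := by
    rw [hw, ← div_eq_mul_inv, div_eq_iff hs0.ne', ← sq, hss]
  have hw3 : (N : ℝ) ^ (-(3 / 2) : ℝ) = w ^ 3 := by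
    rw [hw, inv_pow, Real.rpow_neg hn.le, Real.sqrt_eq_rpow, ← Real.rpow_mul_natCast hn.le]
    norm_num
  have hfrob : ∀ {F : Matrix (Fin N) (Fin N) ℝ}, specNorm F ≤ c' → frob F ≤ c' * (N * w) := by
    intro F hF
    rw [hnw, mul_comm]
    exact (frob_le_sqrt_mul_specNorm F).trans (mul_le_mul_of_nonneg_left hF hs0.le)
  let q : Ω → Matrix (Fin N) (Fin N) ℝ →ₗ[ℝ] ℝ :=
    fun ω => centeredQuad (M.Sig ψ₀) (M.Z *ᵥ v ω + ε ω)
  have hq : ∀ F, L3Le μ (fun ω => q ω F) (κ * frob F) := fun F => by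
    refine (l3Le_centeredQuad hlaw F).mono (mul_le_mul_of_nonneg_right ?_ (frob_nonneg _))
    rw [hκ]
    exact mul_le_mul_of_nonneg_left hM.bound_Sig₀ (by positivity)
  have hq0 : ∀ F, ∫ ω, q ω F ∂μ = 0 := integral_centeredQuad hlaw
  have hqs : ∀ ω F, |q ω F| ≤ specNorm F * (c' * N + |q ω 1|) := fun ω F => by
    refine (abs_centeredQuad_le (M.Sig ψ₀) (M.Z *ᵥ v ω + ε ω) hM.bound_Sig₀ F).trans
      (mul_le_mul_of_nonneg_left ?_ (specNorm_nonneg _))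
    have : 2 * c * N ≤ c' * N := mul_le_mul_of_nonneg_right (by rw [hc']; linarith) hn.le
    simpa only [q] using add_le_add_left this _
  set V := projWeights M W L with hV
  have bV := hE.bound_V
  obtain ⟨F, hF⟩ : ∃ F : τ → Matrix (Fin N) (Fin N) ℝ, F = Sum.elim (fun _ => 1) (Sum.elim
    (fun a => V a ψ₀) (Sum.elim (fun i => pderiv i.2 (V i.1) ψ₀) (Sum.elim
      (fun i => pderiv i.2.1 (pderiv i.2.2 (V i.1)) ψ₀) (fun i => V i.2 i.1)))) := ⟨_, rfl⟩
  have hFb : ∀ i, frob (F i) ≤ c' * (N * w) := by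
    rw [hF]
    rintro (_ | a | ⟨a, b⟩ | ⟨a, b, d⟩ | ⟨θ, a⟩)
    · exact hfrob (specNorm_one_le.trans hc'1)
    · exact hfrob ((bV a).le hψ₀)
    · exact hfrob (((bV a).bound_pderiv b).le hψ₀)
    · exact hfrob ((((bV a).bound_pderiv d).bound_pderiv b).le hψ₀)
    · exact hfrob ((bV a).le (hJΘ θ.2))
  obtain ⟨z, hz0, hz1, hzF, hz⟩ := exists_dominating hκ0 hc'0 hw0 hw2 hq hFb
  rw [← hb] at hz
  rw [hF] at hzF
  have hscore : ∀ ω, ∀ θ ∈ Θ, M.Solves W L (M.obs β (ε ω) (v ω)) θ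
      ↔ score V (fun ψ => M.Sig ψ - M.Sig ψ₀) (q ω) θ = 0 := fun ω θ hθ =>
    solves_iff_score_eq_zero (hM.unbiased θ hθ) β (ε ω) (v ω)
  have hex : ∀ ω, (∃ θ ∈ Θ, M.Solves W L (M.obs β (ε ω) (v ω)) θ)
      ↔ ∃ θ ∈ Θ, score V (fun ψ => M.Sig ψ - M.Sig ψ₀) (q ω) θ = 0 := fun ω =>
    exists_congr fun θ => and_congr_right fun hθ => hscore ω θ hθ
  have key := fun ω => hexp ((le_max_left N₀ N₁).trans ((le_max_left _ _).trans hN)) hE (q ω)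
    (z ω) (ψhat ω) (hz0 ω) (hz1 ω) (hqs ω) (hzF ω (Sum.inl ()))
    (fun a => hzF ω (Sum.inr (Sum.inl a)))
    (fun a b => hzF ω (Sum.inr (Sum.inr (Sum.inl (a, b)))))
    (fun a b d => hzF ω (Sum.inr (Sum.inr (Sum.inr (Sum.inl (a, b, d))))))
    (fun θ hθ a => hzF ω (Sum.inr (Sum.inr (Sum.inr (Sum.inr (⟨θ, hθ⟩, a))))))
    (fun he => by
      have := hsol ω ((hex ω).2 he)
      exact ⟨this.1, (hscore ω _ this.1).1 this.2⟩)
    (fun he => hfall ω fun h => he ((hex ω).1 h))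
  have hψm : ∀ a, Measurable fun ω => ψhat ω a := fun a => (measurable_pi_apply a).comp hmeas
  have hδm : ∀ a, AEStronglyMeasurable (fun ω => (ψhat ω - ψ₀) a) μ := fun a =>
    ((hψm a).sub_const (ψ₀ a)).aestronglyMeasurable
  have hδ2 : ∀ a, MemLp (fun ω => (ψhat ω - ψ₀) a) 2 μ := fun a =>
    ((hz.of_abs_le (hδm a) hC fun ω =>
      (norm_le_pi_norm (ψhat ω - ψ₀) a).trans (key ω).1).memLp).mono_exponent (by norm_num)
  have hψδ : ∀ a, (fun ω => ψhat ω a) = fun ω => (ψhat ω - ψ₀) a + ψ₀ a := fun a =>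
    funext fun ω => by rw [Pi.sub_apply, sub_add_cancel]
  have he : ∀ {G : Matrix (Fin N) (Fin N) ℝ}, frob G ≤ 136 * c ^ 3 → frob G ≤ c' := fun hG =>
    hG.trans (by rw [hc']; linarith)
  have hVW₀ : ∀ i, frob (V i ψ₀ - W i ψ₀) ≤ c' := fun i => he (by
    rw [hV, projWeights_eq_add, add_sub_cancel_left]
    exact (hM.bound_projError hΘ hc i).le hψ₀)
  have hVW₁ : ∀ i j, frob (pderiv j (V i) ψ₀ - pderiv j (W i) ψ₀) ≤ c' := fun i j => he (by
    rw [hV, hM.pderiv_projWeights hΘ hψ₀, add_sub_cancel_left]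
    exact ((hM.bound_projError hΘ hc i).bound_pderiv j).le hψ₀)
  have hcc : c ≤ c' := by rw [hc']; linarith
  have hV₀ : ∀ i, frob (V i ψ₀) ≤ c' * (N * w) := fun i => hfrob ((bV i).le hψ₀)
  have hW₀ : ∀ i, frob (W i ψ₀) ≤ c' * (N * w) := fun i =>
    hfrob (((hM.bound_W i).le hψ₀).trans hcc)
  have hW₁ : ∀ i j, frob (pderiv j (W i) ψ₀) ≤ c' * (N * w) := fun i j =>
    hfrob ((((hM.bound_W i).bound_pderiv j).le hψ₀).trans hcc)
  refine ⟨isUnit_det_of_coercive hn hE.coercive, fun a => ?_, fun a d => ?_, fun a => ?_⟩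
  · rw [hψδ]
    exact (hδ2 a).add (memLp_const _)
  · have := abs_covariance_sub_leadCov_le (δ := fun ω => ψhat ω - ψ₀) hq hq0 hn hw0 hw1 hw2
      hE.coercive hc'0 hc'0 hc'0 hV₀ hW₀ hVW₀ hz (fun ω => (hz0 ω).le) hC
      (fun ω i => hzF ω (Sum.inr (Sum.inl i))) hδm (fun ω => (key ω).1) (fun ω => (key ω).2.1) a d
    rw [leadCov_eq hlaw hM.symm_W, ← hB₁] at this
    rw [hψδ, hψδ, covariance_add_const_left ((hδ2 a).integrable (by norm_num)),
      covariance_add_const_right ((hδ2 d).integrable (by norm_num)), hw3]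
    exact this.trans (mul_le_mul_of_nonneg_right (by linarith) (by positivity))
  · have := norm_mean_sub_le (δ := fun ω => ψhat ω - ψ₀) hq hq0 hn hw0 hw2
      hE.coercive hc'0 hc'0 hc'0 hb0 hV₀ hW₀ hVW₀ hW₁ hVW₁
      (fun i j l => hE.abs_H_le hψ₀ hc'1 hn1 i j l) hz (fun ω => (hz0 ω).le) hC
      hδm (fun ω => (key ω).1) (fun ω a => (key ω).2.2 a)
    rw [inv_mulVec_leadScore_eq hlaw hM.symm_W, ← hB₂] at this
    rw [hw3]
    refine (norm_le_pi_norm _ a).trans (this.trans ?_)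
    exact mul_le_mul_of_nonneg_right (by linarith) (by positivity)

end Moments

/-! ### Passage to sequences of models and conclusion. -/

section Assembly

variable {p k : ℕ} {N m : ℕ → ℕ} {M : ∀ t, MixedModel (N t) (m t) p k} {W : ∀ t, Weights (N t) k}
  {Θ : Set (Fin k → ℝ)} {ψ₀ : Fin k → ℝ} {L : ∀ t, (Fin k → ℝ) → Matrix (Fin p) (Fin (N t)) ℝ}

lemma RegularModels.exists_modelBound (hreg : RegularModels N m M W Θ ψ₀) (hψ₀ : ψ₀ ∈ Θ)
    (hL : AdmissibleL N m M W Θ ψ₀ L) :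
    ∃ c : ℝ, 1 ≤ c ∧ ∀ᶠ t in atTop, ModelBound Θ ψ₀ c (M t) (W t) (L t) := by
  obtain ⟨c₁, h₁⟩ := hreg.bound_Sig₀
  obtain ⟨c₂, h₂⟩ := hreg.bound_dSig
  obtain ⟨c₃, h₃⟩ := hreg.bound_W
  obtain ⟨c₄, h₄⟩ := hL.order_XL
  obtain ⟨c₅, hc₅, h₅⟩ := hreg.ident
  -- One constant for all bounds; the inverse appears because `ModelBound` carries the
  -- identification constant on the other side.
  obtain ⟨c, hc⟩ : ∃ c : ℝ, c = 1 + |c₁| + |c₂| + |c₃| + |c₄| + c₅⁻¹ := ⟨_, rfl⟩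
  have a₁ := abs_nonneg c₁
  have a₂ := abs_nonneg c₂
  have a₃ := abs_nonneg c₃
  have a₄ := abs_nonneg c₄
  have a₅ := inv_pos.2 hc₅
  refine ⟨c, by linarith, h₅.mono fun t ht => ?_⟩
  refine ⟨fun a => hreg.symm_W t a ψ₀ hψ₀, hreg.smooth_Sig t, hreg.smooth_W t, hL.smooth t,
    (h₁ t).trans (by linarith [le_abs_self c₁]), fun b => ?_, fun a => ?_, ?_, hL.unbiased t,
    fun ψ hψ => ?_⟩
  · refine derivBound_of_pderivs fun s hs ψ hψ => ?_
    -- Bounds on Σ are available away from ψ₀ only for orders at least one; appending b meets this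
    -- requirement.
    have := h₂ t (s ++ [b]) (by simp) (by simpa [Nat.lt_succ_iff] using hs) ψ hψ
    rw [pderivs, List.foldr_append] at this
    exact this.trans (by linarith [le_abs_self c₂])
  · exact derivBound_of_pderivs fun s hs ψ hψ =>
      (h₃ t a s hs ψ hψ).trans (by linarith [le_abs_self c₃])
  · exact derivBound_of_pderivs fun s hs ψ hψ =>
      (frob_le_of_entries (h₄ t s hs ψ hψ)).trans (by linarith)
  · have h6 : N t * ‖ψ - ψ₀‖ = c₅⁻¹ * (c₅ * N t * ‖ψ - ψ₀‖) := by field_simp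
    rw [h6]
    exact (mul_le_mul_of_nonneg_left (ht ψ hψ) a₅.le).trans
      (mul_le_mul_of_nonneg_right (by linarith) (norm_nonneg _))

end Assembly

theorem theorem1 {p k : ℕ} (N m : ℕ → ℕ) (hN : Tendsto N atTop atTop)
    (M : ∀ t, MixedModel (N t) (m t) p k) (W : ∀ t, Weights (N t) k)
    (Θ : Set (Fin k → ℝ)) (hΘ : IsOpen Θ) (hΘc : Convex ℝ Θ)
    (ψ₀ : Fin k → ℝ) (hψ₀ : ψ₀ ∈ Θ)
    (hreg : RegularModels N m M W Θ ψ₀)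
    {Ω : ℕ → Type*} [∀ t, MeasurableSpace (Ω t)]
    (μ : ∀ t, Measure (Ω t)) [∀ t, IsProbabilityMeasure (μ t)]
    (β : Fin p → ℝ) (Ke Kv S : ℝ)
    (ε : ∀ t, Ω t → Fin (N t) → ℝ) (v : ∀ t, Ω t → Fin (m t) → ℝ)
    (hlaw : ∀ t, (M t).ErrorLaw (μ t) ψ₀ Ke Kv S (ε t) (v t)) :
    (∀ (L : ∀ t, (Fin k → ℝ) → Matrix (Fin p) (Fin (N t)) ℝ) (ψhat : ∀ t, Ω t → Fin k → ℝ),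
      AdmissibleL N m M W Θ ψ₀ L →
      IsEstimator N m M W Θ L (fun t ω => (M t).obs β (ε t ω) (v t ω)) ψhat →
      (∀ᶠ t in atTop, IsUnit ((M t).A (W t) ψ₀).det ∧
        ∀ a, MemLp (fun ω => ψhat t ω a) 2 (μ t)) ∧
      (∀ a b, (fun t => covariance (fun ω => ψhat t ω a) (fun ω => ψhat t ω b) (μ t)
          - (M t).asympCov (W t) Ke Kv ψ₀ a b)
        =O[atTop] fun t => (N t : ℝ) ^ (-(3 / 2) : ℝ)) ∧
      (∀ a, (fun t => (∫ ω, (ψhat t ω a - ψ₀ a) ∂(μ t)) - (M t).asympBias (W t) Ke Kv ψ₀ a)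
        =O[atTop] fun t => (N t : ℝ) ^ (-(3 / 2) : ℝ))) ∧
    (∀ (L L' : ∀ t, (Fin k → ℝ) → Matrix (Fin p) (Fin (N t)) ℝ)
      (ψhat ψhat' : ∀ t, Ω t → Fin k → ℝ),
      AdmissibleL N m M W Θ ψ₀ L → AdmissibleL N m M W Θ ψ₀ L' →
      IsEstimator N m M W Θ L (fun t ω => (M t).obs β (ε t ω) (v t ω)) ψhat →
      IsEstimator N m M W Θ L' (fun t ω => (M t).obs β (ε t ω) (v t ω)) ψhat' →
      (∀ a b, (fun t => covariance (fun ω => ψhat t ω a) (fun ω => ψhat t ω b) (μ t)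
          - covariance (fun ω => ψhat' t ω a) (fun ω => ψhat' t ω b) (μ t))
        =O[atTop] fun t => (N t : ℝ) ^ (-(3 / 2) : ℝ)) ∧
      (∀ a, (fun t => (∫ ω, (ψhat t ω a - ψ₀ a) ∂(μ t)) - ∫ ω, (ψhat' t ω a - ψ₀ a) ∂(μ t))
        =O[atTop] fun t => (N t : ℝ) ^ (-(3 / 2) : ℝ))) := by
  have main : ∀ (L : ∀ t, (Fin k → ℝ) → Matrix (Fin p) (Fin (N t)) ℝ)
      (ψhat : ∀ t, Ω t → Fin k → ℝ), AdmissibleL N m M W Θ ψ₀ L →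
      IsEstimator N m M W Θ L (fun t ω => (M t).obs β (ε t ω) (v t ω)) ψhat →
      (∀ᶠ t in atTop, IsUnit ((M t).A (W t) ψ₀).det ∧
        ∀ a, MemLp (fun ω => ψhat t ω a) 2 (μ t)) ∧
      (∀ a b, (fun t => covariance (fun ω => ψhat t ω a) (fun ω => ψhat t ω b) (μ t)
          - (M t).asympCov (W t) Ke Kv ψ₀ a b)
        =O[atTop] fun t => (N t : ℝ) ^ (-(3 / 2) : ℝ)) ∧
      (∀ a, (fun t => (∫ ω, (ψhat t ω a - ψ₀ a) ∂(μ t)) - (M t).asympBias (W t) Ke Kv ψ₀ a)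
        =O[atTop] fun t => (N t : ℝ) ^ (-(3 / 2) : ℝ)) := by
    intro L ψhat hL hest
    obtain ⟨c, hc, hb⟩ := hreg.exists_modelBound hψ₀ hL
    obtain ⟨R, hR⟩ := hest.fallback
    -- R may be negative when there are no samples without a solution, hence |R|.
    obtain ⟨B, N₀, hB⟩ := exists_moment_bounds (p := p) c |R| S hc (abs_nonneg R) hΘ hΘc hψ₀
    have ev := (hb.and (hN.eventually_ge_atTop N₀)).mono fun t ht =>
      hB ht.2 ht.1 (hlaw t) β (hest.measurable t) (hest.solves t)
        fun ω h => (hR t ω h).trans (le_abs_self R)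
    have hpos : ∀ t, ‖(N t : ℝ) ^ (-(3 / 2) : ℝ)‖ = (N t : ℝ) ^ (-(3 / 2) : ℝ) := fun t =>
      Real.norm_of_nonneg (Real.rpow_nonneg (Nat.cast_nonneg _) _)
    exact ⟨ev.mono fun t ht => ⟨ht.1, ht.2.1⟩,
      fun a b => Asymptotics.IsBigO.of_bound B (ev.mono fun t ht => by
        rw [hpos]
        exact ht.2.2.1 a b),
      fun a => Asymptotics.IsBigO.of_bound B (ev.mono fun t ht => by
        rw [hpos]
        exact ht.2.2.2 a)⟩
  refine ⟨main, fun L L' ψhat ψhat' hL hL' hest hest' => ⟨fun a b => ?_, fun a => ?_⟩⟩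
  -- The leading term is the same for L and L', so it cancels in the difference.
  · refine (((main L ψhat hL hest).2.1 a b).sub ((main L' ψhat' hL' hest').2.1 a b)).congr_left
      fun t => ?_
    exact sub_sub_sub_cancel_right _ _ _
  · refine (((main L ψhat hL hest).2.2 a).sub ((main L' ψhat' hL' hest').2.2 a)).congr_left
      fun t => ?_
    exact sub_sub_sub_cancel_right _ _ _
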